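/- Let $\mathbb{T}^2=\mathbb{R}^2/\mathbb{Z}^2$, let $K\ge 2$, $\alpha\in(0,1)$, let $\varphi_1^{\mathrm{in}},\dots,\varphi_K^{\mathrm{in}}\in C^{1,\alpha}(\mathbb{T}^2)$ be real-valued functions (markers), and let $F:\mathbb{R}^K\to\mathbb{R}$ be smooth. Put $\omega_0=F(\varphi_1^{\mathrm{in}},\dots,\varphi_K^{\mathrm{in}})$. For a divergence-free velocity field $u$ on $[0,\infty)\times\mathbb{T}^2$ and a bounded $f_0$, call a measurable function $f$ on $[0,\infty)\times\mathbb{T}^2$ a bounded weak solution of $\partial_t f+u\cdot\nabla f=0$, $f|_{t=0}=f_0$, if $\sup_{0\le t\le T}\|f(t)\|_{L^\infty(\mathbb{T}^2)}<\infty$ for every $T$ and, for every $t\ge 0$ and every smooth $\eta$ on $\mathbb{R}\times\mathbb{T}^2$, $$\int_{\mathbb{T}^2} f(t)\,\eta(t)\,dx-\int_{\mathbb{T}^2} f_0\,\eta(0)\,dx=\int_0^t\!\int_{\mathbb{T}^2} f\,(\partial_t\eta+u\cdot\nabla\eta)\,dx\,ds .$$ Let $(\omega,u)$ be the (global) Yudovich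 solution of the two-dimensional Euler equation with initial vorticity $\omega_0$; that is, $\omega$ is a bounded weak solution of $$\partial_t\omega+u\cdot\nabla\omega=0,\qquad \omega|_{t=0}=\omega_0,$$ where $u\in L^1_{\mathrm{loc}}([0,\infty);L^1(\mathbb{T}^2;\mathbb{R}^2))$ and, for every $t\ge0$, $u=\nabla^\perp\psi=(\partial_2\psi,-\partial_1\psi)$ with $\psi(t)\in H^1(\mathbb{T}^2)$ a weak solution of $-\Delta\psi=\omega-\langle\omega\rangle$, $\langle\omega\rangle$ being the spatial mean of $\omega$. Then for each $k$ the transport equation $$\partial_t\varphi_k+u\cdot\nabla\varphi_k=0,\qquad \varphi_k|_{t=0}=\varphi_k^{\mathrm{in}},$$ has a bounded weak solution, and for all bounded weak solutions $\varphi_1,\dots,\varphi_K$ of these equations and every $t\ge0$, $$\omega(t,x)=F\bigl(\varphi_1(t,x),\dots,\varphi_K(t,x)\bigr)\qquad\text{for almost every }x\in\mathbb{T}^2 .$$ -/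

import Mathlib

open MeasureTheory Set

open scoped NNReal

/-- The two-dimensional torus `ℝ² / ℤ²`. Its `volume` is the normalised Lebesgue (Haar) measure,
of total mass one. -/
abbrev Torus2 : Type := UnitAddTorus (Fin 2)

namespace Torus2

/-- The quotient map `ℝ² → ℝ² / ℤ²`. -/
def proj (y : Fin 2 → ℝ) : Torus2 := fun i => (y i : UnitAddCircle)

/-- The partial derivative `∂ᵢ f` of a function on the torus. -/
noncomputable def partialDeriv (i : Fin 2) (f : Torus2 → ℝ) (x : Torus2) : ℝ :=
  deriv (fun s : ℝ => f (x + Pi.single i (s : UnitAddCircle))) 0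

/-- `f` is of class `C^n` on the torus: its `ℤ²`-periodic lift to `ℝ²` is of class `C^n`. -/
def IsCn (n : ℕ∞) (f : Torus2 → ℝ) : Prop :=
  ContDiff ℝ n (fun y : Fin 2 → ℝ => f (proj y))

/-- `f ∈ C^{1,α}(𝕋²)`: `f` is `C¹` and its first partial derivatives are `α`-Hölder. -/
def IsC1Holder (α : ℝ≥0) (f : Torus2 → ℝ) : Prop :=
  IsCn 1 f ∧ ∀ i, ∃ C : ℝ≥0, HolderWith C α (partialDeriv i f)

/-- A space-time test function: `η` is smooth on `ℝ × 𝕋²`. -/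
def IsSpaceTimeTest (η : ℝ → Torus2 → ℝ) : Prop :=
  ContDiff ℝ (⊤ : ℕ∞) (fun p : ℝ × (Fin 2 → ℝ) => η p.1 (proj p.2))

/-- `g` is the weak (distributional) gradient of `ψ` on the torus. -/
def IsWeakGradient (ψ : Torus2 → ℝ) (g : Torus2 → Fin 2 → ℝ) : Prop :=
  ∀ η : Torus2 → ℝ, IsCn ⊤ η → ∀ i, ∫ x, ψ x * partialDeriv i η x = -∫ x, g x i * η x

/-- `ψ ∈ H¹(𝕋²)`, with weak gradient `g`, is a weak solution of `-Δψ = w - ⟨w⟩`,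
where `⟨w⟩` is the spatial mean of `w`. -/
structure IsStreamFunction (w ψ : Torus2 → ℝ) (g : Torus2 → Fin 2 → ℝ) : Prop where
  memLp : MemLp ψ 2 volume
  memLp_grad : MemLp g 2 volume
  weakGradient : IsWeakGradient ψ g
  poisson : ∀ η : Torus2 → ℝ, IsCn ⊤ η →
    ∫ x, ∑ i, g x i * partialDeriv i η x = ∫ x, (w x - ∫ y, w y) * η x

/-- `v` is the velocity generated by the vorticity `w` through the Biot-Savart law:
`v = ∇^⊥ψ = (∂₂ψ, -∂₁ψ)` almost everywhere, where `-Δψ = w - ⟨w⟩`. With this orientation of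
`∇^⊥`, `curl v = ∂₁v₂ - ∂₂v₁ = w - ⟨w⟩`. -/
def IsBiotSavartVelocity (w : Torus2 → ℝ) (v : Torus2 → Fin 2 → ℝ) : Prop :=
  ∃ (ψ : Torus2 → ℝ) (g : Torus2 → Fin 2 → ℝ), IsStreamFunction w ψ g ∧
    ∀ᵐ x, v x = ![g x 1, -g x 0]

/-- `f` is a bounded weak solution on `[0,∞) × 𝕋²` of the transport equation
`∂ₜ f + u · ∇f = 0`, `f(0) = f₀`, for a divergence-free velocity field `u`: it is bounded on every
`[0,T] × 𝕋²`, and for every `t ≥ 0` and every smooth `η`,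
`∫ f(t) η(t) - ∫ f₀ η(0) = ∫₀ᵗ ∫ f (∂ₜ η + u · ∇η)`. -/
structure IsTransportSolution (u : ℝ → Torus2 → Fin 2 → ℝ) (f₀ : Torus2 → ℝ)
    (f : ℝ → Torus2 → ℝ) : Prop where
  measurable : AEStronglyMeasurable (fun p : ℝ × Torus2 => f p.1 p.2)
    ((volume.restrict (Ici 0)).prod volume)
  measurable_slice : ∀ t, 0 ≤ t → AEStronglyMeasurable (f t) volume
  bounded : ∀ T : ℝ, ∃ M : ℝ, ∀ t ∈ Icc 0 T, ∀ᵐ x, |f t x| ≤ M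
  weak_eq : ∀ η : ℝ → Torus2 → ℝ, IsSpaceTimeTest η → ∀ t, 0 ≤ t →
    (∫ x, f t x * η t x) - ∫ x, f₀ x * η 0 x =
      ∫ s in (0 : ℝ)..t, ∫ x, f s x *
        (deriv (fun r => η r x) s + ∑ i, u s x i * partialDeriv i (η s) x)

/-- `(ω, u)` is a (global) Yudovich solution of the two-dimensional Euler equation
`∂ₜ ω + u · ∇ω = 0`, `u = ∇^⊥ψ`, `-Δψ = ω - ⟨ω⟩`, with initial vorticity `ω₀`: the vorticity is a
bounded weak solution, and the velocity is given by the Biot-Savart law at every time. -/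
structure IsYudovichSolution (ω₀ : Torus2 → ℝ) (ω : ℝ → Torus2 → ℝ)
    (u : ℝ → Torus2 → Fin 2 → ℝ) : Prop where
  integrable_velocity : ∀ T : ℝ, Integrable (fun p : ℝ × Torus2 => u p.1 p.2)
    ((volume.restrict (Icc 0 T)).prod volume)
  biotSavart : ∀ t, 0 ≤ t → IsBiotSavartVelocity (ω t) (u t)
  transport : IsTransportSolution u ω₀ ω

end Torus2

/-! The vorticity `ω` and the markers `φ k` are bounded weak solutions of transport by one and the
same velocity. The core is joint renormalization, `integral_comp_eq_of_isTransportSolution`: for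
finitely many such solutions `f j` and every smooth `Φ` of several variables, `∫ Φ(f(t))` does not
depend on time. For `Φ(a) = (a₀ - F(a₁, …, a_K))²` this integral is zero initially, hence zero at
time `t`, which is the claim.

Renormalization follows DiPerna and Lions. On `[0, t]` the vorticity is bounded by a constant, so
Parseval and the Biot-Savart law give `‖v(· + z) - v‖² ≤ C (sin² πz₀ + sin² πz₁)` in `L²`, with `C`
uniform in time (`IsBiotSavartVelocity.sqIncrement_le`). The solutions are mollified by a kernel
proportional to `∏ cos²ᴺ(πzᵢ)`, and the error in the equation is a commutator. Its kernel has mean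
zero in `y`, so `f y` may be replaced by `f y - f x`. Since the squared derivative of the kernel is
at most the kernel times a weight with bounded second moment, a weighted AM-GM inequality bounds the
`L¹` norm of the commutator by `o(1) / l + C' l` for every `l > 0`
(`IsSobolevVelocity.integral_abs_commutator_le`), so this norm tends to zero. The kernel is a
trigonometric polynomial: a mollified solution is a finite sum of smooth functions of `x` times
pairings of the solution with fixed test functions. At fixed `x` it is absolutely continuous in
time, and the chain rule applies without any regularization in time.

Existence is by duality. Incompressibility gives `∫ |η(0)| ≤ ∫∫ |∂ₜη + u · ∇η|` for test functions
vanishing at late times, so Hahn-Banach and the duality of `L¹` and `L∞` produce a bounded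
space-time solution. The weak equation makes its pairings with test functions continuous in time
after correction on a null set of times, and this defines a slice at every `t ≥ 0`. -/

namespace Torus2

/-! ### Differential calculus on the torus through periodic lifts. -/

instance isProbabilityMeasure_unitAddCircle :
    IsProbabilityMeasure (volume : Measure UnitAddCircle) :=
  ⟨UnitAddCircle.measure_univ⟩

theorem volume_unitAddCircle_eq : (volume : Measure UnitAddCircle) = AddCircle.haarAddCircle := by
  rw [AddCircle.volume_eq_smul_haarAddCircle]; simp

instance isNegInvariant_unitAddCircle : (volume : Measure UnitAddCircle).IsNegInvariant := by
  rw [volume_unitAddCircle_eq]; infer_instance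

instance isProbabilityMeasure : IsProbabilityMeasure (volume : Measure Torus2) := by
  rw [volume_pi]; infer_instance

instance isNegInvariant : (volume : Measure Torus2).IsNegInvariant := by
  rw [volume_pi]; infer_instance

theorem proj_isOpenQuotientMap : IsOpenQuotientMap proj :=
  IsOpenQuotientMap.piMap (f := fun (_ : Fin 2) (y : ℝ) => (y : UnitAddCircle))
    fun _ => QuotientAddGroup.isOpenQuotientMap_mk

theorem proj_surjective : Function.Surjective proj := proj_isOpenQuotientMap.surjective

theorem proj_add_smul_single (y : Fin 2 → ℝ) (i : Fin 2) (s : ℝ) :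
    proj (y + s • Pi.single i (1 : ℝ)) = proj y + Pi.single i (s : UnitAddCircle) := by
  ext j
  rcases eq_or_ne j i with rfl | h
  · simp [proj]
  · simp [proj, h]

variable {n : ℕ∞} {f g : Torus2 → ℝ}

theorem IsCn.continuous (hf : IsCn n f) : Continuous f :=
  proj_isOpenQuotientMap.isQuotientMap.continuous_iff.2 (ContDiff.continuous hf)

theorem hasDerivAt_line (H : (Fin 2 → ℝ) → ℝ) (hH : Differentiable ℝ H) (y : Fin 2 → ℝ)
    (i : Fin 2) (s : ℝ) :
    HasDerivAt (fun r : ℝ => H (y + r • Pi.single i (1 : ℝ)))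
      (fderiv ℝ H (y + s • Pi.single i (1 : ℝ)) (Pi.single i 1)) s := by
  have h1 : HasDerivAt (fun r : ℝ => y + r • (Pi.single i (1 : ℝ) : Fin 2 → ℝ))
      (Pi.single i (1 : ℝ)) s := by
    simpa using ((hasDerivAt_id s).smul_const (Pi.single i (1 : ℝ) : Fin 2 → ℝ)).const_add y
  exact (hH _).hasFDerivAt.comp_hasDerivAt s h1

theorem partialDeriv_proj (hf : IsCn n f) (hn : n ≠ 0) (i : Fin 2) (y : Fin 2 → ℝ) :
    partialDeriv i f (proj y) = fderiv ℝ (fun y => f (proj y)) y (Pi.single i 1) := by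
  have h := hasDerivAt_line _ (ContDiff.differentiable hf (by exact_mod_cast hn)) y i 0
  simp only [proj_add_smul_single, zero_smul, add_zero] at h
  exact h.deriv

theorem IsCn.hasDerivAt_shift (hf : IsCn n f) (hn : n ≠ 0) (i : Fin 2) (x : Torus2) (s : ℝ) :
    HasDerivAt (fun r : ℝ => f (x + Pi.single i (r : UnitAddCircle)))
      (partialDeriv i f (x + Pi.single i (s : UnitAddCircle))) s := by
  obtain ⟨y, rfl⟩ := proj_surjective x
  have h := hasDerivAt_line _ (ContDiff.differentiable hf (by exact_mod_cast hn)) y i s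
  rw [← partialDeriv_proj hf hn] at h
  simpa only [proj_add_smul_single] using h

theorem IsCn.hasDerivAt (hf : IsCn n f) (hn : n ≠ 0) (i : Fin 2) (x : Torus2) :
    HasDerivAt (fun r : ℝ => f (x + Pi.single i (r : UnitAddCircle))) (partialDeriv i f x) 0 := by
  simpa using hf.hasDerivAt_shift hn i x 0

theorem IsCn.partialDeriv (hf : IsCn ⊤ f) (i : Fin 2) : IsCn ⊤ (partialDeriv i f) := by
  unfold IsCn
  simp only [partialDeriv_proj hf (by simp)]
  exact (ContDiff.fderiv_right (m := ((⊤ : ℕ∞) : WithTop ℕ∞)) hf (by simp)).clm_apply contDiff_const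

theorem partialDeriv_comm (hf : IsCn ⊤ f) (i j : Fin 2) :
    Torus2.partialDeriv i (Torus2.partialDeriv j f) =
      Torus2.partialDeriv j (Torus2.partialDeriv i f) := by
  have key : ∀ (i j : Fin 2) (y : Fin 2 → ℝ),
      Torus2.partialDeriv i (Torus2.partialDeriv j f) (proj y) =
        fderiv ℝ (fderiv ℝ fun y => f (proj y)) y (Pi.single i 1) (Pi.single j 1) := by
    intro i j y
    rw [partialDeriv_proj (hf.partialDeriv j) (by simp)]
    simp only [partialDeriv_proj hf (by simp)]
    have hd : Differentiable ℝ (fderiv ℝ fun y => f (proj y)) :=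
      (ContDiff.fderiv_right (m := ((⊤ : ℕ∞) : WithTop ℕ∞)) hf (by simp)).differentiable (by simp)
    rw [fderiv_clm_apply (hd y) (differentiableAt_const _)]
    simp
  funext x
  obtain ⟨y, rfl⟩ := proj_surjective x
  rw [key, key]
  have h2 : minSmoothness ℝ 2 ≤ ((⊤ : ℕ∞) : WithTop ℕ∞) := by
    rw [minSmoothness_of_isRCLikeNormedField]
    exact WithTop.coe_le_coe.2 le_top
  have : IsSymmSndFDerivAt ℝ (fun y => f (proj y)) y :=
    ContDiffAt.isSymmSndFDerivAt (ContDiff.contDiffAt hf) h2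
  exact this _ _

theorem isCn_const (c : ℝ) : IsCn n fun _ : Torus2 => c := contDiff_const

theorem IsCn.comp_pi {ι : Type*} [Fintype ι] {a : ι → Torus2 → ℝ} (ha : ∀ j, IsCn n (a j))
    {Φ : (ι → ℝ) → ℝ} (hΦ : ContDiff ℝ n Φ) : IsCn n fun x => Φ fun j => a j x :=
  hΦ.comp (contDiff_pi.2 ha)

theorem IsCn.comp {β : ℝ → ℝ} (hβ : ContDiff ℝ n β) (hf : IsCn n f) : IsCn n fun x => β (f x) :=
  ContDiff.comp hβ hf

theorem IsCn.add (hf : IsCn n f) (hg : IsCn n g) : IsCn n fun x => f x + g x :=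
  ContDiff.add hf hg

theorem IsCn.mul (hf : IsCn n f) (hg : IsCn n g) : IsCn n fun x => f x * g x :=
  ContDiff.mul hf hg

theorem IsCn.sum {ι : Type*} (s : Finset ι) {a : ι → Torus2 → ℝ} (ha : ∀ j ∈ s, IsCn n (a j)) :
    IsCn n fun x => ∑ j ∈ s, a j x :=
  ContDiff.sum ha

theorem partialDeriv_comp_pi {ι : Type*} [Fintype ι] {a : ι → Torus2 → ℝ}
    (ha : ∀ j, IsCn ⊤ (a j)) {Φ : (ι → ℝ) → ℝ} (hΦ : ContDiff ℝ (⊤ : ℕ∞) Φ) (i : Fin 2)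
    (x : Torus2) :
    partialDeriv i (fun x => Φ fun j => a j x) x =
      fderiv ℝ Φ (fun j => a j x) fun j => partialDeriv i (a j) x := by
  have h1 : HasDerivAt (fun (s : ℝ) j => a j (x + Pi.single i (s : UnitAddCircle)))
      (fun j => partialDeriv i (a j) x) 0 :=
    hasDerivAt_pi.2 fun j => (ha j).hasDerivAt (by simp) i x
  have h2 := (hΦ.differentiable (by simp) fun j => a j x).hasFDerivAt
  exact (HasFDerivAt.comp_hasDerivAt_of_eq (0 : ℝ) h2 h1 (by simp)).deriv

theorem partialDeriv_comp {β : ℝ → ℝ} (hβ : ContDiff ℝ (⊤ : ℕ∞) β) (hf : IsCn ⊤ f) (i : Fin 2)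
    (x : Torus2) :
    partialDeriv i (fun x => β (f x)) x = deriv β (f x) * partialDeriv i f x :=
  (HasDerivAt.comp_of_eq (0 : ℝ) (hβ.differentiable (by simp) (f x)).hasDerivAt
    (hf.hasDerivAt (by simp) i x) (by simp)).deriv

theorem partialDeriv_sum_mul {ι : Type*} (s : Finset ι) {a : ι → Torus2 → ℝ}
    (ha : ∀ j, IsCn ⊤ (a j)) (c : ι → ℝ) (i : Fin 2) (x : Torus2) :
    partialDeriv i (fun x => ∑ j ∈ s, a j x * c j) x = ∑ j ∈ s, partialDeriv i (a j) x * c j := by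
  have h : HasDerivAt (fun r : ℝ => ∑ j ∈ s, a j (x + Pi.single i (r : UnitAddCircle)) * c j)
      (∑ j ∈ s, partialDeriv i (a j) x * c j) 0 :=
    HasDerivAt.fun_sum fun j _ => ((ha j).hasDerivAt (by simp) i x).mul_const _
  exact h.deriv

theorem partialDeriv_comp_sub_right (f : Torus2 → ℝ) (y : Torus2) (i : Fin 2) (x : Torus2) :
    partialDeriv i (fun x => f (x - y)) x = partialDeriv i f (x - y) := by
  simp only [partialDeriv, sub_add_eq_add_sub]

theorem partialDeriv_comp_sub_left (hf : IsCn ⊤ f) (x : Torus2) (i : Fin 2) (y : Torus2) :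
    partialDeriv i (fun y => f (x - y)) y = -partialDeriv i f (x - y) := by
  have h := HasDerivAt.scomp_of_eq (0 : ℝ) (hf.hasDerivAt (by simp) i (x - y))
    (hasDerivAt_neg (0 : ℝ)) neg_zero.symm
  have h2 : (fun r : ℝ => f (x - (y + Pi.single i (r : UnitAddCircle)))) =
      (fun r : ℝ => f (x - y + Pi.single i (r : UnitAddCircle))) ∘ Neg.neg := by
    funext r
    simp only [Function.comp]
    congr 1
    rw [AddCircle.coe_neg, Pi.single_neg]
    abel
  rw [← h2] at h
  exact h.deriv.trans (by simp)

theorem _root_.Continuous.exists_forall_abs_le {X : Type*} [TopologicalSpace X] [CompactSpace X]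
    {f : X → ℝ} (hf : Continuous f) : ∃ C, 0 ≤ C ∧ ∀ x, |f x| ≤ C := by
  obtain ⟨C, hC⟩ := isCompact_univ.exists_bound_of_continuousOn hf.continuousOn
  exact ⟨max C 0, le_max_right _ _, fun x => (hC x (mem_univ x)).trans (le_max_left _ _)⟩

/-! Space-time test functions. -/

variable {η : ℝ → Torus2 → ℝ}

theorem prodMap_isOpenQuotientMap :
    IsOpenQuotientMap (Prod.map id proj : ℝ × (Fin 2 → ℝ) → ℝ × Torus2) :=
  IsOpenQuotientMap.id.prodMap proj_isOpenQuotientMap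

theorem IsSpaceTimeTest.continuous (h : IsSpaceTimeTest η) :
    Continuous fun p : ℝ × Torus2 => η p.1 p.2 :=
  prodMap_isOpenQuotientMap.isQuotientMap.continuous_iff.2 (ContDiff.continuous h)

theorem IsSpaceTimeTest.isCn (h : IsSpaceTimeTest η) (t : ℝ) : IsCn ⊤ (η t) :=
  ContDiff.comp (g := fun p : ℝ × (Fin 2 → ℝ) => η p.1 (proj p.2)) h
    (contDiff_const.prodMk contDiff_id)

theorem isSpaceTimeTest_of_isCn {ζ : Torus2 → ℝ} (h : IsCn ⊤ ζ) : IsSpaceTimeTest fun _ => ζ :=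
  ContDiff.comp (g := fun y : (Fin 2 → ℝ) => ζ (proj y)) h contDiff_snd

theorem IsSpaceTimeTest.hasDerivAt_proj (h : IsSpaceTimeTest η) (t : ℝ) (y : Fin 2 → ℝ) :
    HasDerivAt (fun r => η r (proj y))
      (fderiv ℝ (fun p : ℝ × (Fin 2 → ℝ) => η p.1 (proj p.2)) (t, y) (1, 0)) t := by
  have h1 : HasDerivAt (fun r : ℝ => (r, y)) (1, 0) t :=
    (hasDerivAt_id t).prodMk (hasDerivAt_const t y)
  exact (ContDiff.differentiable h (by simp) (t, y)).hasFDerivAt.comp_hasDerivAt t h1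

theorem IsSpaceTimeTest.hasDerivAt (h : IsSpaceTimeTest η) (t : ℝ) (x : Torus2) :
    HasDerivAt (fun r => η r x) (deriv (fun r => η r x) t) t := by
  obtain ⟨y, rfl⟩ := proj_surjective x
  exact (h.hasDerivAt_proj t y).differentiableAt.hasDerivAt

theorem IsSpaceTimeTest.continuous_deriv (h : IsSpaceTimeTest η) :
    Continuous fun p : ℝ × Torus2 => deriv (fun r => η r p.2) p.1 := by
  refine prodMap_isOpenQuotientMap.isQuotientMap.continuous_iff.2 ?_
  have : ((fun p : ℝ × Torus2 => deriv (fun r => η r p.2) p.1) ∘ Prod.map id proj) =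
      fun p => fderiv ℝ (fun p : ℝ × (Fin 2 → ℝ) => η p.1 (proj p.2)) p (1, 0) := by
    funext p
    exact (h.hasDerivAt_proj p.1 p.2).deriv
  rw [this]
  exact (ContDiff.continuous_fderiv h (by simp)).clm_apply continuous_const

theorem IsSpaceTimeTest.continuous_partialDeriv (h : IsSpaceTimeTest η) (i : Fin 2) :
    Continuous fun p : ℝ × Torus2 => partialDeriv i (η p.1) p.2 := by
  refine prodMap_isOpenQuotientMap.isQuotientMap.continuous_iff.2 ?_
  have : ((fun p : ℝ × Torus2 => partialDeriv i (η p.1) p.2) ∘ Prod.map id proj) =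
      fun p => fderiv ℝ (fun p : ℝ × (Fin 2 → ℝ) => η p.1 (proj p.2)) p (0, Pi.single i 1) := by
    funext p
    change partialDeriv i (η p.1) (proj p.2) = _
    rw [partialDeriv_proj (h.isCn p.1) (by simp)]
    have h1 : HasFDerivAt (fun y : Fin 2 → ℝ => (p.1, y))
        (ContinuousLinearMap.inr ℝ ℝ (Fin 2 → ℝ)) p.2 :=
      (hasFDerivAt_prodMk_right p.1 p.2)
    have h2 := (ContDiff.differentiable h (by simp) (p.1, p.2)).hasFDerivAt.comp p.2 h1
    have h3 := h2.fderiv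
    simp only [Function.comp_def] at h3
    rw [h3]
    simp
  rw [this]
  exact (ContDiff.continuous_fderiv h (by simp)).clm_apply continuous_const

end Torus2

/-! ### A trigonometric approximate identity and its moments. -/

namespace Torus2

/-- The function `cos² (π x)` on the circle. -/
noncomputable def cosSq (x : UnitAddCircle) : ℝ := (1 + (fourier 1 x : ℂ).re) / 2

theorem fourier_one_coe (y : ℝ) : (fourier 1 (y : UnitAddCircle) : ℂ) =
    Real.cos (2 * Real.pi * y) + Real.sin (2 * Real.pi * y) * Complex.I := by
  rw [fourier_coe_apply, Complex.ofReal_cos, Complex.ofReal_sin, ← Complex.exp_mul_I]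
  congr 1
  push_cast
  ring

theorem fourier_one_re_coe (y : ℝ) :
    (fourier 1 (y : UnitAddCircle) : ℂ).re = Real.cos (2 * Real.pi * y) := by
  rw [fourier_one_coe]; simp [-Complex.ofReal_cos, -Complex.ofReal_sin]

theorem fourier_one_im_coe (y : ℝ) :
    (fourier 1 (y : UnitAddCircle) : ℂ).im = Real.sin (2 * Real.pi * y) := by
  rw [fourier_one_coe]; simp [-Complex.ofReal_cos, -Complex.ofReal_sin]

theorem cosSq_coe (y : ℝ) : cosSq (y : UnitAddCircle) = (1 + Real.cos (2 * Real.pi * y)) / 2 := by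
  rw [cosSq, fourier_one_re_coe]

/-- The double-angle formula `sin² 2πy = 4 cos² πy sin² πy`. It is what lets the square of the
kernel's derivative be compared with the kernel itself. -/
theorem fourier_one_im_sq (x : UnitAddCircle) :
    (fourier 1 x : ℂ).im ^ 2 = 4 * (cosSq x * (1 - cosSq x)) := by
  induction x using QuotientAddGroup.induction_on with | H y =>
  rw [cosSq_coe, fourier_one_im_coe, Real.sin_sq]
  ring

theorem cosSq_nonneg (x : UnitAddCircle) : 0 ≤ cosSq x := by
  induction x using QuotientAddGroup.induction_on with | H y =>
  rw [cosSq_coe]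
  linarith [Real.neg_one_le_cos (2 * Real.pi * y)]

theorem cosSq_le_one (x : UnitAddCircle) : cosSq x ≤ 1 := by
  induction x using QuotientAddGroup.induction_on with | H y =>
  rw [cosSq_coe]
  linarith [Real.cos_le_one (2 * Real.pi * y)]

@[fun_prop]
theorem continuous_cosSq : Continuous cosSq := by
  unfold cosSq
  fun_prop

theorem cosSq_neg (x : UnitAddCircle) : cosSq (-x) = cosSq x := by
  simp [cosSq, AddCircle.toCircle_neg]

/-- The addition formula for the cosine; it is the source of the separability of the kernel. -/
theorem cosSq_sub (x y : UnitAddCircle) :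
    cosSq (x - y) = (1 + (fourier 1 x : ℂ).re * (fourier 1 y : ℂ).re +
      (fourier 1 x : ℂ).im * (fourier 1 y : ℂ).im) / 2 := by
  simp [cosSq, sub_eq_add_neg, AddCircle.toCircle_add, AddCircle.toCircle_neg]
  ring

theorem hasDerivAt_cosSq (x : UnitAddCircle) :
    HasDerivAt (fun r : ℝ => cosSq (x + r)) (-Real.pi * (fourier 1 x : ℂ).im) 0 := by
  induction x using QuotientAddGroup.induction_on with | H y =>
  change HasDerivAt (fun r : ℝ => cosSq ((y : UnitAddCircle) + r))
    (-Real.pi * (fourier 1 (y : UnitAddCircle) : ℂ).im) 0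
  rw [fourier_one_im_coe]
  simp only [← AddCircle.coe_add, cosSq_coe]
  have h : HasDerivAt (fun r : ℝ => 2 * Real.pi * (y + r)) (2 * Real.pi) 0 := by
    simpa using ((hasDerivAt_id (0 : ℝ)).const_add y).const_mul (2 * Real.pi)
  have h2 := (h.cos.const_add 1).div_const 2
  exact h2.congr_deriv (by rw [add_zero]; ring)

/-- The moments `∫ cos² (π x) ^ N` over the circle. -/
noncomputable def cosMoment (N : ℕ) : ℝ := ∫ x, cosSq x ^ N

theorem integrable_of_continuous {X : Type*} [TopologicalSpace X] [CompactSpace X]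
    [MeasurableSpace X] [OpensMeasurableSpace X] {μ : Measure X} [IsFiniteMeasure μ]
    {f : X → ℝ} (hf : Continuous f) : Integrable f μ :=
  hf.integrable_of_hasCompactSupport (HasCompactSupport.of_compactSpace f)

theorem cosMoment_zero : cosMoment 0 = 1 := by simp [cosMoment]

/-- Wallis' recursion: the derivative of `sin(2πy) cos²ᴺ(πy)` integrates to zero over a period. -/
theorem cosMoment_succ (N : ℕ) :
    (2 * N + 2) * cosMoment (N + 1) = (2 * N + 1) * cosMoment N := by
  have hI : ∀ M, cosMoment M = ∫ y in (0 : ℝ)..1, ((1 + Real.cos (2 * Real.pi * y)) / 2) ^ M := by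
    intro M
    rw [cosMoment, ← UnitAddCircle.intervalIntegral_preimage 0]
    simp [cosSq_coe]
  have hd : ∀ y : ℝ, HasDerivAt
      (fun y => Real.sin (2 * Real.pi * y) * ((1 + Real.cos (2 * Real.pi * y)) / 2) ^ N)
      (2 * Real.pi * ((2 * N + 2) * ((1 + Real.cos (2 * Real.pi * y)) / 2) ^ (N + 1)
        - (2 * N + 1) * ((1 + Real.cos (2 * Real.pi * y)) / 2) ^ N)) y := by
    intro y
    have h : HasDerivAt (fun r : ℝ => 2 * Real.pi * r) (2 * Real.pi) y := by
      simpa using (hasDerivAt_id y).const_mul (2 * Real.pi)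
    have h2 := h.sin.mul (((h.cos.const_add 1).div_const 2).pow N)
    refine HasDerivAt.congr_deriv h2 ?_
    simp only [Pi.pow_apply]
    have hs := Real.sin_sq_add_cos_sq (2 * Real.pi * y)
    generalize Real.cos (2 * Real.pi * y) = c at *
    generalize Real.sin (2 * Real.pi * y) = s at *
    -- The power rule produces the truncated exponent `N - 1`, hence the separate case `N = 0`.
    rcases N with _ | M
    · simp
      ring
    · simp only [Nat.add_sub_cancel]
      push_cast
      have : s ^ 2 = 1 - c ^ 2 := by linarith
      linear_combination (-(M + 1) * Real.pi * ((1 + c) / 2) ^ M) * this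
  have h0 := intervalIntegral.integral_eq_sub_of_hasDerivAt (a := 0) (b := 1)
    (fun y _ => hd y) (Continuous.intervalIntegrable (by fun_prop) _ _)
  rw [intervalIntegral.integral_const_mul, intervalIntegral.integral_sub
    (Continuous.intervalIntegrable (by fun_prop) _ _)
    (Continuous.intervalIntegrable (by fun_prop) _ _), intervalIntegral.integral_const_mul,
    intervalIntegral.integral_const_mul, ← hI, ← hI] at h0
  simp [Real.pi_ne_zero] at h0
  linarith

theorem cosMoment_pos (N : ℕ) : 0 < cosMoment N := by
  induction N with
  | zero => simp [cosMoment_zero]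
  | succ N ih =>
    have h := cosMoment_succ N
    have h1 : 0 < (2 * (N : ℝ) + 1) * cosMoment N := by positivity
    rw [← h] at h1
    exact pos_of_mul_pos_right h1 (by positivity)

/-- The approximate identity on the torus proportional to `∏ᵢ cos² (π zᵢ) ^ N`. -/
noncomputable def kernel (N : ℕ) (z : Torus2) : ℝ :=
  (cosSq (z 0) ^ N / cosMoment N) * (cosSq (z 1) ^ N / cosMoment N)

/-- The sum of the squares of the `sin (π zᵢ)`. -/
noncomputable def sinSq (z : Torus2) : ℝ := ∑ i, (1 - cosSq (z i))

/-- A weight whose product with the kernel bounds the square of a partial derivative of the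
kernel. -/
noncomputable def gradWeight (N : ℕ) (z : Torus2) : ℝ :=
  (2 * Real.pi * (N + 1)) ^ 2 *
    ((cosSq (z 0) ^ N * (1 - cosSq (z 0)) / cosMoment (N + 1)) *
        (cosSq (z 1) ^ (N + 1) / cosMoment (N + 1)) +
      (cosSq (z 0) ^ (N + 1) / cosMoment (N + 1)) *
        (cosSq (z 1) ^ N * (1 - cosSq (z 1)) / cosMoment (N + 1)))

theorem kernel_nonneg (N : ℕ) (z : Torus2) : 0 ≤ kernel N z := by
  have := cosSq_nonneg (z 0)
  have := cosSq_nonneg (z 1)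
  have := cosMoment_pos N
  unfold kernel
  positivity

theorem gradWeight_nonneg (N : ℕ) (z : Torus2) : 0 ≤ gradWeight N z := by
  have := cosSq_nonneg (z 0)
  have := cosSq_nonneg (z 1)
  have : 0 ≤ 1 - cosSq (z 0) := sub_nonneg.2 (cosSq_le_one _)
  have : 0 ≤ 1 - cosSq (z 1) := sub_nonneg.2 (cosSq_le_one _)
  have := cosMoment_pos (N + 1)
  unfold gradWeight
  positivity

theorem sinSq_nonneg (z : Torus2) : 0 ≤ sinSq z :=
  Finset.sum_nonneg fun _ _ => sub_nonneg.2 (cosSq_le_one _)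

theorem continuous_kernel (N : ℕ) : Continuous (kernel N) := by unfold kernel; fun_prop

theorem continuous_gradWeight (N : ℕ) : Continuous (gradWeight N) := by unfold gradWeight; fun_prop

theorem continuous_sinSq : Continuous sinSq := by unfold sinSq; fun_prop

theorem kernel_neg (N : ℕ) (z : Torus2) : kernel N (-z) = kernel N z := by
  simp [kernel, cosSq_neg]

theorem isCn_fourier_re (i : Fin 2) : IsCn ⊤ fun x => (fourier 1 (x i) : ℂ).re := by
  simp only [IsCn, proj, fourier_one_re_coe]
  fun_prop

theorem isCn_fourier_im (i : Fin 2) : IsCn ⊤ fun x => (fourier 1 (x i) : ℂ).im := by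
  simp only [IsCn, proj, fourier_one_im_coe]
  fun_prop

theorem isCn_kernel (N : ℕ) : IsCn ⊤ (kernel N) := by
  simp only [IsCn, kernel, proj, cosSq_coe]
  fun_prop

theorem partialDeriv_kernel_zero (N : ℕ) (z : Torus2) :
    partialDeriv 0 (kernel N) z =
      (N * cosSq (z 0) ^ (N - 1) * (-Real.pi * (fourier 1 (z 0) : ℂ).im) / cosMoment N) *
        (cosSq (z 1) ^ N / cosMoment N) := by
  have h := ((((hasDerivAt_cosSq (z 0)).pow N).div_const (cosMoment N)).mul_const
    (cosSq (z 1) ^ N / cosMoment N)).deriv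
  refine Eq.trans ?_ (h.trans ?_)
  · simp [partialDeriv, kernel]
  · simp

theorem partialDeriv_kernel_one (N : ℕ) (z : Torus2) :
    partialDeriv 1 (kernel N) z = (cosSq (z 0) ^ N / cosMoment N) *
      (N * cosSq (z 1) ^ (N - 1) * (-Real.pi * (fourier 1 (z 1) : ℂ).im) / cosMoment N) := by
  have h := ((((hasDerivAt_cosSq (z 1)).pow N).div_const (cosMoment N)).const_mul
    (cosSq (z 0) ^ N / cosMoment N)).deriv
  refine Eq.trans ?_ (h.trans ?_)
  · simp [partialDeriv, kernel]
  · simp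

theorem partialDeriv_kernel_neg (N : ℕ) (i : Fin 2) (z : Torus2) :
    partialDeriv i (kernel N) (-z) = -partialDeriv i (kernel N) z := by
  have him : ∀ x : UnitAddCircle, (fourier 1 (-x) : ℂ).im = -(fourier 1 x : ℂ).im := by
    intro x
    simp [AddCircle.toCircle_neg]
  fin_cases i
  · simp only [Fin.zero_eta, partialDeriv_kernel_zero, Pi.neg_apply, cosSq_neg, him]; ring
  · simp only [Fin.mk_one, partialDeriv_kernel_one, Pi.neg_apply, cosSq_neg, him]; ring

/-- By the double-angle formula the square equals the kernel times the summand of `gradWeight`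
belonging to the direction `i`; the other summand is nonnegative. The shift to `N + 1` keeps all
exponents honest. -/
theorem sq_partialDeriv_kernel_le (N : ℕ) (i : Fin 2) (z : Torus2) :
    partialDeriv i (kernel (N + 1)) z ^ 2 ≤ kernel (N + 1) z * gradWeight N z := by
  have h0 := fourier_one_im_sq (z 0)
  have h1 := fourier_one_im_sq (z 1)
  have c0 := cosSq_nonneg (z 0)
  have c1 := cosSq_nonneg (z 1)
  have s0 : 0 ≤ 1 - cosSq (z 0) := sub_nonneg.2 (cosSq_le_one _)
  have s1 : 0 ≤ 1 - cosSq (z 1) := sub_nonneg.2 (cosSq_le_one _)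
  have hI := cosMoment_pos (N + 1)
  fin_cases i
  · simp only [Fin.zero_eta, partialDeriv_kernel_zero, kernel, gradWeight, mul_add]
    refine le_add_of_le_of_nonneg (le_of_eq ?_) (by positivity)
    generalize (fourier 1 (z 0) : ℂ).im = s at *
    simp only [Nat.add_sub_cancel]
    push_cast
    have e1 : ∀ a b c d e : ℝ, (a * b * (-c * s) / d * e) ^ 2 =
        a ^ 2 * b ^ 2 * c ^ 2 / d ^ 2 * e ^ 2 * s ^ 2 := by
      intro a b c d e; ring
    rw [e1, h0]
    ring
  · simp only [Fin.mk_one, partialDeriv_kernel_one, kernel, gradWeight, mul_add]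
    refine le_add_of_nonneg_of_le (by positivity) (le_of_eq ?_)
    generalize (fourier 1 (z 1) : ℂ).im = s at *
    simp only [Nat.add_sub_cancel]
    push_cast
    have e1 : ∀ a b c d e : ℝ, (e * (a * b * (-c * s) / d)) ^ 2 =
        a ^ 2 * b ^ 2 * c ^ 2 / d ^ 2 * e ^ 2 * s ^ 2 := by
      intro a b c d e; ring
    rw [e1, h1]
    ring

theorem integral_mul_apply (f g : UnitAddCircle → ℝ) :
    ∫ z : Torus2, f (z 0) * g (z 1) = (∫ x, f x) * ∫ x, g x := by
  have h := integral_fintype_prod_volume_eq_prod (𝕜 := ℝ) (ι := Fin 2)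
    (E := fun _ => UnitAddCircle) ![f, g]
  simpa [Fin.prod_univ_two] using h

theorem integral_cosSq_pow_div (N : ℕ) : ∫ x, cosSq x ^ N / cosMoment N = 1 := by
  rw [integral_div, ← cosMoment, div_self (cosMoment_pos N).ne']

theorem integral_kernel (N : ℕ) : ∫ z, kernel N z = 1 := by
  simp only [kernel]
  rw [integral_mul_apply (fun x => cosSq x ^ N / cosMoment N) (fun x => cosSq x ^ N / cosMoment N),
    integral_cosSq_pow_div, mul_one]

theorem integral_cosSq_pow_mul (N : ℕ) :
    ∫ x, cosSq x ^ N * (1 - cosSq x) = cosMoment N / (2 * N + 2) := by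
  have : ∀ x, cosSq x ^ N * (1 - cosSq x) = cosSq x ^ N - cosSq x ^ (N + 1) := fun x => by ring
  simp only [this]
  rw [integral_sub (integrable_of_continuous (by fun_prop))
    (integrable_of_continuous (by fun_prop)), ← cosMoment, ← cosMoment]
  have h := cosMoment_succ N
  field_simp
  linarith

theorem integral_cosSq_pow_mul_sq (N : ℕ) :
    ∫ x, cosSq x ^ N * (1 - cosSq x) * (1 - cosSq x) =
      cosMoment N / (2 * N + 2) - cosMoment (N + 1) / (2 * N + 4) := by
  have : ∀ x, cosSq x ^ N * (1 - cosSq x) * (1 - cosSq x) =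
    cosSq x ^ N * (1 - cosSq x) - cosSq x ^ (N + 1) * (1 - cosSq x) := fun x => by ring
  simp only [this]
  rw [integral_sub (integrable_of_continuous (by fun_prop))
    (integrable_of_continuous (by fun_prop)), integral_cosSq_pow_mul, integral_cosSq_pow_mul]
  push_cast
  ring

/-- Each coordinate contributes `1 / (2N + 2)`, by Wallis' recursion. This decay expresses the
concentration of the kernel at the origin. -/
theorem integral_kernel_mul_sinSq (N : ℕ) : ∫ z, kernel N z * sinSq z = 1 / (N + 1) := by
  have : ∀ z, kernel N z * sinSq z =
      (cosSq (z 0) ^ N * (1 - cosSq (z 0)) / cosMoment N) * (cosSq (z 1) ^ N / cosMoment N) +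
      (cosSq (z 0) ^ N / cosMoment N) * (cosSq (z 1) ^ N * (1 - cosSq (z 1)) / cosMoment N) := by
    intro z
    simp only [kernel, sinSq, Fin.sum_univ_two]
    ring
  simp only [this]
  rw [integral_add (integrable_of_continuous (by fun_prop))
    (integrable_of_continuous (by fun_prop)),
    integral_mul_apply (fun x => cosSq x ^ N * (1 - cosSq x) / cosMoment N)
      (fun x => cosSq x ^ N / cosMoment N),
    integral_mul_apply (fun x => cosSq x ^ N / cosMoment N)
      (fun x => cosSq x ^ N * (1 - cosSq x) / cosMoment N), integral_cosSq_pow_div, integral_div,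
      integral_cosSq_pow_mul]
  have := (cosMoment_pos N).ne'
  field_simp
  ring

/-- The bound is uniform in `N`: the factor `(N + 1)²` coming from differentiation is compensated by
two factors `1 - cosSq`, each of mean of order `1 / N`. The exact value is `16π²` times `2(N + 1)² /
((2N + 1)(2N + 4))`. -/
theorem integral_gradWeight_mul_sinSq_le (N : ℕ) :
    ∫ z, gradWeight N z * sinSq z ≤ 16 * Real.pi ^ 2 := by
  have hI := (cosMoment_pos (N + 1))
  have : ∀ z, gradWeight N z * sinSq z = (2 * Real.pi * (N + 1)) ^ 2 *
      (((cosSq (z 0) ^ N * (1 - cosSq (z 0)) * (1 - cosSq (z 0)) / cosMoment (N + 1)) *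
        (cosSq (z 1) ^ (N + 1) / cosMoment (N + 1)) +
      (cosSq (z 0) ^ N * (1 - cosSq (z 0)) / cosMoment (N + 1)) *
        (cosSq (z 1) ^ (N + 1) * (1 - cosSq (z 1)) / cosMoment (N + 1))) +
      ((cosSq (z 0) ^ (N + 1) * (1 - cosSq (z 0)) / cosMoment (N + 1)) *
        (cosSq (z 1) ^ N * (1 - cosSq (z 1)) / cosMoment (N + 1)) +
      (cosSq (z 0) ^ (N + 1) / cosMoment (N + 1)) *
        (cosSq (z 1) ^ N * (1 - cosSq (z 1)) * (1 - cosSq (z 1)) / cosMoment (N + 1)))) := by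
    intro z
    simp only [gradWeight, sinSq, Fin.sum_univ_two]
    ring
  simp only [this]
  set I := cosMoment (N + 1) with hIdef
  rw [integral_const_mul, integral_add (integrable_of_continuous (by fun_prop))
    (integrable_of_continuous (by fun_prop)), integral_add (integrable_of_continuous (by fun_prop))
    (integrable_of_continuous (by fun_prop)), integral_add (integrable_of_continuous (by fun_prop))
    (integrable_of_continuous (by fun_prop)),
    integral_mul_apply (fun x => cosSq x ^ N * (1 - cosSq x) * (1 - cosSq x) / I)
      (fun x => cosSq x ^ (N + 1) / I),
    integral_mul_apply (fun x => cosSq x ^ N * (1 - cosSq x) / I)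
      (fun x => cosSq x ^ (N + 1) * (1 - cosSq x) / I),
    integral_mul_apply (fun x => cosSq x ^ (N + 1) * (1 - cosSq x) / I)
      (fun x => cosSq x ^ N * (1 - cosSq x) / I),
    integral_mul_apply (fun x => cosSq x ^ (N + 1) / I)
      (fun x => cosSq x ^ N * (1 - cosSq x) * (1 - cosSq x) / I),
    integral_div, integral_div, integral_div, integral_div, integral_cosSq_pow_mul_sq,
    integral_cosSq_pow_mul, integral_cosSq_pow_mul, ← cosMoment, ← hIdef]
  have h := cosMoment_succ N
  rw [← hIdef] at h
  have hN : cosMoment N = (2 * N + 2) / (2 * N + 1) * I := by field_simp; linarith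
  rw [hN]
  have : (2 * Real.pi * ((N : ℝ) + 1)) ^ 2 *
      (((2 * N + 2) / (2 * N + 1) * I / (2 * N + 2) - I / (2 * N + 4)) / I * (I / I) +
        (2 * N + 2) / (2 * N + 1) * I / (2 * N + 2) / I * (I / (2 * ((N + 1 : ℕ) : ℝ) + 2) / I) +
      (I / (2 * ((N + 1 : ℕ) : ℝ) + 2) / I * ((2 * N + 2) / (2 * N + 1) * I / (2 * N + 2) / I) +
        I / I * (((2 * N + 2) / (2 * N + 1) * I / (2 * N + 2) - I / (2 * N + 4)) / I))) =
      16 * Real.pi ^ 2 * ((2 * (N + 1) ^ 2) / ((2 * N + 1) * (2 * N + 4))) := by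
    push_cast
    field_simp
    ring
  rw [this]
  have : (2 * ((N : ℝ) + 1) ^ 2) / ((2 * N + 1) * (2 * N + 4)) ≤ 1 := by
    rw [div_le_one (by positivity)]
    nlinarith [(Nat.cast_nonneg N : (0 : ℝ) ≤ N)]
  nlinarith [Real.pi_pos, sq_nonneg Real.pi]

/-- A finite sum of products of smooth functions of each of the two variables. -/
def IsSeparable (κ : Torus2 → Torus2 → ℝ) : Prop :=
  ∃ (J : Type) (_ : Fintype J) (A B : J → Torus2 → ℝ), (∀ j, IsCn ⊤ (A j)) ∧
    (∀ j, IsCn ⊤ (B j)) ∧ ∀ x y, κ x y = ∑ j, A j x * B j y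

theorem IsSeparable.mul {κ κ' : Torus2 → Torus2 → ℝ} (h : IsSeparable κ) (h' : IsSeparable κ') :
    IsSeparable fun x y => κ x y * κ' x y := by
  obtain ⟨J, _, A, B, hA, hB, e⟩ := h
  obtain ⟨J', _, A', B', hA', hB', e'⟩ := h'
  refine ⟨J × J', inferInstance, fun p x => A p.1 x * A' p.2 x, fun p x => B p.1 x * B' p.2 x,
    fun p => (hA _).mul (hA' _), fun p => (hB _).mul (hB' _), fun x y => ?_⟩
  simp only [e, e']
  rw [Finset.sum_mul_sum, Fintype.sum_prod_type]
  exact Finset.sum_congr rfl fun _ _ => Finset.sum_congr rfl fun _ _ => by ring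

theorem isSeparable_const (c : ℝ) : IsSeparable fun _ _ => c :=
  ⟨Unit, inferInstance, fun _ _ => c, fun _ _ => 1, fun _ => isCn_const c, fun _ => isCn_const 1,
    fun x y => by simp⟩

theorem IsSeparable.pow {κ : Torus2 → Torus2 → ℝ} (h : IsSeparable κ) (N : ℕ) :
    IsSeparable fun x y => κ x y ^ N := by
  induction N with
  | zero => simpa using isSeparable_const 1
  | succ N ih => simpa only [pow_succ] using ih.mul h

theorem isSeparable_cosSq (i : Fin 2) : IsSeparable fun x y => cosSq (x i - y i) := by
  refine ⟨Fin 3, inferInstance,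
    ![fun _ => 1 / 2, fun x => (fourier 1 (x i) : ℂ).re * (1 / 2),
      fun x => (fourier 1 (x i) : ℂ).im * (1 / 2)],
    ![fun _ => 1, fun x => (fourier 1 (x i) : ℂ).re, fun x => (fourier 1 (x i) : ℂ).im],
    fun j => ?_, fun j => ?_, fun x y => ?_⟩
  · fin_cases j
    · exact isCn_const _
    · exact (isCn_fourier_re i).mul (isCn_const _)
    · exact (isCn_fourier_im i).mul (isCn_const _)
  · fin_cases j
    · exact isCn_const _
    · exact isCn_fourier_re i
    · exact isCn_fourier_im i
  · simp only [Fin.sum_univ_three, cosSq_sub, Matrix.cons_val]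
    ring

/-- The kernel is a polynomial in functions `cosSq (x i - y i)`, each separable. Mollification by it
therefore sees `f` only through finitely many pairings with test functions. -/
theorem isSeparable_kernel (N : ℕ) : IsSeparable fun x y => kernel N (x - y) := by
  have h := ((isSeparable_cosSq 0).pow N).mul (isSeparable_const (1 / cosMoment N))
  have h' := ((isSeparable_cosSq 1).pow N).mul (isSeparable_const (1 / cosMoment N))
  simpa [kernel, div_eq_mul_inv] using h.mul h'

end Torus2

/-! ### Parseval's identity and translation increments in `L²`. -/

namespace Torus2

-- Parseval. The measure is a variable with an equation so that `subst` replaces it everywhere by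
-- the product of normalised Haar measures, for which the `mFourier` series is stated.
open UnitAddTorus in
theorem hasSum_sq_norm_integral_mFourier {μ : Measure Torus2}
    (hμ : μ = Measure.pi fun _ => AddCircle.haarAddCircle) {f : Torus2 → ℂ} (hf : MemLp f 2 μ) :
    HasSum (fun k : Fin 2 → ℤ => ‖∫ x, mFourier (-k) x * f x ∂μ‖ ^ 2) (∫ x, ‖f x‖ ^ 2 ∂μ) := by
  subst hμ
  have h := hasSum_sq_mFourierCoeff (d := Fin 2) (hf.toLp f)
  have e := hf.coeFn_toLp
  have e1 : ∀ k : Fin 2 → ℤ, mFourierCoeff (d := Fin 2) (hf.toLp f) k =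
      ∫ x, mFourier (-k) x * f x ∂(Measure.pi fun _ => AddCircle.haarAddCircle) := by
    intro k
    refine integral_congr_ae ?_
    filter_upwards [e] with x hx
    rw [smul_eq_mul, hx]
  simp only [e1] at h
  convert h using 1
  refine integral_congr_ae ?_
  filter_upwards [e] with x hx
  rw [hx]

/-- The Fourier coefficients of a real function on the torus. -/
noncomputable def fourierCoef (f : Torus2 → ℝ) (k : Fin 2 → ℤ) : ℂ :=
  ∫ x, UnitAddTorus.mFourier (-k) x * (f x : ℂ)

theorem volume_eq_pi_haarAddCircle :
    (volume : Measure Torus2) = Measure.pi fun _ => AddCircle.haarAddCircle := by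
  rw [volume_pi, volume_unitAddCircle_eq]

theorem hasSum_sq_fourierCoef {f : Torus2 → ℝ} (hf : MemLp f 2 volume) :
    HasSum (fun k => ‖fourierCoef f k‖ ^ 2) (∫ x, f x ^ 2) := by
  have h := hasSum_sq_norm_integral_mFourier volume_eq_pi_haarAddCircle (hf.ofReal (K := ℂ))
  simpa [fourierCoef] using h

theorem mFourier_add_apply (k : Fin 2 → ℤ) (x y : Torus2) :
    UnitAddTorus.mFourier k (x + y) = UnitAddTorus.mFourier k x * UnitAddTorus.mFourier k y := by
  simp only [UnitAddTorus.mFourier, ContinuousMap.coe_mk, Fin.prod_univ_two, Pi.add_apply,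
    fourier_apply, smul_add, AddCircle.toCircle_add, Circle.coe_mul]
  ring

theorem mFourier_neg_apply (k : Fin 2 → ℤ) (x : Torus2) :
    UnitAddTorus.mFourier (-k) (-x) = UnitAddTorus.mFourier k x := by
  simp [UnitAddTorus.mFourier, fourier_apply]

theorem norm_mFourier_apply (k : Fin 2 → ℤ) (x : Torus2) : ‖UnitAddTorus.mFourier k x‖ = 1 := by
  simp only [UnitAddTorus.mFourier, ContinuousMap.coe_mk, fourier_apply, norm_prod,
    Circle.norm_coe, Finset.prod_const_one]

theorem integrable_mFourier_mul {f : Torus2 → ℝ} (hf : Integrable f) (k : Fin 2 → ℤ) :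
    Integrable fun x => UnitAddTorus.mFourier k x * (f x : ℂ) :=
  hf.ofReal.bdd_mul (UnitAddTorus.mFourier k).continuous.aestronglyMeasurable
    (Filter.Eventually.of_forall fun x => (norm_mFourier_apply k x).le)

theorem _root_.MeasureTheory.MemLp.comp_add_right_torus {f : Torus2 → ℝ} {p : ENNReal}
    (hf : MemLp f p volume) (z : Torus2) : MemLp (fun x => f (x + z)) p volume :=
  hf.comp_measurePreserving (measurePreserving_add_right volume z)

theorem fourierCoef_shift_sub {f : Torus2 → ℝ} (hf : Integrable f) (z : Torus2) (k : Fin 2 → ℤ) :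
    fourierCoef (fun x => f (x + z) - f x) k =
      (UnitAddTorus.mFourier k z - 1) * fourierCoef f k := by
  have hfz : Integrable fun x => f (x + z) := hf.comp_add_right z
  have h1 : ∫ x, UnitAddTorus.mFourier (-k) x * (f (x + z) : ℂ) =
      UnitAddTorus.mFourier k z * fourierCoef f k := by
    rw [fourierCoef, ← integral_const_mul,
      ← integral_add_right_eq_self (fun x => UnitAddTorus.mFourier k z *
        (UnitAddTorus.mFourier (-k) x * (f x : ℂ))) z]
    refine integral_congr_ae (Filter.Eventually.of_forall fun x => ?_)
    have : UnitAddTorus.mFourier (-k) x =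
        UnitAddTorus.mFourier k z * UnitAddTorus.mFourier (-k) (x + z) := by
      rw [← mFourier_neg_apply k z, mul_comm, ← mFourier_add_apply, add_neg_cancel_right]
    simp only
    rw [this, mul_assoc]
  simp only [fourierCoef, Complex.ofReal_sub, mul_sub]
  rw [integral_sub (integrable_mFourier_mul hfz _) (integrable_mFourier_mul hf _), h1, sub_mul,
    one_mul, fourierCoef]

/-- The square of the `L²` norm of the increment of `f` by a translation. -/
noncomputable def sqIncrement (f : Torus2 → ℝ) (z : Torus2) : ℝ := ∫ x, (f (x + z) - f x) ^ 2

theorem hasSum_sqIncrement {f : Torus2 → ℝ} (hf : MemLp f 2 volume) (z : Torus2) :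
    HasSum (fun k => ‖UnitAddTorus.mFourier k z - 1‖ ^ 2 * ‖fourierCoef f k‖ ^ 2)
      (sqIncrement f z) := by
  have h := hasSum_sq_fourierCoef ((hf.comp_add_right_torus z).sub hf)
  have hi : Integrable f := hf.integrable (by norm_num)
  have e : ∀ k, fourierCoef ((fun x => f (x + z)) - f) k =
    (UnitAddTorus.mFourier k z - 1) * fourierCoef f k := fun k => fourierCoef_shift_sub hi z k
  simp only [e, norm_mul, mul_pow] at h
  exact h

theorem norm_pow_sub_one_le {a : ℂ} (ha : ‖a‖ = 1) (n : ℕ) : ‖a ^ n - 1‖ ≤ n * ‖a - 1‖ := by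
  induction n with
  | zero => simp
  | succ n ih =>
    have : a ^ (n + 1) - 1 = a ^ n * (a - 1) + (a ^ n - 1) := by ring
    rw [this]
    refine (norm_add_le _ _).trans ?_
    rw [norm_mul, norm_pow, ha, one_pow, one_mul]
    push_cast
    linarith

theorem norm_fourier_sub_one_le (m : ℤ) (w : UnitAddCircle) :
    ‖(fourier m w : ℂ) - 1‖ ≤ |(m : ℝ)| * ‖(fourier 1 w : ℂ) - 1‖ := by
  have key : ∀ n : ℕ, ‖(fourier (n : ℤ) w : ℂ) - 1‖ ≤ n * ‖(fourier 1 w : ℂ) - 1‖ := by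
    intro n
    have : (fourier (n : ℤ) w : ℂ) = (fourier 1 w : ℂ) ^ n := by
      simp [fourier_apply, AddCircle.toCircle_nsmul]
    rw [this]
    exact norm_pow_sub_one_le (by rw [fourier_apply, Circle.norm_coe]) n
  obtain ⟨n, rfl | rfl⟩ := m.eq_nat_or_neg
  · simpa using key n
  · have : ‖(fourier (-(n : ℤ)) w : ℂ) - 1‖ = ‖(fourier (n : ℤ) w : ℂ) - 1‖ := by
      rw [fourier_neg, ← RCLike.norm_conj]
      simp
    rw [this]
    simpa using key n

theorem sq_norm_fourier_one_sub_one (w : UnitAddCircle) :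
    ‖(fourier 1 w : ℂ) - 1‖ ^ 2 = 4 * (1 - cosSq w) := by
  have h := fourier_one_im_sq w
  rw [← Complex.normSq_eq_norm_sq, Complex.normSq_apply]
  have hc : (fourier 1 w : ℂ).re = 2 * cosSq w - 1 := by rw [cosSq]; ring
  simp only [Complex.sub_re, Complex.sub_im, Complex.one_re, Complex.one_im, sub_zero, hc]
  linear_combination h

/-- Telescoping gives `|e^{2πimw} - 1| ≤ |m| |e^{2πiw} - 1|` in each coordinate, and `|e^{2πiw} -
1|² = 4 sin² πw`; Cauchy-Schwarz combines the coordinates. -/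
theorem sq_norm_mFourier_sub_one_le (k : Fin 2 → ℤ) (z : Torus2) :
    ‖UnitAddTorus.mFourier k z - 1‖ ^ 2 ≤ 4 * (∑ i, (k i : ℝ) ^ 2) * sinSq z := by
  have h : ‖UnitAddTorus.mFourier k z - 1‖ ≤
      ∑ i, |(k i : ℝ)| * ‖(fourier 1 (z i) : ℂ) - 1‖ := by
    have e : UnitAddTorus.mFourier k z - 1 =
        (fourier (k 0) (z 0) : ℂ) * ((fourier (k 1) (z 1) : ℂ) - 1) +
          ((fourier (k 0) (z 0) : ℂ) - 1) := by
      simp only [UnitAddTorus.mFourier, ContinuousMap.coe_mk, Fin.prod_univ_two]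
      ring
    rw [e, Fin.sum_univ_two]
    refine (norm_add_le _ _).trans ?_
    rw [norm_mul, fourier_apply, Circle.norm_coe, one_mul, add_comm]
    exact add_le_add (norm_fourier_sub_one_le _ _) (norm_fourier_sub_one_le _ _)
  refine (pow_le_pow_left₀ (norm_nonneg _) h 2).trans ?_
  refine (Finset.sum_mul_sq_le_sq_mul_sq _ _ _).trans (le_of_eq ?_)
  simp only [sq_abs, sq_norm_fourier_one_sub_one, sinSq, ← Finset.mul_sum]
  ring

theorem sq_norm_mFourier_sub_one_le_four (k : Fin 2 → ℤ) (z : Torus2) :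
    ‖UnitAddTorus.mFourier k z - 1‖ ^ 2 ≤ 4 := by
  have : ‖UnitAddTorus.mFourier k z - 1‖ ≤ 2 := by
    refine (norm_sub_le _ _).trans ?_
    rw [norm_mFourier_apply, norm_one]
    norm_num
  nlinarith [norm_nonneg (UnitAddTorus.mFourier k z - 1)]

theorem sqIncrement_nonneg (f : Torus2 → ℝ) (z : Torus2) : 0 ≤ sqIncrement f z :=
  integral_nonneg fun _ => sq_nonneg _

/-- The difference-quotient estimate for `H¹` on the Fourier side: the hypothesis plays the role of
`‖∇g‖ ≤ ‖w‖`, so no gradient of `g` has to be introduced. -/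
theorem sqIncrement_le_of_fourierCoef_le {g w : Torus2 → ℝ} (hg : MemLp g 2 volume)
    (hw : MemLp w 2 volume)
    (h : ∀ k, (∑ i, (k i : ℝ) ^ 2) * ‖fourierCoef g k‖ ^ 2 ≤ ‖fourierCoef w k‖ ^ 2)
    (z : Torus2) : sqIncrement g z ≤ 4 * sinSq z * ∫ x, w x ^ 2 := by
  refine hasSum_le (fun k => ?_) (hasSum_sqIncrement hg z)
    ((hasSum_sq_fourierCoef hw).mul_left (4 * sinSq z))
  calc ‖UnitAddTorus.mFourier k z - 1‖ ^ 2 * ‖fourierCoef g k‖ ^ 2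
      ≤ (4 * (∑ i, (k i : ℝ) ^ 2) * sinSq z) * ‖fourierCoef g k‖ ^ 2 := by
        gcongr; exact sq_norm_mFourier_sub_one_le k z
    _ = 4 * sinSq z * ((∑ i, (k i : ℝ) ^ 2) * ‖fourierCoef g k‖ ^ 2) := by ring
    _ ≤ _ := by
        have := sinSq_nonneg z
        gcongr
        exact h k

/-- Mean square oscillation of `f` at the scale of the kernel. -/
noncomputable def kernelOscillation (N : ℕ) (f : Torus2 → ℝ) : ℝ :=
  ∫ z, kernel N z * sqIncrement f z

/-- By Parseval the oscillation is the sum over `k` of `|f̂(k)|² ∫ K_N |e_k - 1|²`. Each term is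
`O(1 / (N + 1))` and is dominated by the summable `4 |f̂(k)|²`, so the limit passes through the sum.
-/
theorem tendsto_kernelOscillation {f : Torus2 → ℝ} (hf : MemLp f 2 volume) :
    Filter.Tendsto (fun N => kernelOscillation N f) Filter.atTop (nhds 0) := by
  set a : (Fin 2 → ℤ) → ℝ := fun k => ‖fourierCoef f k‖ ^ 2
  set q : (Fin 2 → ℤ) → Torus2 → ℝ := fun k z => ‖UnitAddTorus.mFourier k z - 1‖ ^ 2
  have hqc : ∀ k, Continuous (q k) := fun k => by fun_prop
  have hint : ∀ N k, Integrable fun z => kernel N z * (q k z * a k) := fun N k =>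
    integrable_of_continuous ((continuous_kernel N).mul ((hqc k).mul continuous_const))
  have hb : ∀ N k, ∫ z, kernel N z * (q k z * a k) ≤ 4 * a k := by
    intro N k
    calc ∫ z, kernel N z * (q k z * a k) ≤ ∫ z, kernel N z * (4 * a k) := by
          refine integral_mono (hint N k)
            (integrable_of_continuous ((continuous_kernel N).mul continuous_const)) fun z => ?_
          have := kernel_nonneg N z
          have : 0 ≤ a k := sq_nonneg _
          have := sq_norm_mFourier_sub_one_le_four k z
          simp only
          gcongr
      _ = 4 * a k := by rw [integral_mul_const, integral_kernel, one_mul]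
  have hb' : ∀ N k, ∫ z, kernel N z * (q k z * a k) ≤
      4 * (∑ i, (k i : ℝ) ^ 2) * a k * (1 / ((N : ℝ) + 1)) := by
    intro N k
    rw [← integral_kernel_mul_sinSq, ← integral_const_mul]
    refine integral_mono (hint N k) (integrable_of_continuous (continuous_const.mul
      ((continuous_kernel N).mul continuous_sinSq))) fun z => ?_
    have := kernel_nonneg N z
    have : 0 ≤ a k := sq_nonneg _
    have := sq_norm_mFourier_sub_one_le k z
    calc kernel N z * (q k z * a k)
        ≤ kernel N z * ((4 * (∑ i, (k i : ℝ) ^ 2) * sinSq z) * a k) := by gcongr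
      _ = _ := by ring
  have hnn : ∀ N k z, 0 ≤ kernel N z * (q k z * a k) := fun N k z =>
    mul_nonneg (kernel_nonneg N z) (mul_nonneg (sq_nonneg _) (sq_nonneg _))
  have hasum : Summable fun k => 4 * a k := (hasSum_sq_fourierCoef hf).summable.mul_left 4
  have hD : ∀ N, kernelOscillation N f = ∑' k, ∫ z, kernel N z * (q k z * a k) := by
    intro N
    have hs : Summable fun k => ∫ z, ‖kernel N z * (q k z * a k)‖ := by
      simp only [Real.norm_of_nonneg (hnn _ _ _)]
      exact hasum.of_nonneg_of_le (fun k => integral_nonneg (hnn N k)) (hb N)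
    rw [(hasSum_integral_of_summable_integral_norm (hint N) hs).tsum_eq, kernelOscillation]
    refine integral_congr_ae (Filter.Eventually.of_forall fun z => ?_)
    simp only
    rw [tsum_mul_left, (hasSum_sqIncrement hf z).tsum_eq]
  simp only [hD]
  rw [← tsum_zero (β := Fin 2 → ℤ) (α := ℝ)]
  refine tendsto_tsum_of_dominated_convergence hasum (fun k => ?_)
    (Filter.Eventually.of_forall fun N k => ?_)
  · refine squeeze_zero (fun N => integral_nonneg (hnn N k)) (fun N => hb' N k) ?_
    simpa using (tendsto_one_div_add_atTop_nhds_zero_nat (𝕜 := ℝ)).const_mul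
      (4 * (∑ i, (k i : ℝ) ^ 2) * a k)
  · rw [Real.norm_of_nonneg (integral_nonneg (hnn N k))]
    exact hb N k

/-! ### The Biot-Savart law -/

theorem mFourier_proj (k : Fin 2 → ℤ) (y : Fin 2 → ℝ) :
    UnitAddTorus.mFourier k (proj y) = Real.cos (2 * Real.pi * ∑ i, k i * y i) +
      Real.sin (2 * Real.pi * ∑ i, k i * y i) * Complex.I := by
  simp only [UnitAddTorus.mFourier, ContinuousMap.coe_mk, proj, fourier_coe_apply]
  rw [← Complex.exp_sum, Complex.ofReal_cos, Complex.ofReal_sin, ← Complex.exp_mul_I]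
  congr 1
  simp only [Fin.sum_univ_two]
  push_cast
  ring

theorem mFourier_re_proj (k : Fin 2 → ℤ) (y : Fin 2 → ℝ) :
    (UnitAddTorus.mFourier k (proj y)).re = Real.cos (2 * Real.pi * ∑ i, k i * y i) := by
  rw [mFourier_proj]; simp [-Complex.ofReal_cos, -Complex.ofReal_sin]

theorem mFourier_im_proj (k : Fin 2 → ℤ) (y : Fin 2 → ℝ) :
    (UnitAddTorus.mFourier k (proj y)).im = Real.sin (2 * Real.pi * ∑ i, k i * y i) := by
  rw [mFourier_proj]; simp [-Complex.ofReal_cos, -Complex.ofReal_sin]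

theorem isCn_mFourier_re (k : Fin 2 → ℤ) : IsCn ⊤ fun x => (UnitAddTorus.mFourier k x).re := by
  simp only [IsCn, mFourier_re_proj]
  fun_prop

theorem isCn_mFourier_im (k : Fin 2 → ℤ) : IsCn ⊤ fun x => (UnitAddTorus.mFourier k x).im := by
  simp only [IsCn, mFourier_im_proj]
  fun_prop

theorem hasDerivAt_phase (k : Fin 2 → ℤ) (y : Fin 2 → ℝ) (i : Fin 2) :
    HasDerivAt (fun r : ℝ => 2 * Real.pi * ∑ j, k j * (y + r • (Pi.single i (1 : ℝ) : Fin 2 → ℝ)) j)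
      (2 * Real.pi * k i) 0 := by
  have h : HasDerivAt (fun r : ℝ => 2 * Real.pi * (∑ j, k j * y j + r * k i))
      (2 * Real.pi * k i) 0 := by
    simpa using (((hasDerivAt_id (0 : ℝ)).mul_const (k i : ℝ)).const_add
      (∑ j, k j * y j)).const_mul (2 * Real.pi)
  convert h using 4 with r
  fin_cases i <;> simp <;> ring

theorem partialDeriv_mFourier_re (k : Fin 2 → ℤ) (i : Fin 2) (x : Torus2) :
    partialDeriv i (fun x => (UnitAddTorus.mFourier k x).re) x =
      -(2 * Real.pi * k i) * (UnitAddTorus.mFourier k x).im := by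
  obtain ⟨y, rfl⟩ := proj_surjective x
  simp only [partialDeriv, ← proj_add_smul_single, mFourier_re_proj, mFourier_im_proj]
  rw [(hasDerivAt_phase k y i).cos.deriv]
  simp only [zero_smul, add_zero]
  ring

theorem partialDeriv_mFourier_im (k : Fin 2 → ℤ) (i : Fin 2) (x : Torus2) :
    partialDeriv i (fun x => (UnitAddTorus.mFourier k x).im) x =
      (2 * Real.pi * k i) * (UnitAddTorus.mFourier k x).re := by
  obtain ⟨y, rfl⟩ := proj_surjective x
  simp only [partialDeriv, ← proj_add_smul_single, mFourier_re_proj, mFourier_im_proj]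
  rw [(hasDerivAt_phase k y i).sin.deriv]
  simp only [zero_smul, add_zero]
  ring

theorem sq_norm_fourierCoef {f : Torus2 → ℝ} (hf : Integrable f) (k : Fin 2 → ℤ) :
    ‖fourierCoef f k‖ ^ 2 = (∫ x, f x * (UnitAddTorus.mFourier (-k) x).re) ^ 2 +
      (∫ x, f x * (UnitAddTorus.mFourier (-k) x).im) ^ 2 := by
  have h := integrable_mFourier_mul hf (-k)
  have hre : (fourierCoef f k).re = ∫ x, f x * (UnitAddTorus.mFourier (-k) x).re := by
    rw [fourierCoef]
    refine (integral_re h).symm.trans (integral_congr_ae (Filter.Eventually.of_forall fun x => ?_))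
    simp [mul_comm]
  have him : (fourierCoef f k).im = ∫ x, f x * (UnitAddTorus.mFourier (-k) x).im := by
    rw [fourierCoef]
    refine (integral_im h).symm.trans (integral_congr_ae (Filter.Eventually.of_forall fun x => ?_))
    simp [mul_comm]
  rw [← Complex.normSq_eq_norm_sq, Complex.normSq_apply, hre, him]
  ring

theorem _root_.MeasureTheory.Integrable.mul_continuous_torus {f g : Torus2 → ℝ}
    (hf : Integrable f) (hg : Continuous g) : Integrable fun x => f x * g x := by
  obtain ⟨C, -, hC⟩ := hg.exists_forall_abs_le
  exact hf.mul_bdd hg.aestronglyMeasurable (Filter.Eventually.of_forall hC)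

variable {w ψ : Torus2 → ℝ} {g : Torus2 → Fin 2 → ℝ}

theorem IsStreamFunction.memLp_apply (h : IsStreamFunction w ψ g) (i : Fin 2) :
    MemLp (fun x => g x i) 2 volume :=
  memLp_pi_iff.1 h.memLp_grad i

/-- Testing with Fourier modes gives `|ĝᵢ| = 2π |kᵢ| |ψ̂|` and `4π² |k|² |ψ̂| = |ŵ|` for the
mean-free part of `w`. Test functions being real, the real and imaginary parts of the modes are used
separately. -/
theorem IsStreamFunction.fourierCoef_le (h : IsStreamFunction w ψ g) (hw : Integrable w)
    (i : Fin 2) (k : Fin 2 → ℤ) :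
    (∑ i, (k i : ℝ) ^ 2) * ‖fourierCoef (fun x => g x i) k‖ ^ 2 ≤
      ‖fourierCoef (fun x => w x - ∫ y, w y) k‖ ^ 2 := by
  have hgi : ∀ i, Integrable fun x => g x i := fun i => (h.memLp_apply i).integrable (by norm_num)
  have hwi : Integrable fun x => w x - ∫ y, w y := hw.sub (integrable_const _)
  have hcr := isCn_mFourier_re (-k)
  have hci := isCn_mFourier_im (-k)
  rw [sq_norm_fourierCoef (hgi i), sq_norm_fourierCoef hwi]
  have g1 : ∀ i, ∫ x, g x i * (UnitAddTorus.mFourier (-k) x).re =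
      -(2 * Real.pi * k i) * ∫ x, ψ x * (UnitAddTorus.mFourier (-k) x).im := by
    intro i
    have := h.weakGradient _ hcr i
    simp only [partialDeriv_mFourier_re, mul_left_comm (ψ _), integral_const_mul] at this
    simp at this ⊢
    linarith
  have g2 : ∀ i, ∫ x, g x i * (UnitAddTorus.mFourier (-k) x).im =
      (2 * Real.pi * k i) * ∫ x, ψ x * (UnitAddTorus.mFourier (-k) x).re := by
    intro i
    have := h.weakGradient _ hci i
    simp only [partialDeriv_mFourier_im, mul_left_comm (ψ _), integral_const_mul] at this
    simp at this ⊢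
    linarith
  have p1 := h.poisson _ hcr
  have p2 := h.poisson _ hci
  have hsr : ∀ i (c : ℝ), Integrable fun x => c * (g x i * (UnitAddTorus.mFourier (-k) x).re) :=
    fun i c => ((hgi i).mul_continuous_torus hcr.continuous).const_mul c
  have hsi : ∀ i (c : ℝ), Integrable fun x => c * (g x i * (UnitAddTorus.mFourier (-k) x).im) :=
    fun i c => ((hgi i).mul_continuous_torus hci.continuous).const_mul c
  simp only [partialDeriv_mFourier_re, mul_left_comm (g _ _)] at p1
  rw [integral_finsetSum _ fun i _ => hsi i _] at p1
  simp only [partialDeriv_mFourier_im, mul_left_comm (g _ _)] at p2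
  rw [integral_finsetSum _ fun i _ => hsr i _] at p2
  simp only [integral_const_mul, g1, g2, Fin.sum_univ_two] at p1 p2
  rw [← p1, ← p2, g1, g2, Fin.sum_univ_two]
  set A := ∫ x, ψ x * (UnitAddTorus.mFourier (-k) x).re
  set B := ∫ x, ψ x * (UnitAddTorus.mFourier (-k) x).im
  simp only [Pi.neg_apply, Int.cast_neg]
  -- The inequality is sharper by a factor `(2π)²` than needed; that factor is discarded.
  have hπ : 1 ≤ (2 * Real.pi) ^ 2 := by nlinarith [Real.pi_gt_three]
  set S := (k 0 : ℝ) ^ 2 + (k 1 : ℝ) ^ 2 with hS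
  have hki : (k i : ℝ) ^ 2 ≤ S := by
    fin_cases i
    · exact le_add_of_nonneg_right (sq_nonneg _)
    · exact le_add_of_nonneg_left (sq_nonneg _)
  have hS0 : 0 ≤ S := by positivity
  calc S * ((-(2 * Real.pi * k i) * B) ^ 2 + (2 * Real.pi * k i * A) ^ 2)
      = S * (2 * Real.pi) ^ 2 * (A ^ 2 + B ^ 2) * (k i : ℝ) ^ 2 := by ring
    _ ≤ S * (2 * Real.pi) ^ 2 * (A ^ 2 + B ^ 2) * S := by gcongr
    _ ≤ S * (2 * Real.pi) ^ 2 * (A ^ 2 + B ^ 2) * S * (2 * Real.pi) ^ 2 :=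
        le_mul_of_one_le_right (by positivity) hπ
    _ = _ := by rw [hS]; ring

theorem IsBiotSavartVelocity.exists_stream {v : Torus2 → Fin 2 → ℝ}
    (h : IsBiotSavartVelocity w v) : ∃ (ψ : Torus2 → ℝ) (g : Torus2 → Fin 2 → ℝ),
      IsStreamFunction w ψ g ∧ (fun x => v x 0) =ᵐ[volume] (fun x => g x 1) ∧
        (fun x => v x 1) =ᵐ[volume] (fun x => -g x 0) := by
  obtain ⟨ψ, g, hs, hv⟩ := h
  exact ⟨ψ, g, hs, hv.mono fun x hx => by simp [hx], hv.mono fun x hx => by simp [hx]⟩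

theorem IsBiotSavartVelocity.memLp {v : Torus2 → Fin 2 → ℝ} (h : IsBiotSavartVelocity w v)
    (i : Fin 2) : MemLp (fun x => v x i) 2 volume := by
  obtain ⟨ψ, g, hs, h0, h1⟩ := h.exists_stream
  fin_cases i
  · exact (memLp_congr_ae h0).2 (hs.memLp_apply 1)
  · exact (memLp_congr_ae h1).2 (hs.memLp_apply 0).neg

/-- A rotated gradient is divergence-free because `∂₀∂₁η = ∂₁∂₀η`; both derivatives fall on the test
function, since `ψ` is only in `H¹`. -/
theorem IsBiotSavartVelocity.integral_divergence {v : Torus2 → Fin 2 → ℝ}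
    (h : IsBiotSavartVelocity w v) {η : Torus2 → ℝ} (hη : IsCn ⊤ η) :
    ∫ x, ∑ i, v x i * partialDeriv i η x = 0 := by
  have hv : ∀ i, Integrable fun x => v x i := fun i => (h.memLp i).integrable (by norm_num)
  obtain ⟨ψ, g, hs, h0, h1⟩ := h.exists_stream
  rw [integral_finsetSum _ fun i _ => (hv i).mul_continuous_torus (hη.partialDeriv i).continuous,
    Fin.sum_univ_two]
  have e0 : ∫ x, v x 0 * partialDeriv 0 η x = ∫ x, g x 1 * partialDeriv 0 η x :=
    integral_congr_ae (h0.mono fun x hx => by simp only at hx ⊢; rw [hx])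
  have e1 : ∫ x, v x 1 * partialDeriv 1 η x = -∫ x, g x 0 * partialDeriv 1 η x := by
    rw [← integral_neg]
    exact integral_congr_ae (h1.mono fun x hx => by simp only at hx ⊢; rw [hx]; ring)
  have w0 := hs.weakGradient _ (hη.partialDeriv 0) 1
  have w1 := hs.weakGradient _ (hη.partialDeriv 1) 0
  rw [partialDeriv_comm hη 1 0] at w0
  rw [e0, e1]
  linarith

/-- The constant is `4 · (2M)²`: the vorticity minus its mean is bounded by `2M`, and the Fourier
estimate contributes the factor `4`. -/
theorem IsBiotSavartVelocity.sqIncrement_le {v : Torus2 → Fin 2 → ℝ}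
    (h : IsBiotSavartVelocity w v) (hw : AEStronglyMeasurable w volume) {M : ℝ}
    (hM : ∀ᵐ x, |w x| ≤ M) (i : Fin 2) (z : Torus2) :
    sqIncrement (fun x => v x i) z ≤ 16 * M ^ 2 * sinSq z := by
  have hM0 : 0 ≤ M := by
    obtain ⟨x, hx⟩ := hM.exists
    exact (abs_nonneg _).trans hx
  have hwL : MemLp w 2 volume := MemLp.of_bound hw M hM
  have hwi : Integrable w := hwL.integrable (by norm_num)
  have hmean : |∫ y, w y| ≤ M := by
    have := norm_integral_le_of_norm_le_const (μ := (volume : Measure Torus2))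
      (f := w) (C := M) hM
    simpa using this
  have hw' : ∀ᵐ x, |w x - ∫ y, w y| ≤ 2 * M := hM.mono fun x hx =>
    (abs_sub _ _).trans (by linarith)
  have hwL' : MemLp (fun x => w x - ∫ y, w y) 2 volume := hwL.sub (memLp_const _)
  have hsq : ∫ x, (w x - ∫ y, w y) ^ 2 ≤ 4 * M ^ 2 := by
    have := norm_integral_le_of_norm_le_const (μ := (volume : Measure Torus2))
      (f := fun x => (w x - ∫ y, w y) ^ 2) (C := 4 * M ^ 2)
      (hw'.mono fun x hx => by
        rw [Real.norm_of_nonneg (sq_nonneg _), ← sq_abs]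
        nlinarith [abs_nonneg (w x - ∫ y, w y)])
    simpa using (le_abs_self _).trans this
  obtain ⟨ψ, g, hs, h0, h1⟩ := h.exists_stream
  have hg : ∀ i, sqIncrement (fun x => g x i) z ≤ 16 * M ^ 2 * sinSq z := by
    intro i
    refine (sqIncrement_le_of_fourierCoef_le (hs.memLp_apply i) hwL'
      (hs.fourierCoef_le hwi i) z).trans ?_
    have := sinSq_nonneg z
    calc 4 * sinSq z * ∫ x, (w x - ∫ y, w y) ^ 2 ≤ 4 * sinSq z * (4 * M ^ 2) := by gcongr
      _ = _ := by ring
  have hz := (measurePreserving_add_right (volume : Measure Torus2) z).quasiMeasurePreserving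
  fin_cases i
  · refine le_of_eq_of_le (integral_congr_ae ?_) (hg 1)
    filter_upwards [h0, hz.ae h0] with x hx hx'
    simp only [Fin.zero_eta] at hx hx' ⊢
    rw [hx, hx']
  · refine le_of_eq_of_le (integral_congr_ae ?_) (hg 0)
    filter_upwards [h1, hz.ae h1] with x hx hx'
    simp only [Fin.mk_one] at hx hx' ⊢
    rw [hx, hx']
    ring

end Torus2

/-! ### The DiPerna-Lions commutator estimate. -/

namespace Torus2

theorem gradWeight_neg (N : ℕ) (z : Torus2) : gradWeight N (-z) = gradWeight N z := by
  simp [gradWeight, cosSq_neg]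

theorem integrable_weight_mul_sq_sub {w : Torus2 → ℝ} (hw : Continuous w) {f : Torus2 → ℝ}
    (hf : MemLp f 2 volume) :
    Integrable (fun p : Torus2 × Torus2 => w (p.1 - p.2) * (f p.2 - f p.1) ^ 2) := by
  obtain ⟨C, -, hC⟩ := hw.exists_forall_abs_le
  have h1 : MemLp (fun p : Torus2 × Torus2 => f p.1) 2 volume := hf.comp_fst volume
  have h2 : MemLp (fun p : Torus2 × Torus2 => f p.2) 2 volume := hf.comp_snd volume
  have h3 : Integrable fun p : Torus2 × Torus2 => (f p.2 - f p.1) ^ 2 :=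
    (h2.sub h1).integrable_sq
  exact h3.bdd_mul (c := C) (by fun_prop) (Filter.Eventually.of_forall fun p => hC _)

/-- Substitute `y = x + z`, which preserves the product measure, and integrate in `x` first;
evenness of `w` absorbs the sign of `x - y = -z`. -/
theorem integral_weight_mul_sq_sub {w : Torus2 → ℝ} (hw : Continuous w)
    (heven : ∀ z, w (-z) = w z) {f : Torus2 → ℝ} (hf : MemLp f 2 volume) :
    ∫ p : Torus2 × Torus2, w (p.1 - p.2) * (f p.2 - f p.1) ^ 2 = ∫ z, w z * sqIncrement f z := by
  have hmp : MeasurePreserving (fun p : Torus2 × Torus2 => (p.1, p.1 + p.2)) :=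
    measurePreserving_prod_add volume volume
  have hint := integrable_weight_mul_sq_sub hw hf
  have e : ∀ p : Torus2 × Torus2, w (p.1 - (p.1 + p.2)) * (f (p.1 + p.2) - f p.1) ^ 2 =
      w p.2 * (f (p.1 + p.2) - f p.1) ^ 2 := fun p => by simp [heven]
  have hint' : Integrable fun p : Torus2 × Torus2 => w p.2 * (f (p.1 + p.2) - f p.1) ^ 2 :=
    (hmp.integrable_comp_of_integrable hint).congr (Filter.Eventually.of_forall e)
  rw [← hmp.map_eq, integral_map hmp.aemeasurable (by rw [hmp.map_eq]; exact hint.1)]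
  simp only [e]
  rw [Measure.volume_eq_prod, integral_prod_symm _ hint']
  simp only [integral_const_mul, sqIncrement]

theorem integral_partialDeriv_kernel_sub (N : ℕ) (i : Fin 2) (x : Torus2) :
    ∫ y, partialDeriv i (kernel N) (x - y) = 0 := by
  rw [integral_sub_left_eq_self (fun z => partialDeriv i (kernel N) z) volume x]
  have h := integral_neg_eq_self (fun z => partialDeriv i (kernel N) z) (volume : Measure Torus2)
  simp only [partialDeriv_kernel_neg, integral_neg] at h
  linarith

theorem continuous_partialDeriv_kernel (N : ℕ) (i : Fin 2) :
    Continuous (partialDeriv i (kernel N)) :=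
  ((isCn_kernel N).partialDeriv i).continuous

theorem isCn_kernel_sub (N : ℕ) (x : Torus2) : IsCn ⊤ fun y => kernel N (x - y) := by
  obtain ⟨J, _, A, B, -, hB, e⟩ := isSeparable_kernel N
  simp only [e]
  exact IsCn.sum _ fun j _ => (isCn_const _).mul (hB j)

/-- A velocity field on the torus which is square integrable, weakly divergence-free, and has a
square integrable modulus of continuity of the size allowed by a square integrable gradient. -/
structure IsSobolevVelocity (C : ℝ) (v : Torus2 → Fin 2 → ℝ) : Prop where
  memLp : ∀ i, MemLp (fun x => v x i) 2 volume
  divergence : ∀ η : Torus2 → ℝ, IsCn ⊤ η → ∫ x, ∑ i, v x i * partialDeriv i η x = 0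
  sqIncrement_le : ∀ i z, sqIncrement (fun x => v x i) z ≤ C * sinSq z

/-- The commutator of the mollification by the kernel with the derivative along `v`. -/
noncomputable def commutator (N : ℕ) (v : Torus2 → Fin 2 → ℝ) (f : Torus2 → ℝ) (x : Torus2) : ℝ :=
  ∫ y, f y * ∑ i, (v x i - v y i) * partialDeriv i (kernel N) (x - y)

variable {C : ℝ} {v : Torus2 → Fin 2 → ℝ}

theorem IsSobolevVelocity.integrable (h : IsSobolevVelocity C v) (i : Fin 2) :
    Integrable fun x => v x i :=
  (h.memLp i).integrable (by norm_num)

theorem IsSobolevVelocity.integrable_commutator_kernel (h : IsSobolevVelocity C v) (N : ℕ)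
    (x : Torus2) :
    Integrable fun y => ∑ i, (v x i - v y i) * partialDeriv i (kernel N) (x - y) :=
  integrable_finsetSum _ fun i _ => Integrable.mul_continuous_torus
    ((integrable_const _).sub (h.integrable i))
    ((continuous_partialDeriv_kernel N i).comp (continuous_const.sub continuous_id))

/-- The part with `v x` vanishes because the derivative of the even kernel is odd, the part with `v
y` because `v` is divergence-free. This is the cancellation behind the commutator estimate. -/
theorem IsSobolevVelocity.integral_commutator_kernel (h : IsSobolevVelocity C v) (N : ℕ)
    (x : Torus2) :
    ∫ y, ∑ i, (v x i - v y i) * partialDeriv i (kernel N) (x - y) = 0 := by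
  have hc : ∀ i, Continuous fun y => partialDeriv i (kernel N) (x - y) := fun i =>
    (continuous_partialDeriv_kernel N i).comp (continuous_const.sub continuous_id)
  have h1 := h.divergence _ (isCn_kernel_sub N x)
  simp only [partialDeriv_comp_sub_left (isCn_kernel N)] at h1
  have h2 : ∫ y, ∑ i, v x i * partialDeriv i (kernel N) (x - y) = 0 := by
    rw [integral_finsetSum _ fun i _ => (integrable_of_continuous (hc i)).const_mul _]
    simp [integral_const_mul, integral_partialDeriv_kernel_sub]
  have i2 : Integrable fun y => ∑ i, v x i * partialDeriv i (kernel N) (x - y) :=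
    integrable_finsetSum _ fun i _ => (integrable_of_continuous (hc i)).const_mul _
  have i1 : Integrable fun y => ∑ i, v y i * -partialDeriv i (kernel N) (x - y) :=
    integrable_finsetSum _ fun i _ => (h.integrable i).mul_continuous_torus (hc i).neg
  have e : ∀ y, ∑ i, (v x i - v y i) * partialDeriv i (kernel N) (x - y) =
      (∑ i, v x i * partialDeriv i (kernel N) (x - y)) +
        ∑ i, v y i * -partialDeriv i (kernel N) (x - y) := by
    intro y
    rw [← Finset.sum_add_distrib]
    exact Finset.sum_congr rfl fun i _ => by ring
  simp only [e]
  rw [integral_add i2 i1, h1, h2, add_zero]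

theorem abs_mul_mul_le_of_sq_le {a b d p q l : ℝ} (hp : 0 ≤ p) (hq : 0 ≤ q) (hl : 0 < l)
    (h : d ^ 2 ≤ p * q) : |a * (b * d)| ≤ (p * a ^ 2 / l + l * (q * b ^ 2)) / 2 := by
  refine abs_le_of_sq_le_sq ?_ (by positivity)
  have h1 : (a * (b * d)) ^ 2 ≤ (p * a ^ 2) * (q * b ^ 2) := by
    calc (a * (b * d)) ^ 2 = a ^ 2 * b ^ 2 * d ^ 2 := by ring
      _ ≤ a ^ 2 * b ^ 2 * (p * q) := by gcongr
      _ = _ := by ring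
  refine h1.trans ?_
  have e : p * a ^ 2 * (q * b ^ 2) = (p * a ^ 2 / l) * (l * (q * b ^ 2)) := by field_simp
  rw [e]
  nlinarith [sq_nonneg (p * a ^ 2 / l - l * (q * b ^ 2))]

/-- After `f y` is replaced by `f y - f x`, AM-GM with parameter `l` splits the integrand into
kernel times `(f y - f x)²` and `gradWeight` times `(v y - v x)²`. The first part is the oscillation
of `f`, which tends to zero with `N`; the second is bounded uniformly in `N` by the modulus of
continuity of `v`. -/
theorem IsSobolevVelocity.integral_abs_commutator_le (h : IsSobolevVelocity C v)
    {f : Torus2 → ℝ} (hf : MemLp f ⊤ volume) (N : ℕ) {l : ℝ} (hl : 0 < l) :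
    ∫ x, |commutator (N + 1) v f x| ≤
      kernelOscillation (N + 1) f / l + 16 * Real.pi ^ 2 * C * l := by
  have hf2 : MemLp f 2 volume := hf.mono_exponent le_top
  have hC0 : 0 ≤ C := by
    -- Nonnegativity of `C` is read off from the increment bound at the half-period `z = (1/2,
    -- 1/2)`, where `sinSq z = 2`.
    have h1 := h.sqIncrement_le 0 (fun _ => ((1 / 2 : ℝ) : UnitAddCircle))
    have h2 := sqIncrement_nonneg (fun x => v x 0) (fun _ => ((1 / 2 : ℝ) : UnitAddCircle))
    have h3 : sinSq (fun _ => ((1 / 2 : ℝ) : UnitAddCircle)) = 2 := by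
      simp only [sinSq, cosSq_coe, Fin.sum_univ_two]
      rw [show 2 * Real.pi * (1 / 2) = Real.pi by ring, Real.cos_pi]
      norm_num
    rw [h3] at h1
    linarith
  -- The AM-GM majorant. Summing over the two components of `v` cancels the factor `1/2`.
  set H : Torus2 × Torus2 → ℝ := fun p => ∑ i : Fin 2,
    (kernel (N + 1) (p.1 - p.2) * (f p.2 - f p.1) ^ 2 / l +
      l * (gradWeight N (p.1 - p.2) * (v p.2 i - v p.1 i) ^ 2)) / 2 with hH
  have i1 := integrable_weight_mul_sq_sub (continuous_kernel (N + 1)) hf2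
  have i2 := fun i => integrable_weight_mul_sq_sub (continuous_gradWeight N) (h.memLp i)
  have hHint : Integrable H := integrable_finsetSum _ fun i _ =>
    ((i1.div_const l).add ((i2 i).const_mul l)).div_const 2
  have hHval : ∫ p, H p ≤ kernelOscillation (N + 1) f / l + 16 * Real.pi ^ 2 * C * l := by
    have i3 : ∀ i, Integrable fun p : Torus2 × Torus2 =>
        (kernel (N + 1) (p.1 - p.2) * (f p.2 - f p.1) ^ 2 / l +
          l * (gradWeight N (p.1 - p.2) * (v p.2 i - v p.1 i) ^ 2)) / 2 :=
      fun i => ((i1.div_const l).add ((i2 i).const_mul l)).div_const 2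
    simp only [hH]
    rw [integral_finsetSum _ fun i _ => i3 i]
    have hs : ∀ i, ∫ p : Torus2 × Torus2, gradWeight N (p.1 - p.2) * (v p.2 i - v p.1 i) ^ 2 ≤
        C * (16 * Real.pi ^ 2) := by
      intro i
      rw [integral_weight_mul_sq_sub (continuous_gradWeight N) (gradWeight_neg N) (h.memLp i)]
      calc ∫ z, gradWeight N z * sqIncrement (fun x => v x i) z
          ≤ ∫ z, C * (gradWeight N z * sinSq z) := by
            refine integral_mono_of_nonneg
              (Filter.Eventually.of_forall fun z => mul_nonneg (gradWeight_nonneg N z)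
                (sqIncrement_nonneg _ z))
              (integrable_of_continuous (continuous_const.mul
                ((continuous_gradWeight N).mul continuous_sinSq)))
              (Filter.Eventually.of_forall fun z => ?_)
            have h1 := h.sqIncrement_le i z
            have h2 := gradWeight_nonneg N z
            calc _ ≤ gradWeight N z * (C * sinSq z) := by simp only; gcongr
              _ = _ := by ring
        _ ≤ _ := by
            rw [integral_const_mul]
            have := integral_gradWeight_mul_sinSq_le N
            gcongr
    have hv : ∀ i, ∫ p : Torus2 × Torus2, (kernel (N + 1) (p.1 - p.2) * (f p.2 - f p.1) ^ 2 / l +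
        l * (gradWeight N (p.1 - p.2) * (v p.2 i - v p.1 i) ^ 2)) / 2 ≤
          (kernelOscillation (N + 1) f / l + l * (C * (16 * Real.pi ^ 2))) / 2 := by
      intro i
      rw [integral_div, integral_add (i1.div_const l) ((i2 i).const_mul l), integral_div,
        integral_const_mul,
        integral_weight_mul_sq_sub (continuous_kernel _) (kernel_neg _) hf2, ← kernelOscillation]
      have := hs i
      gcongr
    refine (Finset.sum_le_sum fun i _ => hv i).trans (le_of_eq ?_)
    simp
    ring
  have hae : ∀ᵐ x, |commutator (N + 1) v f x| ≤ ∫ y, H (x, y) := by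
    filter_upwards [hHint.prod_right_ae] with x hx
    have hk := h.integrable_commutator_kernel (N + 1) x
    have e : commutator (N + 1) v f x = ∫ y, (f y - f x) *
        ∑ i, (v x i - v y i) * partialDeriv i (kernel (N + 1)) (x - y) := by
      have hfk : Integrable fun y => f y *
          ∑ i, (v x i - v y i) * partialDeriv i (kernel (N + 1)) (x - y) :=
        hk.smul_of_top_right hf
      simp only [sub_mul (f _)]
      rw [integral_sub hfk (hk.const_mul _), integral_const_mul, h.integral_commutator_kernel,
        mul_zero, sub_zero, commutator]
    rw [e]
    refine (abs_integral_le_integral_abs).trans (integral_mono_of_nonneg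
      (Filter.Eventually.of_forall fun y => abs_nonneg _) hx
      (Filter.Eventually.of_forall fun y => ?_))
    simp only [hH, Finset.mul_sum]
    refine (Finset.abs_sum_le_sum_abs _ _).trans (Finset.sum_le_sum fun i _ => ?_)
    have := abs_mul_mul_le_of_sq_le (a := f y - f x) (b := v x i - v y i)
      (kernel_nonneg (N + 1) (x - y))
      (gradWeight_nonneg N (x - y)) hl (sq_partialDeriv_kernel_le N i (x - y))
    rwa [sub_sq_comm (v x i)] at this
  calc ∫ x, |commutator (N + 1) v f x| ≤ ∫ x, ∫ y, H (x, y) :=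
        integral_mono_of_nonneg (Filter.Eventually.of_forall fun x => abs_nonneg _)
          hHint.integral_prod_left hae
    _ = ∫ p, H p := (integral_prod _ hHint).symm
    _ ≤ _ := hHval

/-- Choose `l` small first, then `N` large depending on `l`. -/
theorem tendsto_zero_of_le_div_add_mul {c D : ℕ → ℝ} {K : ℝ} (hc : ∀ N, 0 ≤ c N)
    (hD : Filter.Tendsto D Filter.atTop (nhds 0)) (h : ∀ N l, 0 < l → c N ≤ D N / l + K * l) :
    Filter.Tendsto c Filter.atTop (nhds 0) := by
  rw [Metric.tendsto_atTop]
  intro ε hε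
  obtain ⟨l, hl, hlε⟩ : ∃ l : ℝ, 0 < l ∧ |K| * l < ε / 2 := by
    refine ⟨ε / 2 / (|K| + 1), by positivity, ?_⟩
    rw [mul_div_assoc', div_lt_iff₀ (by positivity)]
    nlinarith
  obtain ⟨N₀, hN₀⟩ := Metric.tendsto_atTop.1 (hD.div_const l) (ε / 2) (by positivity)
  refine ⟨N₀, fun N hN => ?_⟩
  have h1 := h N l hl
  have h2 := hN₀ N hN
  rw [Real.dist_eq, zero_div, sub_zero] at h2
  rw [Real.dist_eq, sub_zero, abs_of_nonneg (hc N)]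
  have h4 : K * l ≤ |K| * l := by
    gcongr
    exact le_abs_self K
  linarith [le_abs_self (D N / l)]

theorem tendsto_integral_abs_commutator (h : IsSobolevVelocity C v)
    {f : Torus2 → ℝ} (hf : MemLp f ⊤ volume) :
    Filter.Tendsto (fun N => ∫ x, |commutator (N + 1) v f x|) Filter.atTop (nhds 0) :=
  tendsto_zero_of_le_div_add_mul (fun _ => integral_nonneg fun _ => abs_nonneg _)
    ((tendsto_kernelOscillation (hf.mono_exponent le_top)).comp (Filter.tendsto_add_atTop_nat 1))
    fun N _ hl => h.integral_abs_commutator_le hf N hl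

/-- A bound free of `N`; it supplies the dominating constant when the commutators are integrated in
time. -/
theorem kernelOscillation_le {f : Torus2 → ℝ} {M : ℝ} (hM : ∀ᵐ x, |f x| ≤ M) (N : ℕ) :
    kernelOscillation N f ≤ 4 * M ^ 2 := by
  have h : ∀ z, sqIncrement f z ≤ 4 * M ^ 2 := by
    intro z
    have hz := (measurePreserving_add_right (volume : Measure Torus2) z).quasiMeasurePreserving
    have := norm_integral_le_of_norm_le_const (μ := (volume : Measure Torus2))
      (f := fun x => (f (x + z) - f x) ^ 2) (C := 4 * M ^ 2) (by
        filter_upwards [hM, hz.ae hM] with x hx hx'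
        rw [Real.norm_of_nonneg (sq_nonneg _)]
        rw [abs_le] at hx hx'
        nlinarith)
    rw [sqIncrement]
    simpa using (le_abs_self _).trans this
  calc kernelOscillation N f ≤ ∫ z, kernel N z * (4 * M ^ 2) := by
        refine integral_mono_of_nonneg
          (Filter.Eventually.of_forall fun z => mul_nonneg (kernel_nonneg N z)
            (sqIncrement_nonneg _ z))
          (integrable_of_continuous ((continuous_kernel N).mul continuous_const))
          (Filter.Eventually.of_forall fun z => ?_)
        have := kernel_nonneg N z
        have := h z
        simp only
        gcongr
    _ = _ := by rw [integral_mul_const, integral_kernel, one_mul]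

end Torus2

/-! ### Mollified functions and the chain rule along absolutely continuous curves. -/

namespace Torus2

/-- The mollification of a function by the kernel. -/
noncomputable def mollify (N : ℕ) (f : Torus2 → ℝ) (x : Torus2) : ℝ :=
  ∫ y, f y * kernel N (x - y)

/-- The mollification of minus the distributional divergence of `f v`. -/
noncomputable def mollifyDiv (N : ℕ) (v : Torus2 → Fin 2 → ℝ) (f : Torus2 → ℝ) (x : Torus2) : ℝ :=
  ∫ y, f y * ∑ i, v y i * -partialDeriv i (kernel N) (x - y)

/-- One finite expansion serves for the kernel and its derivatives in `x` and in `y`, so integrals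
against them become finite sums of pairings and no differentiation under the integral is needed. -/
theorem exists_kernel_expansion (N : ℕ) : ∃ (J : Type) (_ : Fintype J) (A B : J → Torus2 → ℝ),
    (∀ j, IsCn ⊤ (A j)) ∧ (∀ j, IsCn ⊤ (B j)) ∧
    (∀ x y, kernel N (x - y) = ∑ j, B j y * A j x) ∧
    (∀ i x y, partialDeriv i (kernel N) (x - y) = ∑ j, B j y * partialDeriv i (A j) x) ∧
    ∀ i x y, -partialDeriv i (kernel N) (x - y) = ∑ j, partialDeriv i (B j) y * A j x := by
  obtain ⟨J, _, A, B, hA, hB, e⟩ := isSeparable_kernel N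
  replace e : ∀ x y, kernel N (x - y) = ∑ j, A j x * B j y := e
  refine ⟨J, inferInstance, A, B, hA, hB, fun x y => ?_, fun i x y => ?_, fun i x y => ?_⟩
  · rw [e]
    exact Finset.sum_congr rfl fun _ _ => mul_comm _ _
  · rw [← partialDeriv_comp_sub_right]
    simp only [e]
    rw [partialDeriv_sum_mul _ hA fun j => B j y]
    exact Finset.sum_congr rfl fun _ _ => mul_comm _ _
  · rw [← partialDeriv_comp_sub_left (isCn_kernel N)]
    simp only [e, mul_comm (A _ x)]
    rw [partialDeriv_sum_mul _ hB fun j => A j x]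

section Expansion

variable {J : Type} [Fintype J] {A B : J → Torus2 → ℝ} {N : ℕ} {f : Torus2 → ℝ}

theorem mollify_eq_sum (hB : ∀ j, IsCn ⊤ (B j))
    (e : ∀ x y, kernel N (x - y) = ∑ j, B j y * A j x) (hf : Integrable f) (x : Torus2) :
    mollify N f x = ∑ j, A j x * ∫ y, f y * B j y := by
  simp only [mollify, e, Finset.mul_sum, ← mul_assoc]
  rw [integral_finsetSum _ fun j _ => (hf.mul_continuous_torus (hB j).continuous).mul_const _]
  simp only [integral_mul_const]
  exact Finset.sum_congr rfl fun _ _ => mul_comm _ _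

theorem mollifyDiv_eq_sum {v : Torus2 → Fin 2 → ℝ} (hB : ∀ j, IsCn ⊤ (B j))
    (e : ∀ i x y, -partialDeriv i (kernel N) (x - y) = ∑ j, partialDeriv i (B j) y * A j x)
    (hfv : ∀ i, Integrable fun y => f y * v y i) (x : Torus2) :
    mollifyDiv N v f x = ∑ j, A j x * ∫ y, f y * ∑ i, v y i * partialDeriv i (B j) y := by
  have h : ∀ j, Integrable fun y => f y * ∑ i, v y i * partialDeriv i (B j) y := by
    intro j
    simp only [Finset.mul_sum, ← mul_assoc]
    exact integrable_finsetSum _ fun i _ =>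
      (hfv i).mul_continuous_torus ((hB j).partialDeriv i).continuous
  simp only [mul_comm (A _ x), ← integral_mul_const]
  rw [← integral_finsetSum _ fun j _ => (h j).mul_const _, mollifyDiv]
  refine integral_congr_ae (Filter.Eventually.of_forall fun y => ?_)
  simp only [e, Finset.mul_sum, Finset.sum_mul]
  rw [Finset.sum_comm]
  exact Finset.sum_congr rfl fun _ _ => Finset.sum_congr rfl fun _ _ => by ring

end Expansion

theorem isCn_mollify (N : ℕ) {f : Torus2 → ℝ} (hf : Integrable f) : IsCn ⊤ (mollify N f) := by
  obtain ⟨J, _, A, B, hA, hB, e, -, -⟩ := exists_kernel_expansion N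
  rw [funext (mollify_eq_sum hB e hf)]
  exact IsCn.sum _ fun j _ => (hA j).mul (isCn_const _)

theorem partialDeriv_mollify (N : ℕ) {f : Torus2 → ℝ} (hf : Integrable f) (i : Fin 2)
    (x : Torus2) : partialDeriv i (mollify N f) x =
      ∫ y, f y * partialDeriv i (kernel N) (x - y) := by
  obtain ⟨J, _, A, B, hA, hB, e, e', -⟩ := exists_kernel_expansion N
  rw [funext (mollify_eq_sum hB e hf), partialDeriv_sum_mul _ hA]
  simp only [e', Finset.mul_sum, ← mul_assoc]
  rw [integral_finsetSum _ fun j _ => (hf.mul_continuous_torus (hB j).continuous).mul_const _]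
  simp only [integral_mul_const, mul_comm]

theorem continuous_mollifyDiv (N : ℕ) {v : Torus2 → Fin 2 → ℝ} {f : Torus2 → ℝ}
    (hfv : ∀ i, Integrable fun y => f y * v y i) : Continuous (mollifyDiv N v f) := by
  obtain ⟨J, _, A, B, hA, hB, -, -, e⟩ := exists_kernel_expansion N
  rw [funext (mollifyDiv_eq_sum hB e hfv)]
  exact continuous_finsetSum _ fun j _ => (hA j).continuous.mul continuous_const

theorem abs_mollify_le {f : Torus2 → ℝ} {M : ℝ} (hM : ∀ᵐ x, |f x| ≤ M) (N : ℕ) (x : Torus2) :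
    |mollify N f x| ≤ M := by
  have hk : Integrable fun y => kernel N (x - y) := (integrable_of_continuous
    ((continuous_kernel N).comp (continuous_const.sub continuous_id)))
  calc |mollify N f x| ≤ ∫ y, |f y * kernel N (x - y)| := abs_integral_le_integral_abs
    _ ≤ ∫ y, M * kernel N (x - y) := by
        refine integral_mono_of_nonneg (Filter.Eventually.of_forall fun y => abs_nonneg _)
          (hk.const_mul M) (hM.mono fun y hy => ?_)
        have := kernel_nonneg N (x - y)
        simp only [abs_mul, abs_of_nonneg this]
        gcongr
    _ = M := by
        rw [integral_const_mul, integral_sub_left_eq_self (fun z => kernel N z) volume x,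
          integral_kernel, mul_one]

/-- From `|d| ≤ d² / l + l` averaged against the kernel, which has mass one. The right side has the
shape required by `tendsto_zero_of_le_div_add_mul`, hence `1 * l`. -/
theorem integral_abs_mollify_sub_le {f : Torus2 → ℝ} (hf : MemLp f 2 volume) (N : ℕ) {l : ℝ}
    (hl : 0 < l) : ∫ x, |mollify N f x - f x| ≤ kernelOscillation N f / l + 1 * l := by
  have hf1 : Integrable f := hf.integrable (by norm_num)
  have i1 := integrable_weight_mul_sq_sub (continuous_kernel N) hf
  have i2 : Integrable fun p : Torus2 × Torus2 => kernel N (p.1 - p.2) :=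
    integrable_of_continuous ((continuous_kernel N).comp (by fun_prop))
  have hk : ∀ x, Integrable fun y => kernel N (x - y) := fun x => (integrable_of_continuous
    ((continuous_kernel N).comp (continuous_const.sub continuous_id)))
  have hk1 : ∀ x, ∫ y, kernel N (x - y) = 1 := fun x => by
    rw [integral_sub_left_eq_self (fun z => kernel N z) volume x, integral_kernel]
  set H : Torus2 × Torus2 → ℝ := fun p =>
    kernel N (p.1 - p.2) * (f p.2 - f p.1) ^ 2 / l + l * kernel N (p.1 - p.2) with hH
  have hHint : Integrable H := (i1.div_const l).add (i2.const_mul l)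
  have hHval : ∫ p, H p = kernelOscillation N f / l + 1 * l := by
    rw [hH, integral_add (i1.div_const l) (i2.const_mul l), integral_div, integral_const_mul,
      integral_weight_mul_sq_sub (continuous_kernel _) (kernel_neg _) hf, ← kernelOscillation]
    rw [Measure.volume_eq_prod, integral_prod _ i2]
    simp [hk1]
  have hae : ∀ᵐ x, |mollify N f x - f x| ≤ ∫ y, H (x, y) := by
    filter_upwards [hHint.prod_right_ae] with x hx
    have e : mollify N f x - f x = ∫ y, (f y - f x) * kernel N (x - y) := by
      have hfk : Integrable fun y => f y * kernel N (x - y) := hf1.mul_continuous_torus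
        ((continuous_kernel N).comp (continuous_const.sub continuous_id))
      simp only [sub_mul (f _)]
      rw [integral_sub hfk ((hk x).const_mul _),
        integral_const_mul, hk1, mul_one, mollify]
    rw [e]
    refine (abs_integral_le_integral_abs).trans (integral_mono_of_nonneg
      (Filter.Eventually.of_forall fun y => abs_nonneg _) hx
      (Filter.Eventually.of_forall fun y => ?_))
    simp only [hH, abs_mul, abs_of_nonneg (kernel_nonneg N (x - y))]
    have h1 : |f y - f x| ≤ (f y - f x) ^ 2 / l + l := by
      rw [div_add' _ _ _ hl.ne', le_div_iff₀ hl, ← sq_abs (f y - f x)]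
      nlinarith [sq_nonneg (|f y - f x| - l), abs_nonneg (f y - f x)]
    calc |f y - f x| * kernel N (x - y) ≤ ((f y - f x) ^ 2 / l + l) * kernel N (x - y) := by
          have := kernel_nonneg N (x - y)
          gcongr
      _ = _ := by ring
  calc ∫ x, |mollify N f x - f x| ≤ ∫ x, ∫ y, H (x, y) :=
        integral_mono_of_nonneg (Filter.Eventually.of_forall fun x => abs_nonneg _)
          hHint.integral_prod_left hae
    _ = ∫ p, H p := (integral_prod _ hHint).symm
    _ = _ := hHval

theorem tendsto_integral_abs_mollify_sub {f : Torus2 → ℝ} (hf : MemLp f 2 volume) :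
    Filter.Tendsto (fun N => ∫ x, |mollify N f x - f x|) Filter.atTop (nhds 0) :=
  tendsto_zero_of_le_div_add_mul (fun _ => integral_nonneg fun _ => abs_nonneg _)
    (tendsto_kernelOscillation hf) fun N _ hl => integral_abs_mollify_sub_le hf N hl

/-- Along a solution `mollifyDiv` is the time derivative of the mollified function, so the
commutator is exactly the error with which that function solves the transport equation. -/
theorem commutator_eq {C : ℝ} {v : Torus2 → Fin 2 → ℝ} (h : IsSobolevVelocity C v)
    {f : Torus2 → ℝ} (hf : MemLp f ⊤ volume) (N : ℕ) (x : Torus2) :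
    commutator N v f x = ∑ i, v x i * partialDeriv i (mollify N f) x + mollifyDiv N v f x := by
  have hf1 : Integrable f := hf.integrable le_top
  have hc : ∀ i, Continuous fun y => partialDeriv i (kernel N) (x - y) := fun i =>
    (continuous_partialDeriv_kernel N i).comp (continuous_const.sub continuous_id)
  have hfv : ∀ i, Integrable fun y => f y * v y i := fun i => (h.integrable i).smul_of_top_right hf
  have i1 : ∀ i, Integrable fun y => v x i * (f y * partialDeriv i (kernel N) (x - y)) :=
    fun i => (hf1.mul_continuous_torus (hc i)).const_mul _
  have i2 : Integrable fun y => f y * ∑ i, v y i * -partialDeriv i (kernel N) (x - y) := by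
    simp only [Finset.mul_sum, ← mul_assoc]
    exact integrable_finsetSum _ fun i _ => (hfv i).mul_continuous_torus (hc i).neg
  simp only [partialDeriv_mollify N hf1, ← integral_const_mul]
  rw [← integral_finsetSum _ fun i _ => i1 i, mollifyDiv,
    ← integral_add (integrable_finsetSum _ fun i _ => i1 i) i2, commutator]
  refine integral_congr_ae (Filter.Eventually.of_forall fun y => ?_)
  simp only [Finset.mul_sum, ← Finset.sum_add_distrib]
  exact Finset.sum_congr rfl fun i _ => by ring

theorem abs_fderiv_le_of_norm_le {ι : Type*} [Fintype ι] {Φ : (ι → ℝ) → ℝ} {M L : ℝ}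
    (hL : ∀ a : ι → ℝ, (∀ j, |a j| ≤ M) → ‖fderiv ℝ Φ a‖ ≤ L) {a : ι → ℝ}
    (ha : ∀ j, |a j| ≤ M) (b : ι → ℝ) : |fderiv ℝ Φ a b| ≤ L * ∑ j, |b j| := by
  have hL0 : 0 ≤ L := (norm_nonneg _).trans (hL a ha)
  calc |fderiv ℝ Φ a b| ≤ ‖fderiv ℝ Φ a‖ * ‖b‖ := (fderiv ℝ Φ a).le_opNorm b
    _ ≤ L * ∑ j, |b j| := by
        gcongr
        · exact hL a ha
        · refine (pi_norm_le_iff_of_nonneg (Finset.sum_nonneg fun _ _ => abs_nonneg _)).2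
            fun j => ?_
          exact Finset.single_le_sum (f := fun j => |b j|) (fun _ _ => abs_nonneg _)
            (Finset.mem_univ j)

/-- The integral on the left is the rate of change of `∫ Φ(f_N)`. Adding `∫ v · ∇Φ(f_N) = 0` turns
`mollifyDiv` into the commutator, which is the small quantity. -/
theorem abs_integral_fderiv_mollifyDiv_le {ι : Type*} [Fintype ι] {C : ℝ}
    {v : Torus2 → Fin 2 → ℝ} (h : IsSobolevVelocity C v) {f : ι → Torus2 → ℝ}
    (hf : ∀ j, MemLp (f j) ⊤ volume) {Φ : (ι → ℝ) → ℝ} (hΦ : ContDiff ℝ (⊤ : ℕ∞) Φ) {M L : ℝ}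
    (hM : ∀ j, ∀ᵐ x, |f j x| ≤ M)
    (hL : ∀ a : ι → ℝ, (∀ j, |a j| ≤ M) → ‖fderiv ℝ Φ a‖ ≤ L) (N : ℕ) :
    |∫ x, fderiv ℝ Φ (fun j => mollify N (f j) x) fun j => mollifyDiv N v (f j) x| ≤
      L * ∑ j, ∫ x, |commutator N v (f j) x| := by
  have hf1 : ∀ j, Integrable (f j) := fun j => (hf j).integrable le_top
  have hfv : ∀ j i, Integrable fun y => f j y * v y i :=
    fun j i => (h.integrable i).smul_of_top_right (hf j)
  have hcn : ∀ j, IsCn ⊤ (mollify N (f j)) := fun j => isCn_mollify N (hf1 j)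
  have hcomm : ∀ j, Integrable (commutator N v (f j)) := by
    intro j
    rw [funext (commutator_eq h (hf j) N)]
    exact (integrable_finsetSum _ fun i _ => (h.integrable i).mul_continuous_torus
      ((hcn j).partialDeriv i).continuous).add
        (integrable_of_continuous (continuous_mollifyDiv N (hfv j)))
  have hdiv := h.divergence _ (IsCn.comp_pi hcn hΦ)
  have hcont : Continuous fun x => fderiv ℝ Φ (fun j => mollify N (f j) x) fun j =>
      mollifyDiv N v (f j) x :=
    ((hΦ.continuous_fderiv (by simp)).comp (continuous_pi fun j => (hcn j).continuous)).clm_apply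
      (continuous_pi fun j => continuous_mollifyDiv N (hfv j))
  have e : ∫ x, fderiv ℝ Φ (fun j => mollify N (f j) x) (fun j => mollifyDiv N v (f j) x) =
      ∫ x, fderiv ℝ Φ (fun j => mollify N (f j) x) fun j => commutator N v (f j) x := by
    -- The added zero is the weak divergence of `v` tested with the smooth function `Φ(f_N)`.
    rw [← zero_add (∫ x, _), ← hdiv, ← integral_add (integrable_finsetSum _ fun i _ =>
      (h.integrable i).mul_continuous_torus ((IsCn.comp_pi hcn hΦ).partialDeriv i).continuous)
      (integrable_of_continuous hcont)]
    refine integral_congr_ae (Filter.Eventually.of_forall fun x => ?_)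
    simp only [partialDeriv_comp_pi hcn hΦ, commutator_eq h (hf _)]
    simp only [← smul_eq_mul, ← map_smul, ← map_sum, ← map_add]
    congr 1
  rw [e, ← integral_finsetSum _ fun j _ => (hcomm j).abs, ← integral_const_mul]
  refine (abs_integral_le_integral_abs).trans (integral_mono_of_nonneg
    (Filter.Eventually.of_forall fun x => abs_nonneg _)
    ((integrable_finsetSum _ fun j _ => (hcomm j).abs).const_mul L)
    (Filter.Eventually.of_forall fun x => ?_))
  exact abs_fderiv_le_of_norm_le hL (fun j => abs_mollify_le (hM j) N x) _

/-- The curve stays in a ball, on which `Φ` is Lipschitz; the increments of `Φ` are then controlled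
by the sum of the increments of the components. -/
theorem _root_.AbsolutelyContinuousOnInterval.comp_pi {ι : Type*} [Fintype ι] {Φ : (ι → ℝ) → ℝ}
    (hΦ : ContDiff ℝ 1 Φ) {b : ι → ℝ → ℝ} {s t : ℝ}
    (hb : ∀ j, AbsolutelyContinuousOnInterval (b j) s t) :
    AbsolutelyContinuousOnInterval (fun r => Φ fun j => b j r) s t := by
  have hcpt : IsCompact ((fun r j => b j r) '' uIcc s t) :=
    isCompact_uIcc.image_of_continuousOn (continuousOn_pi.2 fun j => (hb j).continuousOn)
  obtain ⟨R, hR⟩ := hcpt.isBounded.subset_closedBall 0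
  obtain ⟨K, hK⟩ := hΦ.contDiffOn.exists_lipschitzOnWith (by decide)
    (convex_closedBall (0 : ι → ℝ) R) (isCompact_closedBall _ _)
  have hsum := tendsto_finsetSum (Finset.univ : Finset ι) fun j _ => hb j
  have hsum' := hsum.const_mul (K : ℝ)
  simp only [Finset.sum_const_zero, mul_zero] at hsum'
  refine squeeze_zero' (Filter.Eventually.of_forall fun E =>
    Finset.sum_nonneg fun _ _ => dist_nonneg) ?_ hsum'
  filter_upwards [Filter.mem_inf_of_right (Filter.mem_principal_self _)] with E hE
  rw [Finset.sum_comm, Finset.mul_sum]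
  refine Finset.sum_le_sum fun i hi => ?_
  obtain ⟨h1, h2⟩ := hE.1 i hi
  refine (hK.dist_le_mul _ (hR (mem_image_of_mem _ h1)) _ (hR (mem_image_of_mem _ h2))).trans ?_
  refine mul_le_mul_of_nonneg_left ?_ K.2
  refine (dist_pi_le_iff (Finset.sum_nonneg fun _ _ => dist_nonneg)).2 fun j => ?_
  exact Finset.single_le_sum (f := fun j => dist (b j (E.2 i).1) (b j (E.2 i).2))
    (fun _ _ => dist_nonneg) (Finset.mem_univ j)

/-- The rates `g j` are merely integrable in time, so the chain rule holds only almost everywhere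
and absolute continuity is what recovers the increment. -/
theorem comp_primitive_sub_eq_integral {ι : Type*} [Fintype ι] {Φ : (ι → ℝ) → ℝ}
    (hΦ : ContDiff ℝ 1 Φ) {g : ι → ℝ → ℝ} {t : ℝ}
    (hg : ∀ j, IntervalIntegrable (g j) volume 0 t) (a : ι → ℝ) :
    Φ (fun j => a j + ∫ r in (0 : ℝ)..t, g j r) - Φ a =
      ∫ s in (0 : ℝ)..t, fderiv ℝ Φ (fun j => a j + ∫ r in (0 : ℝ)..s, g j r) fun j => g j s := by
  have hac : ∀ j, AbsolutelyContinuousOnInterval (fun s => a j + ∫ r in (0 : ℝ)..s, g j r) 0 t :=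
    fun j => AbsolutelyContinuousOnInterval.fun_add
      (LipschitzOnWith.absolutelyContinuousOnInterval (K := 0)
        (LipschitzWith.const (a j)).lipschitzOnWith)
      ((hg j).absolutelyContinuousOnInterval_intervalIntegral (by simp))
  have h := (AbsolutelyContinuousOnInterval.comp_pi hΦ hac).integral_deriv_eq_sub
  simp only [intervalIntegral.integral_same, add_zero] at h
  rw [← h]
  refine intervalIntegral.integral_congr_ae ?_
  filter_upwards [ae_all_iff.2 fun j => (hg j).ae_hasDerivAt_integral] with s hs hst
  have hd : HasDerivAt (fun (s : ℝ) j => a j + ∫ r in (0 : ℝ)..s, g j r) (fun j => g j s) s :=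
    hasDerivAt_pi.2 fun j => (hs j (uIoc_subset_uIcc hst) 0 (by simp)).const_add _
  exact ((hΦ.differentiable (by simp) _).hasFDerivAt.comp_hasDerivAt s hd).deriv

end Torus2

/-! ### Bounded weak solutions and their joint renormalization. -/

namespace Torus2

theorem aestronglyMeasurable_pi_of_apply {X ι : Type*} [MeasurableSpace X] {μ : Measure X}
    [Fintype ι] {f : X → ι → ℝ} (hf : ∀ j, AEStronglyMeasurable (fun x => f x j) μ) :
    AEStronglyMeasurable f μ :=
  (aemeasurable_pi_lambda _ fun j => (hf j).aemeasurable).aestronglyMeasurable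

/-- The set where the bound holds need not be measurable, so Fubini is applied to a measurable
representative. -/
theorem ae_prod_abs_le_of_ae_ae {X Y : Type*} [MeasurableSpace X] [MeasurableSpace Y]
    {μ : Measure X} {ν : Measure Y} [SFinite μ] [SFinite ν] {f : X → Y → ℝ}
    (hf : AEStronglyMeasurable (fun p : X × Y => f p.1 p.2) (μ.prod ν)) {M : ℝ}
    (hM : ∀ᵐ t ∂μ, ∀ᵐ x ∂ν, |f t x| ≤ M) : ∀ᵐ p ∂(μ.prod ν), |f p.1 p.2| ≤ M := by
  have h1 := hf.ae_eq_mk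
  have hmeas : MeasurableSet {p : X × Y | |hf.mk _ p| ≤ M} :=
    measurableSet_le (hf.stronglyMeasurable_mk.measurable.abs) measurable_const
  have h2 : ∀ᵐ p ∂(μ.prod ν), p ∈ {p : X × Y | |hf.mk _ p| ≤ M} := by
    rw [Measure.ae_prod_mem_iff_ae_ae_mem hmeas]
    filter_upwards [hM, Measure.ae_ae_of_ae_prod h1] with t ht ht'
    filter_upwards [ht, ht'] with x hx hx'
    rw [← hx']
    exact hx
  filter_upwards [h1, h2] with p hp hp'
  rw [hp]
  exact hp'

/-- The derivative of `η` along the flow of `u`. -/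
noncomputable def materialDeriv (u : ℝ → Torus2 → Fin 2 → ℝ) (η : ℝ → Torus2 → ℝ) (s : ℝ)
    (x : Torus2) : ℝ :=
  deriv (fun r => η r x) s + ∑ i, u s x i * partialDeriv i (η s) x

theorem ae_abs_le_of_continuous {g : ℝ × Torus2 → ℝ} (hg : Continuous g) (T : ℝ) :
    ∃ C, ∀ s ∈ Icc 0 T, ∀ x, |g (s, x)| ≤ C := by
  obtain ⟨C, hC⟩ :=
    (isCompact_Icc.prod (isCompact_univ : IsCompact (univ : Set Torus2))).exists_bound_of_continuousOn
    (hg.continuousOn (s := Icc 0 T ×ˢ univ))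
  exact ⟨C, fun s hs x => hC (s, x) ⟨hs, mem_univ _⟩⟩

theorem ae_prod_of_forall_mem {T : ℝ} {p : ℝ × Torus2 → Prop}
    (h : ∀ s ∈ Icc 0 T, ∀ x, p (s, x)) :
    ∀ᵐ q ∂((volume.restrict (Icc 0 T)).prod (volume : Measure Torus2)), p q := by
  have e : (volume.restrict (Icc 0 T)).prod (volume : Measure Torus2) =
      (volume.prod volume).restrict (Icc 0 T ×ˢ univ) := by
    rw [← Measure.prod_restrict, Measure.restrict_univ]
  rw [e]
  exact ae_restrict_of_forall_mem (measurableSet_Icc.prod MeasurableSet.univ)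
    fun q hq => h q.1 hq.1 q.2

theorem integrable_prod_mul_continuous {T : ℝ} {f g : ℝ × Torus2 → ℝ}
    (hf : Integrable f ((volume.restrict (Icc 0 T)).prod volume)) (hg : Continuous g) :
    Integrable (fun p => f p * g p) ((volume.restrict (Icc 0 T)).prod volume) := by
  obtain ⟨C, hC⟩ := ae_abs_le_of_continuous hg T
  exact hf.mul_bdd (c := C) hg.aestronglyMeasurable (ae_prod_of_forall_mem hC)

theorem integrable_prod_of_continuous (T : ℝ) {g : ℝ × Torus2 → ℝ} (hg : Continuous g) :
    Integrable g ((volume.restrict (Icc 0 T)).prod volume) := by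
  simpa using integrable_prod_mul_continuous (T := T) (integrable_const (1 : ℝ)) hg

/-- A velocity field integrable on bounded time intervals. -/
def IsLocallyIntegrableVelocity (u : ℝ → Torus2 → Fin 2 → ℝ) : Prop :=
  ∀ T : ℝ, Integrable (fun p : ℝ × Torus2 => u p.1 p.2) ((volume.restrict (Icc 0 T)).prod volume)

variable {u : ℝ → Torus2 → Fin 2 → ℝ}

theorem integrable_materialDeriv (hu : IsLocallyIntegrableVelocity u) {η : ℝ → Torus2 → ℝ}
    (hη : IsSpaceTimeTest η) (T : ℝ) :
    Integrable (fun p : ℝ × Torus2 => materialDeriv u η p.1 p.2)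
      ((volume.restrict (Icc 0 T)).prod volume) :=
  (integrable_prod_of_continuous T hη.continuous_deriv).add
    (integrable_finsetSum _ fun i _ => integrable_prod_mul_continuous
      (f := fun p => u p.1 p.2 i) ((hu T).eval i)
      (hη.continuous_partialDeriv i))

theorem integrable_mul_materialDeriv (hu : IsLocallyIntegrableVelocity u) {η : ℝ → Torus2 → ℝ}
    (hη : IsSpaceTimeTest η) {T M : ℝ} {f : ℝ → Torus2 → ℝ}
    (hf : AEStronglyMeasurable (fun p : ℝ × Torus2 => f p.1 p.2)
      ((volume.restrict (Icc 0 T)).prod volume))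
    (hM : ∀ᵐ p ∂((volume.restrict (Icc 0 T)).prod (volume : Measure Torus2)), |f p.1 p.2| ≤ M) :
    Integrable (fun p : ℝ × Torus2 => f p.1 p.2 * materialDeriv u η p.1 p.2)
      ((volume.restrict (Icc 0 T)).prod volume) :=
  (integrable_materialDeriv hu hη T).bdd_mul hf hM

namespace IsTransportSolution

variable {f₀ : Torus2 → ℝ} {f : ℝ → Torus2 → ℝ}

theorem aestronglyMeasurable_Icc (h : IsTransportSolution u f₀ f) (T : ℝ) :
    AEStronglyMeasurable (fun p : ℝ × Torus2 => f p.1 p.2)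
      ((volume.restrict (Icc 0 T)).prod volume) :=
  h.measurable.mono_measure
    (Measure.prod_mono (Measure.restrict_mono Icc_subset_Ici_self le_rfl) le_rfl)

theorem integrable_mul_materialDeriv (h : IsTransportSolution u f₀ f)
    (hu : IsLocallyIntegrableVelocity u) {η : ℝ → Torus2 → ℝ} (hη : IsSpaceTimeTest η) (T : ℝ) :
    Integrable (fun p : ℝ × Torus2 => f p.1 p.2 * materialDeriv u η p.1 p.2)
      ((volume.restrict (Icc 0 T)).prod volume) := by
  obtain ⟨M, hM⟩ := h.bounded T
  exact Torus2.integrable_mul_materialDeriv hu hη (h.aestronglyMeasurable_Icc T)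
    (ae_prod_abs_le_of_ae_ae (h.aestronglyMeasurable_Icc T)
      (ae_restrict_of_forall_mem measurableSet_Icc hM))

/-- The rate of change of `∫ f(t) ζ` for a test function `ζ` independent of time. -/
noncomputable def _root_.Torus2.testRate (u : ℝ → Torus2 → Fin 2 → ℝ) (f : ℝ → Torus2 → ℝ)
    (ζ : Torus2 → ℝ) (s : ℝ) : ℝ :=
  ∫ x, f s x * ∑ i, u s x i * partialDeriv i ζ x

theorem _root_.Torus2.materialDeriv_const (ζ : Torus2 → ℝ) (s : ℝ) (x : Torus2) :
    materialDeriv u (fun _ => ζ) s x = ∑ i, u s x i * partialDeriv i ζ x := by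
  simp [materialDeriv]

theorem integrableOn_testRate (h : IsTransportSolution u f₀ f)
    (hu : IsLocallyIntegrableVelocity u) {ζ : Torus2 → ℝ} (hζ : IsCn ⊤ ζ) (T : ℝ) :
    IntegrableOn (testRate u f ζ) (Icc 0 T) := by
  have := (h.integrable_mul_materialDeriv hu (isSpaceTimeTest_of_isCn hζ) T).integral_prod_left
  simpa only [materialDeriv_const] using! this

theorem integral_mul_eq (h : IsTransportSolution u f₀ f) {ζ : Torus2 → ℝ} (hζ : IsCn ⊤ ζ) {t : ℝ}
    (ht : 0 ≤ t) : ∫ x, f t x * ζ x = (∫ x, f₀ x * ζ x) + ∫ s in (0 : ℝ)..t, testRate u f ζ s := by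
  have := h.weak_eq _ (isSpaceTimeTest_of_isCn hζ) t ht
  simp only [deriv_const, zero_add] at this
  simp only [testRate]
  linarith

theorem memLp_top (h : IsTransportSolution u f₀ f) {t : ℝ} (ht : 0 ≤ t) :
    MemLp (f t) ⊤ volume := by
  obtain ⟨M, hM⟩ := h.bounded t
  exact memLp_top_of_bound (h.measurable_slice t ht) M (hM t ⟨ht, le_rfl⟩)

end IsTransportSolution

section Renormalization

variable {ι : Type*} [Fintype ι]

theorem exists_abs_integral_comp_sub_le {Φ : (ι → ℝ) → ℝ} (hΦ : ContDiff ℝ (⊤ : ℕ∞) Φ) (M : ℝ) :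
    ∃ L : ℝ, 0 ≤ L ∧ (∀ a : ι → ℝ, (∀ j, |a j| ≤ M) → ‖fderiv ℝ Φ a‖ ≤ L) ∧
      ∀ a b : ι → ℝ, (∀ j, |a j| ≤ M) → (∀ j, |b j| ≤ M) → |Φ a - Φ b| ≤ L * ∑ j, |a j - b j| := by
  -- The radius is `|M|` so that the ball contains the origin whatever the sign of `M`.
  obtain ⟨L, hL⟩ := (isCompact_closedBall (0 : ι → ℝ) |M|).exists_bound_of_continuousOn
    (hΦ.continuous_fderiv (by simp)).continuousOn
  have hmem : ∀ a : ι → ℝ, (∀ j, |a j| ≤ M) → a ∈ Metric.closedBall (0 : ι → ℝ) |M| := by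
    intro a ha
    rw [mem_closedBall_zero_iff, pi_norm_le_iff_of_nonneg (abs_nonneg _)]
    exact fun j => (ha j).trans (le_abs_self M)
  have hL0 : 0 ≤ L := (norm_nonneg _).trans (hL 0 (by simp))
  refine ⟨L, hL0, fun a ha => hL a (hmem a ha), fun a b ha hb => ?_⟩
  have h := (convex_closedBall (0 : ι → ℝ) |M|).norm_image_sub_le_of_norm_fderiv_le (𝕜 := ℝ)
    (fun x _ => hΦ.differentiable (by simp) x) hL (hmem b hb) (hmem a ha)
  refine h.trans (mul_le_mul_of_nonneg_left ?_ hL0)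
  refine (pi_norm_le_iff_of_nonneg (Finset.sum_nonneg fun _ _ => abs_nonneg _)).2 fun j => ?_
  exact Finset.single_le_sum (f := fun j => |a j - b j|) (fun _ _ => abs_nonneg _)
    (Finset.mem_univ j)

theorem tendsto_integral_comp_mollify {Φ : (ι → ℝ) → ℝ} (hΦ : ContDiff ℝ (⊤ : ℕ∞) Φ)
    {h : ι → Torus2 → ℝ} {M : ℝ} (hm : ∀ j, AEStronglyMeasurable (h j) volume)
    (hM : ∀ j, ∀ᵐ x, |h j x| ≤ M) :
    Filter.Tendsto (fun N => ∫ x, Φ fun j => mollify N (h j) x) Filter.atTop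
      (nhds (∫ x, Φ fun j => h j x)) := by
  obtain ⟨L, hL0, -, hL⟩ := exists_abs_integral_comp_sub_le hΦ M
  have h2 : ∀ j, MemLp (h j) 2 volume := fun j => MemLp.of_bound (hm j) M (hM j)
  have h1 : ∀ j, Integrable (h j) := fun j => (h2 j).integrable (by norm_num)
  have i1 : ∀ N, Integrable fun x => Φ fun j => mollify N (h j) x := fun N =>
    integrable_of_continuous (IsCn.comp_pi (fun j => isCn_mollify N (h1 j)) hΦ).continuous
  have hall : ∀ᵐ x, ∀ j, |h j x| ≤ M := ae_all_iff.2 hM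
  have i2 : Integrable fun x => Φ fun j => h j x := by
    refine Integrable.of_bound (C := |Φ 0| + L * ∑ _j : ι, M)
      (hΦ.continuous.comp_aestronglyMeasurable (aestronglyMeasurable_pi_of_apply hm)) ?_
    filter_upwards [hall] with x hx
    have h0 := hL (fun j => h j x) 0 hx
      (fun j => by simpa using (abs_nonneg _).trans (hx j))
    have h3 : ∑ j, |h j x - (0 : ι → ℝ) j| ≤ ∑ _j : ι, M :=
      Finset.sum_le_sum fun j _ => by simpa using hx j
    have h4 := mul_le_mul_of_nonneg_left h3 hL0
    have h5 := abs_sub_abs_le_abs_sub (Φ fun j => h j x) (Φ 0)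
    rw [Real.norm_eq_abs]
    linarith
  have i3 : ∀ N j, Integrable fun x => |mollify N (h j) x - h j x| := fun N j =>
    ((integrable_of_continuous (isCn_mollify N (h1 j)).continuous).sub (h1 j)).abs
  rw [tendsto_iff_dist_tendsto_zero]
  have hlim : Filter.Tendsto (fun N => L * ∑ j, ∫ x, |mollify N (h j) x - h j x|) Filter.atTop
      (nhds 0) := by
    have := (tendsto_finsetSum (Finset.univ : Finset ι) fun j _ =>
      tendsto_integral_abs_mollify_sub (h2 j)).const_mul L
    simpa using this
  refine squeeze_zero (fun _ => dist_nonneg) (fun N => ?_) hlim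
  rw [Real.dist_eq, ← integral_sub (i1 N) i2, ← integral_finsetSum _ fun j _ => i3 N j,
    ← integral_const_mul]
  refine (abs_integral_le_integral_abs).trans (integral_mono_of_nonneg
    (Filter.Eventually.of_forall fun x => abs_nonneg _)
    ((integrable_finsetSum _ fun j _ => i3 N j).const_mul L) ?_)
  filter_upwards [hall] with x hx
  exact hL _ _ (fun j => abs_mollify_le (hM j) N x) hx

/-- At fixed `x` the mollified solutions are primitives of `mollifyDiv`, by separability of the
kernel. The chain rule is applied pointwise in `x`, and Fubini turns the result into a rate for the
integral over the torus, bounded by commutators. -/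
theorem exists_rate_integral_comp_mollify (hu : IsLocallyIntegrableVelocity u) {C : ℝ}
    {t : ℝ} (ht : 0 ≤ t) (hC : ∀ s ∈ Icc 0 t, IsSobolevVelocity C (u s))
    {f₀ : ι → Torus2 → ℝ} {f : ι → ℝ → Torus2 → ℝ}
    (hf : ∀ j, IsTransportSolution u (f₀ j) (f j))
    (hf₀ : ∀ j, Integrable (f₀ j)) {Φ : (ι → ℝ) → ℝ} (hΦ : ContDiff ℝ (⊤ : ℕ∞) Φ) {M L : ℝ}
    (hM : ∀ j, ∀ s ∈ Icc 0 t, ∀ᵐ x, |f j s x| ≤ M)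
    (hL : ∀ a : ι → ℝ, (∀ j, |a j| ≤ M) → ‖fderiv ℝ Φ a‖ ≤ L) (N : ℕ) :
    ∃ E : ℝ → ℝ, IntegrableOn E (Ioc 0 t) ∧
      ((∫ x, Φ fun j => mollify N (f j t) x) - ∫ x, Φ fun j => mollify N (f₀ j) x) =
        ∫ s in Ioc 0 t, E s ∧
      ∀ s ∈ Ioc 0 t, |E s| ≤ L * ∑ j, ∫ x, |commutator N (u s) (f j s) x| := by
  obtain ⟨J, _, A, B, hA, hB, e, -, e'⟩ := exists_kernel_expansion N
  have hfi : ∀ j, ∀ s ∈ Icc 0 t, Integrable (f j s) := fun j s hs =>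
    ((hf j).memLp_top hs.1).integrable le_top
  -- Extension by zero outside `[0, t]` makes the rates integrable on the whole line, and their
  -- primitives continuous there.
  set G : ι → J → ℝ → ℝ := fun j k => (Icc 0 t).indicator (testRate u (f j) (B k)) with hG
  have hGi : ∀ j k, Integrable (G j k) := fun j k =>
    ((hf j).integrableOn_testRate hu (hB k) t).integrable_indicator measurableSet_Icc
  have hGint : ∀ j k, ∀ s ∈ Icc 0 t,
      ∫ r in (0 : ℝ)..s, G j k r = ∫ r in (0 : ℝ)..s, testRate u (f j) (B k) r := by
    intro j k s hs
    refine intervalIntegral.integral_congr fun r hr => ?_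
    rw [uIcc_of_le hs.1] at hr
    exact indicator_of_mem (show r ∈ Icc 0 t from ⟨hr.1, hr.2.trans hs.2⟩) _
  set γ : ι → Torus2 → ℝ → ℝ := fun j x s => ∑ k, A k x * G j k s with hγ
  have hγi : ∀ j x, Integrable (γ j x) := fun j x =>
    integrable_finsetSum _ fun k _ => (hGi j k).const_mul _
  -- On `[0, t]` this is the mollified solution; unlike the solution itself it is jointly continuous
  -- by construction, which gives measurability of the integrand `Q`.
  set P : ι → Torus2 → ℝ → ℝ := fun j x s => mollify N (f₀ j) x + ∫ r in (0 : ℝ)..s, γ j x r with hP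
  have hγint : ∀ j x s, ∫ r in (0 : ℝ)..s, γ j x r = ∑ k, A k x * ∫ r in (0 : ℝ)..s, G j k r := by
    intro j x s
    simp only [hγ]
    rw [intervalIntegral.integral_finsetSum fun k _ =>
      ((hGi j k).const_mul _).intervalIntegrable]
    simp only [intervalIntegral.integral_const_mul]
  have hPm : ∀ j x, ∀ s ∈ Icc 0 t, P j x s = mollify N (f j s) x := by
    intro j x s hs
    rw [mollify_eq_sum hB e (hfi j s hs)]
    simp only [hP, hγint, hGint _ _ s hs, (hf j).integral_mul_eq (hB _) hs.1, mul_add,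
      Finset.sum_add_distrib]
    rw [mollify_eq_sum hB e (hf₀ j)]
  have hγm : ∀ j x, ∀ s ∈ Icc 0 t, γ j x s = mollifyDiv N (u s) (f j s) x := by
    intro j x s hs
    rw [mollifyDiv_eq_sum hB e' fun i => ((hC s hs).integrable i).smul_of_top_right
      ((hf j).memLp_top hs.1)]
    simp only [hγ, hG, indicator_of_mem hs, testRate]
  have hPc : ∀ j, Continuous fun p : ℝ × Torus2 => P j p.2 p.1 := by
    intro j
    simp only [hP, hγint]
    refine ((isCn_mollify N (hf₀ j)).continuous.comp continuous_snd).add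
      (continuous_finsetSum _ fun k _ => ((hA k).continuous.comp continuous_snd).mul ?_)
    exact (intervalIntegral.continuous_primitive (fun a b => (hGi j k).intervalIntegrable) 0).comp
      continuous_fst
  set Q : ℝ × Torus2 → ℝ := fun p =>
    fderiv ℝ Φ (fun j => P j p.2 p.1) fun j => γ j p.2 p.1 with hQ
  have hPb : ∀ x, ∀ s ∈ Icc 0 t, ∀ j, |P j x s| ≤ M := by
    intro x s hs j
    rw [hPm j x s hs]
    exact abs_mollify_le (hM j s hs) N x
  have hγi2 : ∀ j, Integrable (fun p : ℝ × Torus2 => γ j p.2 p.1)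
      ((volume.restrict (Icc 0 t)).prod volume) := by
    intro j
    simp only [hγ, mul_comm (A _ _)]
    refine integrable_finsetSum _ fun k _ => integrable_prod_mul_continuous
      (f := fun p => G j k p.1) ?_ ((hA k).continuous.comp continuous_snd)
    exact ((hGi j k).restrict (s := Icc 0 t)).comp_fst volume
  have hQi : Integrable Q ((volume.restrict (Icc 0 t)).prod volume) := by
    refine Integrable.mono' ((integrable_finsetSum Finset.univ fun j _ => (hγi2 j).abs).const_mul L)
      ?_ ?_
    · have h1 : Continuous fun p : ℝ × Torus2 => fderiv ℝ Φ fun j => P j p.2 p.1 :=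
        (hΦ.continuous_fderiv (by simp)).comp (continuous_pi hPc)
      exact (ContinuousLinearMap.apply ℝ ℝ : (ι → ℝ) →L[ℝ] _).flip.aestronglyMeasurable_comp₂
        h1.aestronglyMeasurable (aestronglyMeasurable_pi_of_apply fun j => (hγi2 j).1)
    · exact ae_prod_of_forall_mem fun s hs x => abs_fderiv_le_of_norm_le hL (hPb x s hs) _
  have hIoc : (volume.restrict (Icc (0 : ℝ) t)) = volume.restrict (Ioc 0 t) :=
    (restrict_Ioc_eq_restrict_Icc).symm
  refine ⟨fun s => ∫ x, Q (s, x), ?_, ?_, ?_⟩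
  · rw [IntegrableOn, ← hIoc]
    exact hQi.integral_prod_left
  · have hx : ∀ x, (Φ fun j => mollify N (f j t) x) - (Φ fun j => mollify N (f₀ j) x) =
        ∫ s in Ioc 0 t, Q (s, x) := by
      intro x
      have := comp_primitive_sub_eq_integral (hΦ.of_le (by exact_mod_cast le_top))
        (fun j => (hγi j x).intervalIntegrable (a := 0) (b := t)) fun j => mollify N (f₀ j) x
      rw [intervalIntegral.integral_of_le ht] at this
      rw [← this]
      congr 2
      funext j
      exact (hPm j x t ⟨ht, le_rfl⟩).symm
    rw [← integral_sub (integrable_of_continuous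
      (IsCn.comp_pi (fun j => isCn_mollify N (hfi j t ⟨ht, le_rfl⟩)) hΦ).continuous)
      (integrable_of_continuous (IsCn.comp_pi (fun j => isCn_mollify N (hf₀ j)) hΦ).continuous)]
    simp only [hx]
    rw [← hIoc]
    exact (integral_integral_swap hQi).symm
  · intro s hs
    have hs' : s ∈ Icc 0 t := Ioc_subset_Icc_self hs
    have := abs_integral_fderiv_mollifyDiv_le (hC s hs') (fun j => (hf j).memLp_top hs'.1) hΦ
      (fun j => hM j s hs') hL N
    simpa only [hQ, hPm _ _ s hs', hγm _ _ s hs'] using this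

/-- The increment of the mollified integral is the time integral of a rate that tends to zero at
every time and is bounded uniformly in `N`. Dominated convergence and convergence of the
mollifications at the two end times conclude. -/
theorem integral_comp_eq_of_isTransportSolution (hu : IsLocallyIntegrableVelocity u)
    {t : ℝ} (ht : 0 ≤ t) {C : ℝ} (hC : ∀ s ∈ Icc 0 t, IsSobolevVelocity C (u s))
    {f₀ : ι → Torus2 → ℝ} {f : ι → ℝ → Torus2 → ℝ}
    (hf : ∀ j, IsTransportSolution u (f₀ j) (f j)) (hf₀ : ∀ j, AEStronglyMeasurable (f₀ j) volume)
    (hM₀ : ∀ j, ∃ m : ℝ, ∀ᵐ x, |f₀ j x| ≤ m) {Φ : (ι → ℝ) → ℝ} (hΦ : ContDiff ℝ (⊤ : ℕ∞) Φ) :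
    ∫ x, Φ (fun j => f j t x) = ∫ x, Φ fun j => f₀ j x := by
  choose M₁ hM₁ using fun j => (hf j).bounded t
  choose M₂ hM₂ using hM₀
  -- A single bound for all components, for the solutions on `[0, t]` as well as for the data.
  set M := ∑ j, (|M₁ j| + |M₂ j|) with hMdef
  have hle : ∀ j, |M₁ j| + |M₂ j| ≤ M := fun j =>
    Finset.single_le_sum (f := fun j => |M₁ j| + |M₂ j|) (fun _ _ => by positivity)
      (Finset.mem_univ j)
  have hM : ∀ j, ∀ s ∈ Icc 0 t, ∀ᵐ x, |f j s x| ≤ M := fun j s hs => (hM₁ j s hs).mono fun x hx =>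
    hx.trans (by linarith [le_abs_self (M₁ j), abs_nonneg (M₂ j), hle j])
  have hM' : ∀ j, ∀ᵐ x, |f₀ j x| ≤ M := fun j => (hM₂ j).mono fun x hx =>
    hx.trans (by linarith [le_abs_self (M₂ j), abs_nonneg (M₁ j), hle j])
  obtain ⟨L, hL0, hL, -⟩ := exists_abs_integral_comp_sub_le hΦ M
  choose E hEi hE hEb using fun N => exists_rate_integral_comp_mollify hu ht hC hf
    (fun j => Integrable.of_bound (hf₀ j) M (hM' j)) hΦ hM hL (N + 1)
  have hlimE : Filter.Tendsto (fun N => ∫ s in Ioc 0 t, E N s) Filter.atTop (nhds 0) := by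
    -- The dominating constant is the commutator bound at `l = 1`, left unsimplified so that it
    -- matches.
    have := tendsto_integral_of_dominated_convergence (μ := volume.restrict (Ioc 0 t))
      (F := E) (f := fun _ => 0) (fun _ => L * ∑ _j : ι, (4 * M ^ 2 / 1 + 16 * Real.pi ^ 2 * C * 1))
      (fun N => (hEi N).1) (integrable_const _)
      (fun N => ae_restrict_of_forall_mem measurableSet_Ioc fun s hs => ?_)
      (ae_restrict_of_forall_mem measurableSet_Ioc fun s hs => ?_)
    · simpa using this
    · have hs' : s ∈ Icc 0 t := Ioc_subset_Icc_self hs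
      refine (hEb N s hs).trans (mul_le_mul_of_nonneg_left (Finset.sum_le_sum fun j _ => ?_) hL0)
      refine ((hC s hs').integral_abs_commutator_le ((hf j).memLp_top hs'.1) N one_pos).trans ?_
      have := kernelOscillation_le (hM j s hs') (N + 1)
      gcongr
    · have hs' : s ∈ Icc 0 t := Ioc_subset_Icc_self hs
      refine squeeze_zero_norm (fun N => hEb N s hs) ?_
      have := (tendsto_finsetSum (Finset.univ : Finset ι) fun j _ =>
        tendsto_integral_abs_commutator (hC s hs') ((hf j).memLp_top hs'.1)).const_mul L
      simpa using this
  simp only [← hE] at hlimE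
  have h1 := (tendsto_integral_comp_mollify hΦ (fun j => (hf j).measurable_slice t ht)
    (fun j => hM j t ⟨ht, le_rfl⟩)).comp (Filter.tendsto_add_atTop_nat 1)
  have h2 := (tendsto_integral_comp_mollify hΦ hf₀ hM').comp
    (Filter.tendsto_add_atTop_nat 1)
  exact sub_eq_zero.1 (tendsto_nhds_unique (h1.sub h2) hlimE)

end Renormalization

end Torus2

/-! ### Bounded functions as the dual of `L¹`. -/

namespace Torus2

section Representation

variable {X : Type*} [MeasurableSpace X] {μ : Measure X} [IsProbabilityMeasure μ]

/-- The inclusion of `L²` in `L¹` on a probability space. -/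
noncomputable def lpTwoToOne (μ : Measure X) [IsProbabilityMeasure μ] :
    Lp ℝ 2 μ →L[ℝ] Lp ℝ 1 μ :=
  (ContinuousLinearMap.mul ℝ ℝ).holderL μ 2 2 1 (Lp.const 2 μ 1)

theorem coeFn_lpTwoToOne (h : Lp ℝ 2 μ) : lpTwoToOne μ h =ᵐ[μ] h := by
  have h1 := (ContinuousLinearMap.mul ℝ ℝ).coeFn_holder (r := 1) (Lp.const 2 μ (1 : ℝ)) h
  filter_upwards [h1, Lp.coeFn_const (p := 2) (μ := μ) (1 : ℝ)] with x hx hx'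
  rw [lpTwoToOne, ContinuousLinearMap.holderL_apply_apply, hx, hx']
  simp

/-- On a probability space `L²` embeds in `L¹`, so Riesz represents `Λ` on `L²` by some `F`.
Indicators give `|∫_s F| ≤ M μ(s)`, hence `|F| ≤ M`, and density of simple functions extends the
formula to `L¹`. -/
theorem exists_bounded_density (Λ : StrongDual ℝ (Lp ℝ 1 μ)) {M : ℝ} (hΛ : ‖Λ‖ ≤ M) :
    ∃ f : X → ℝ, AEStronglyMeasurable f μ ∧ (∀ᵐ x ∂μ, |f x| ≤ M) ∧
      ∀ h : Lp ℝ 1 μ, Λ h = ∫ x, f x * h x ∂μ := by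
  have hM0 : 0 ≤ M := (norm_nonneg _).trans hΛ
  set F : Lp ℝ 2 μ := (InnerProductSpace.toDual ℝ (Lp ℝ 2 μ)).symm (Λ.comp (lpTwoToOne μ)) with hF
  have hFΛ : ∀ h : Lp ℝ 2 μ, Λ (lpTwoToOne μ h) = ∫ x, F x * h x ∂μ := by
    intro h
    have : inner ℝ F h = Λ (lpTwoToOne μ h) := by
      rw [hF, InnerProductSpace.toDual_symm_apply]
      rfl
    rw [← this, L2.inner_def]
    exact integral_congr_ae (Filter.Eventually.of_forall fun x => by simp [mul_comm])
  have hFi : Integrable F μ := (Lp.memLp F).integrable (by norm_num)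
  have hset : ∀ s, MeasurableSet s → |∫ x in s, F x ∂μ| ≤ M * μ.real s := by
    intro s hs
    set h : Lp ℝ 2 μ := indicatorConstLp 2 hs (measure_ne_top μ s) (1 : ℝ) with hh
    have hc : h =ᵐ[μ] s.indicator fun _ => (1 : ℝ) := indicatorConstLp_coeFn
    have h1 : ∫ x in s, F x ∂μ = Λ (lpTwoToOne μ h) := by
      rw [hFΛ, ← integral_indicator hs]
      refine integral_congr_ae ?_
      filter_upwards [hc] with x hx
      rw [hx]
      by_cases hxs : x ∈ s <;> simp [hxs]
    have h2 : ‖lpTwoToOne μ h‖ = μ.real s := by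
      rw [L1.norm_eq_integral_norm]
      have : ∫ x, ‖lpTwoToOne μ h x‖ ∂μ = ∫ x, s.indicator (fun _ => (1 : ℝ)) x ∂μ := by
        refine integral_congr_ae ?_
        filter_upwards [coeFn_lpTwoToOne h, hc] with x hx hx'
        rw [hx, hx']
        by_cases hxs : x ∈ s <;> simp [hxs]
      rw [this, integral_indicator hs]
      simp
    rw [h1, ← h2]
    exact (Λ.le_opNorm _).trans (mul_le_mul_of_nonneg_right hΛ (norm_nonneg _))
  have hb : ∀ᵐ x ∂μ, |F x| ≤ M := by
    have h1 : F ≤ᵐ[μ] fun _ => M := ae_le_of_forall_setIntegral_le hFi (integrable_const _)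
      fun s hs _ => by
        have := (le_abs_self _).trans (hset s hs)
        rw [setIntegral_const, smul_eq_mul]
        linarith
    have h2 : (fun _ => -M) ≤ᵐ[μ] F := ae_le_of_forall_setIntegral_le (integrable_const _) hFi
      fun s hs _ => by
        have := (neg_le_abs _).trans (hset s hs)
        rw [setIntegral_const, smul_eq_mul]
        linarith
    filter_upwards [h1, h2] with x hx hx'
    exact abs_le.2 ⟨hx', hx⟩
  refine ⟨F, Lp.aestronglyMeasurable F, hb, fun h => ?_⟩
  have hFtop : MemLp F ⊤ μ := memLp_top_of_bound (Lp.aestronglyMeasurable F) M hb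
  set Ψ := (ContinuousLinearMap.mul ℝ ℝ).lpPairing μ ⊤ 1 hFtop.toLp with hΨ
  have hΨe : ∀ h : Lp ℝ 1 μ, Ψ h = ∫ x, F x * h x ∂μ := by
    intro h
    rw [hΨ, ContinuousLinearMap.lpPairing_eq_integral]
    refine integral_congr_ae ?_
    filter_upwards [hFtop.coeFn_toLp] with x hx
    simp [hx]
  rw [← hΨe]
  have hΛ2 : ∀ h : Lp ℝ 2 μ, Λ (lpTwoToOne μ h) = Ψ (lpTwoToOne μ h) := by
    intro h
    rw [hFΛ, hΨe]
    refine integral_congr_ae ?_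
    filter_upwards [coeFn_lpTwoToOne h] with x hx
    rw [hx]
  induction h using Lp.induction ENNReal.one_ne_top with
  | indicatorConst c hs hμs =>
    have : (↑(Lp.simpleFunc.indicatorConst 1 hs hμs.ne c) : Lp ℝ 1 μ) =
        lpTwoToOne μ (indicatorConstLp 2 hs hμs.ne c) := by
      rw [Lp.simpleFunc.coe_indicatorConst]
      refine Lp.ext ?_
      exact indicatorConstLp_coeFn.trans
        (indicatorConstLp_coeFn.symm.trans (coeFn_lpTwoToOne _).symm)
    rw [this, hΛ2]
  | add hf hg _ h1 h2 => rw [map_add, map_add, h1, h2]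
  | isClosed => exact isClosed_eq Λ.continuous Ψ.continuous

/-- The bound forces `ℓ` to vanish where `T v = 0` almost everywhere, so `ℓ` descends to the range
of `T` in `L¹`; Hahn-Banach extends it with the same norm. -/
theorem exists_bounded_representation {V : Type*} [AddCommGroup V] [Module ℝ V]
    (T : V →ₗ[ℝ] X → ℝ) (hT : ∀ v, Integrable (T v) μ) (ℓ : V →ₗ[ℝ] ℝ) {M : ℝ} (hM : 0 ≤ M)
    (hℓ : ∀ v, |ℓ v| ≤ M * ∫ x, |T v x| ∂μ) :
    ∃ f : X → ℝ, AEStronglyMeasurable f μ ∧ (∀ᵐ x ∂μ, |f x| ≤ M) ∧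
      ∀ v, ℓ v = ∫ x, f x * T v x ∂μ := by
  set S : V →ₗ[ℝ] Lp ℝ 1 μ :=
    { toFun := fun v => (hT v).toL1 (T v)
      map_add' := fun v w => by simp only [map_add]; exact Integrable.toL1_add _ _ (hT v) (hT w)
      map_smul' := fun c v => by simp only [map_smul]; exact Integrable.toL1_smul _ (hT v) c }
    with hS
  have hSn : ∀ v, ‖S v‖ = ∫ x, |T v x| ∂μ := by
    intro v
    rw [L1.norm_eq_integral_norm]
    refine integral_congr_ae ?_
    filter_upwards [(hT v).coeFn_toL1] with x hx
    simp only [hS, LinearMap.coe_mk, AddHom.coe_mk, Real.norm_eq_abs]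
    rw [hx]
  have hker : LinearMap.ker S ≤ LinearMap.ker ℓ := by
    intro v hv
    rw [LinearMap.mem_ker] at hv ⊢
    have := hℓ v
    rw [← hSn, hv, norm_zero, mul_zero] at this
    exact abs_eq_zero.1 (le_antisymm this (abs_nonneg _))
  set g : LinearMap.range S →ₗ[ℝ] ℝ :=
    ((LinearMap.ker S).liftQ ℓ hker).comp S.quotKerEquivRange.symm.toLinearMap with hg
  have hgv : ∀ v (h : S v ∈ LinearMap.range S), g ⟨S v, h⟩ = ℓ v := by
    intro v h
    rw [hg, LinearMap.comp_apply, LinearEquiv.coe_coe, LinearMap.quotKerEquivRange_symm_apply_image]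
    simp
  have hgn : ∀ y, ‖g y‖ ≤ M * ‖y‖ := by
    intro y
    obtain ⟨v, hv⟩ := LinearMap.mem_range.1 y.2
    have hy : y = ⟨S v, LinearMap.mem_range_self S v⟩ := Subtype.ext hv.symm
    rw [hy, hgv]
    exact (hℓ v).trans_eq (by rw [← hSn, Submodule.coe_norm])
  obtain ⟨Λ, hΛ, hΛn⟩ := exists_extension_norm_eq (LinearMap.range S) (g.mkContinuous M hgn)
  obtain ⟨f, hfm, hfM, hf⟩ := exists_bounded_density Λ (M := M)
    (hΛn.trans_le (g.mkContinuous_norm_le hM hgn))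
  refine ⟨f, hfm, hfM, fun v => ?_⟩
  have h1 := hΛ ⟨S v, LinearMap.mem_range_self S v⟩
  rw [LinearMap.mkContinuous_apply, hgv] at h1
  rw [← h1, hf]
  refine integral_congr_ae ?_
  filter_upwards [(hT v).coeFn_toL1] with x hx
  simp only [hS, LinearMap.coe_mk, AddHom.coe_mk]
  rw [hx]

end Representation

end Torus2

/-! ### Existence of a space-time solution by duality. -/

namespace Torus2

/-- Passing to the probability measure `w κ` and to `T v / w` leaves all `L¹` norms and pairings
unchanged, so infinite measures such as `halfSpaceMeasure` are covered. -/
theorem exists_bounded_representation_of_density {X : Type*} [MeasurableSpace X] {κ : Measure X}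
    {w : X → ℝ≥0} (hw : Measurable w) (hw0 : ∀ x, w x ≠ 0) (hw1 : ∫⁻ x, w x ∂κ = 1)
    {V : Type*} [AddCommGroup V] [Module ℝ V]
    (T : V →ₗ[ℝ] X → ℝ) (hT : ∀ v, Integrable (T v) κ) (ℓ : V →ₗ[ℝ] ℝ) {M : ℝ} (hM : 0 ≤ M)
    (hℓ : ∀ v, |ℓ v| ≤ M * ∫ x, |T v x| ∂κ) :
    ∃ f : X → ℝ, AEStronglyMeasurable f κ ∧ (∀ᵐ x ∂κ, |f x| ≤ M) ∧
      ∀ v, ℓ v = ∫ x, f x * T v x ∂κ := by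
  set ν := κ.withDensity fun x => (w x : ENNReal) with hν
  have : IsProbabilityMeasure ν := ⟨by
    rw [hν, withDensity_apply _ MeasurableSet.univ, Measure.restrict_univ, hw1]⟩
  have hac : κ ≪ ν := withDensity_absolutelyContinuous' hw.coe_nnreal_ennreal.aemeasurable
    (Filter.Eventually.of_forall fun x => by simpa using hw0 x)
  set T' : V →ₗ[ℝ] X → ℝ :=
    { toFun := fun v x => (w x : ℝ)⁻¹ * T v x
      map_add' := fun v v' => by ext x; simp [mul_add]
      map_smul' := fun c v => by ext x; simp; ring } with hT'
  have hw0' : ∀ x, (w x : ℝ) ≠ 0 := fun x => by exact_mod_cast hw0 x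
  have e1 : ∀ v x, w x • T' v x = T v x := fun v x => by
    simp only [hT', LinearMap.coe_mk, AddHom.coe_mk, NNReal.smul_def, smul_eq_mul]
    rw [mul_inv_cancel_left₀ (hw0' x)]
  have hT'i : ∀ v, Integrable (T' v) ν := fun v => by
    rw [hν, integrable_withDensity_iff_integrable_smul hw]
    simpa only [e1] using hT v
  obtain ⟨f, hfm, hfM, hf⟩ := exists_bounded_representation T' hT'i ℓ hM fun v => by
    refine (hℓ v).trans_eq ?_
    rw [hν, integral_withDensity_eq_integral_smul hw]
    congr 1
    refine integral_congr_ae (Filter.Eventually.of_forall fun x => ?_)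
    simp only
    rw [← e1, NNReal.smul_def, NNReal.smul_def, smul_eq_mul, smul_eq_mul, abs_mul,
      NNReal.abs_eq]
  refine ⟨f, hfm.mono_ac hac, hac.ae_le hfM, fun v => ?_⟩
  rw [hf, hν, integral_withDensity_eq_integral_smul hw]
  refine integral_congr_ae (Filter.Eventually.of_forall fun x => ?_)
  simp only
  rw [← mul_smul_comm, e1]

/-- A velocity field which is weakly divergence-free at every nonnegative time. -/
def IsDivergenceFreeVelocity (u : ℝ → Torus2 → Fin 2 → ℝ) : Prop :=
  ∀ s, 0 ≤ s → (∀ i, Integrable fun x => u s x i) ∧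
    ∀ η : Torus2 → ℝ, IsCn ⊤ η → ∫ x, ∑ i, u s x i * partialDeriv i η x = 0

variable {u : ℝ → Torus2 → Fin 2 → ℝ}

theorem hasDerivAt_sqrt_sq_add {δ : ℝ} (hδ : 0 < δ) (r : ℝ) :
    HasDerivAt (fun r => √(r ^ 2 + δ ^ 2)) (r / √(r ^ 2 + δ ^ 2)) r := by
  have h := ((hasDerivAt_pow 2 r).add_const (δ ^ 2)).sqrt (by positivity)
  refine h.congr_deriv ?_
  have : √(r ^ 2 + δ ^ 2) ≠ 0 := by positivity
  field_simp
  simp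

theorem abs_div_sqrt_sq_add_le {δ : ℝ} (hδ : 0 < δ) (r : ℝ) : |r / √(r ^ 2 + δ ^ 2)| ≤ 1 := by
  have h : 0 < √(r ^ 2 + δ ^ 2) := by positivity
  rw [abs_div, abs_of_pos h, div_le_one h]
  exact Real.abs_le_sqrt (by nlinarith)

/-- The backward `L¹` estimate for the transport equation with a source. With `β(r) = √(r² + δ²)`,
`β'(η)` times the material derivative of `η` is the material derivative of `β(η)`; incompressibility
removes its spatial part, and the time integral leaves `δ - β(η 0)`. Since `|β'| ≤ 1`, letting `δ`
tend to zero concludes. -/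
theorem integral_abs_le_integral_abs_materialDeriv (hu : IsLocallyIntegrableVelocity u)
    (hdiv : IsDivergenceFreeVelocity u) {η : ℝ → Torus2 → ℝ} (hη : IsSpaceTimeTest η) {T : ℝ}
    (hT : 0 ≤ T) (hηT : η T = 0) :
    ∫ x, |η 0 x| ≤ ∫ p, |materialDeriv u η p.1 p.2| ∂((volume.restrict (Icc 0 T)).prod volume) := by
  refine le_of_forall_pos_le_add fun δ hδ => ?_
  set β : ℝ → ℝ := fun r => √(r ^ 2 + δ ^ 2) with hβ
  set β' : ℝ → ℝ := fun r => r / √(r ^ 2 + δ ^ 2) with hβ'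
  have hβs : ContDiff ℝ (⊤ : ℕ∞) β := ContDiff.sqrt (by fun_prop) fun r => by positivity
  have hβd : ∀ r, HasDerivAt β (β' r) r := hasDerivAt_sqrt_sq_add hδ
  have hβ'c : Continuous β' := by
    refine continuous_id.div (by fun_prop) fun r => ?_
    positivity
  have hηc : Continuous fun p : ℝ × Torus2 => η p.1 p.2 := hη.continuous
  have hgc : Continuous fun p : ℝ × Torus2 => β' (η p.1 p.2) := hβ'c.comp hηc
  have i1 : Integrable (fun p : ℝ × Torus2 => β' (η p.1 p.2) * materialDeriv u η p.1 p.2)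
      ((volume.restrict (Icc 0 T)).prod volume) :=
    integrable_mul_materialDeriv hu hη (M := 1) (f := fun t x => β' (η t x))
      hgc.aestronglyMeasurable
      (Filter.Eventually.of_forall fun p => abs_div_sqrt_sq_add_le hδ _)
  have i2 : Integrable (fun p : ℝ × Torus2 => β' (η p.1 p.2) * deriv (fun r => η r p.2) p.1)
      ((volume.restrict (Icc 0 T)).prod volume) :=
    integrable_prod_of_continuous T (hgc.mul hη.continuous_deriv)
  have e1 : ∫ p, β' (η p.1 p.2) * materialDeriv u η p.1 p.2
      ∂((volume.restrict (Icc 0 T)).prod volume) =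
      ∫ p, β' (η p.1 p.2) * deriv (fun r => η r p.2) p.1
        ∂((volume.restrict (Icc 0 T)).prod volume) := by
    rw [integral_prod _ i1, integral_prod _ i2]
    refine setIntegral_congr_fun measurableSet_Icc fun s hs => ?_
    have h1 : Integrable fun x => β' (η s x) * deriv (fun r => η r x) s :=
      integrable_of_continuous ((hgc.mul hη.continuous_deriv).comp (Continuous.prodMk_right s))
    have h2 := (hdiv s hs.1).2 _ ((hη.isCn s).comp hβs)
    have h3 : Integrable fun x => ∑ i, u s x i * partialDeriv i (fun x => β (η s x)) x :=
      integrable_finsetSum _ fun i _ => ((hdiv s hs.1).1 i).mul_continuous_torus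
        (((hη.isCn s).comp hβs).partialDeriv i).continuous
    simp only
    rw [← add_zero (∫ x, β' (η s x) * deriv (fun r => η r x) s), ← h2, ← integral_add h1 h3]
    refine integral_congr_ae (Filter.Eventually.of_forall fun x => ?_)
    simp only [partialDeriv_comp hβs (hη.isCn s), (hβd _).deriv, materialDeriv, mul_add,
      Finset.mul_sum]
    congr 1
    exact Finset.sum_congr rfl fun i _ => by ring
  have e2 : ∫ p, β' (η p.1 p.2) * deriv (fun r => η r p.2) p.1
        ∂((volume.restrict (Icc 0 T)).prod volume) = ∫ x, (δ - β (η 0 x)) := by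
    rw [integral_prod_symm _ i2]
    refine integral_congr_ae (Filter.Eventually.of_forall fun x => ?_)
    simp only
    rw [integral_Icc_eq_integral_Ioc, ← intervalIntegral.integral_of_le hT,
      intervalIntegral.integral_eq_sub_of_hasDerivAt
        (fun s _ => (hβd (η s x)).comp s (hη.hasDerivAt s x))
        (((hgc.mul hη.continuous_deriv).comp (Continuous.prodMk_left x)).intervalIntegrable _ _)]
    simp [hηT, hβ, Real.sqrt_sq hδ.le]
  have hβc : Continuous fun x => β (η 0 x) := ((hη.isCn 0).comp hβs).continuous
  rw [integral_sub (integrable_const _) (integrable_of_continuous hβc)] at e2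
  simp only [integral_const, probReal_univ, one_smul] at e2
  have h3 : ∫ x, |η 0 x| ≤ ∫ x, β (η 0 x) :=
    integral_mono (integrable_of_continuous (hη.isCn 0).continuous.abs)
      (integrable_of_continuous hβc) fun x => Real.abs_le_sqrt (by nlinarith)
  have h4 : |∫ p, β' (η p.1 p.2) * materialDeriv u η p.1 p.2
      ∂((volume.restrict (Icc 0 T)).prod volume)| ≤
      ∫ p, |materialDeriv u η p.1 p.2| ∂((volume.restrict (Icc 0 T)).prod volume) := by
    refine abs_integral_le_integral_abs.trans (integral_mono i1.abs
      (integrable_materialDeriv hu hη T).abs fun p => ?_)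
    simp only [abs_mul]
    exact mul_le_of_le_one_left (abs_nonneg _) (abs_div_sqrt_sq_add_le hδ _)
  rw [e1, e2] at h4
  linarith [neg_le_abs (δ - ∫ x, β (η 0 x))]

/-- The measure on `[0, ∞) × 𝕋²`. -/
noncomputable def halfSpaceMeasure : Measure (ℝ × Torus2) :=
  (volume.restrict (Ici 0)).prod volume

theorem halfSpaceMeasure_restrict (T : ℝ) :
    halfSpaceMeasure.restrict (Iic T ×ˢ univ) = (volume.restrict (Icc 0 T)).prod volume := by
  rw [halfSpaceMeasure, ← Measure.prod_restrict, Measure.restrict_univ,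
    Measure.restrict_restrict measurableSet_Iic, inter_comm, Ici_inter_Iic]

theorem integral_halfSpaceMeasure {g : ℝ × Torus2 → ℝ} {T : ℝ} (hg : ∀ p, T < p.1 → g p = 0) :
    ∫ p, g p ∂halfSpaceMeasure = ∫ p, g p ∂((volume.restrict (Icc 0 T)).prod volume) := by
  rw [← halfSpaceMeasure_restrict]
  exact (setIntegral_eq_integral_of_forall_compl_eq_zero fun p hp => hg p (by
    simpa using hp)).symm

theorem integrable_halfSpaceMeasure {g : ℝ × Torus2 → ℝ} {T : ℝ} (hg : ∀ p, T < p.1 → g p = 0)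
    (hi : Integrable g ((volume.restrict (Icc 0 T)).prod volume)) :
    Integrable g halfSpaceMeasure := by
  rw [← halfSpaceMeasure_restrict] at hi
  refine (integrableOn_iff_integrable_of_support_subset fun p hp => ?_).1 hi
  by_contra h
  exact hp (hg p (by simpa using h))

theorem materialDeriv_eq_zero {η : ℝ → Torus2 → ℝ} {T : ℝ} (h : ∀ t, T ≤ t → η t = 0) {s : ℝ}
    (hs : T < s) (x : Torus2) : materialDeriv u η s x = 0 := by
  have h1 : (fun r => η r x) =ᶠ[nhds s] fun _ => 0 := by
    filter_upwards [Ioi_mem_nhds hs] with r hr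
    rw [h r (le_of_lt hr)]
    rfl
  rw [materialDeriv, h1.deriv_eq, h s hs.le]
  simp [partialDeriv]

theorem materialDeriv_add {η θ : ℝ → Torus2 → ℝ} (hη : IsSpaceTimeTest η)
    (hθ : IsSpaceTimeTest θ) (s : ℝ) (x : Torus2) :
    materialDeriv u (η + θ) s x = materialDeriv u η s x + materialDeriv u θ s x := by
  have h1 : deriv (fun r => (η + θ) r x) s = deriv (fun r => η r x) s + deriv (fun r => θ r x) s :=
    ((hη.hasDerivAt s x).add (hθ.hasDerivAt s x)).deriv
  have h2 : ∀ i, partialDeriv i ((η + θ) s) x = partialDeriv i (η s) x + partialDeriv i (θ s) x :=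
    fun i => (((hη.isCn s).hasDerivAt (by simp) i x).add
      ((hθ.isCn s).hasDerivAt (by simp) i x)).deriv
  simp only [materialDeriv, h1, h2, mul_add, Finset.sum_add_distrib]
  ring

theorem materialDeriv_mul {χ : ℝ → ℝ} {χ' : ℝ} {s : ℝ} (hχ : HasDerivAt χ χ' s)
    {η : ℝ → Torus2 → ℝ} (hη : IsSpaceTimeTest η) (x : Torus2) :
    materialDeriv u (fun t x => χ t * η t x) s x = χ' * η s x + χ s * materialDeriv u η s x := by
  have h1 : deriv (fun r => χ r * η r x) s = χ' * η s x + χ s * deriv (fun r => η r x) s :=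
    (hχ.mul (hη.hasDerivAt s x)).deriv
  have h2 : ∀ i, partialDeriv i (fun x => χ s * η s x) x = χ s * partialDeriv i (η s) x :=
    fun i => (((hη.isCn s).hasDerivAt (by simp) i x).const_mul (χ s)).deriv
  simp only [materialDeriv, h1, h2, mul_add, Finset.mul_sum]
  rw [add_assoc]
  congr 2
  exact Finset.sum_congr rfl fun i _ => by ring

theorem IsSpaceTimeTest.add {η θ : ℝ → Torus2 → ℝ} (hη : IsSpaceTimeTest η)
    (hθ : IsSpaceTimeTest θ) : IsSpaceTimeTest (η + θ) :=
  ContDiff.add hη hθ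

theorem IsSpaceTimeTest.mul_time {χ : ℝ → ℝ} (hχ : ContDiff ℝ (⊤ : ℕ∞) χ) {η : ℝ → Torus2 → ℝ}
    (hη : IsSpaceTimeTest η) : IsSpaceTimeTest fun t x => χ t * η t x :=
  ContDiff.mul (hχ.comp contDiff_fst) hη

/-- The space-time test functions which vanish for large times. -/
def testSubmodule : Submodule ℝ (ℝ → Torus2 → ℝ) where
  carrier := {η | IsSpaceTimeTest η ∧ ∃ T, ∀ t, T ≤ t → η t = 0}
  add_mem' := by
    rintro η θ ⟨hη, T, hT⟩ ⟨hθ, S, hS⟩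
    exact ⟨hη.add hθ, max T S, fun t ht => by
      simp [hT t ((le_max_left _ _).trans ht), hS t ((le_max_right _ _).trans ht)]⟩
  zero_mem' := ⟨contDiff_const, 0, fun t _ => rfl⟩
  smul_mem' := by
    rintro c η ⟨hη, T, hT⟩
    exact ⟨hη.mul_time contDiff_const, T, fun t ht => by simp [hT t ht]⟩

theorem exists_spaceTime_solution (hu : IsLocallyIntegrableVelocity u)
    (hdiv : IsDivergenceFreeVelocity u) {f₀ : Torus2 → ℝ} (hf₀ : Integrable f₀) {M : ℝ}
    (hM0 : 0 ≤ M) (hM : ∀ᵐ x, |f₀ x| ≤ M) :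
    ∃ f : ℝ × Torus2 → ℝ, AEStronglyMeasurable f halfSpaceMeasure ∧
      (∀ᵐ p ∂halfSpaceMeasure, |f p| ≤ M) ∧ ∀ η ∈ testSubmodule,
        -∫ x, f₀ x * η 0 x = ∫ p, f p * materialDeriv u η p.1 p.2 ∂halfSpaceMeasure := by
  -- The density `e^{-t}` has total mass one on `[0, ∞) × 𝕋²`.
  set w : ℝ × Torus2 → ℝ≥0 := fun p => Real.toNNReal (Real.exp (-p.1)) with hw
  have hwm : Measurable w := by
    have : Measurable fun p : ℝ × Torus2 => Real.exp (-p.1) := by fun_prop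
    exact this.real_toNNReal
  have hw1 : ∫⁻ p, w p ∂halfSpaceMeasure = 1 := by
    rw [halfSpaceMeasure, lintegral_prod _ hwm.coe_nnreal_ennreal.aemeasurable]
    simp only [hw, lintegral_const, measure_univ, mul_one]
    change ∫⁻ t in Ici (0 : ℝ), ENNReal.ofReal (Real.exp (-t)) = 1
    rw [← ofReal_integral_eq_lintegral_ofReal, integral_Ici_eq_integral_Ioi,
      integral_exp_neg_Ioi_zero,
      ENNReal.ofReal_one]
    · exact (integrableOn_Ici_iff_integrableOn_Ioi).2 (integrableOn_exp_neg_Ioi 0)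
    · exact Filter.Eventually.of_forall fun t => (Real.exp_pos _).le
  set T : testSubmodule →ₗ[ℝ] ℝ × Torus2 → ℝ :=
    { toFun := fun η p => materialDeriv u η.1 p.1 p.2
      map_add' := fun η θ => by
        ext p
        exact materialDeriv_add η.2.1 θ.2.1 p.1 p.2
      map_smul' := fun c η => by
        ext p
        have := materialDeriv_mul (u := u) (hasDerivAt_const p.1 c) η.2.1 p.2
        rw [zero_mul, zero_add] at this
        exact this } with hTdef
  set ℓ : testSubmodule →ₗ[ℝ] ℝ :=
    { toFun := fun η => -∫ x, f₀ x * η.1 0 x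
      map_add' := fun η θ => by
        rw [← neg_add, ← integral_add (hf₀.mul_continuous_torus (η.2.1.isCn 0).continuous)
          (hf₀.mul_continuous_torus (θ.2.1.isCn 0).continuous)]
        simp [mul_add]
      map_smul' := fun c η => by
        simp only [RingHom.id_apply, smul_eq_mul]
        rw [mul_neg, ← integral_const_mul]
        simp [mul_left_comm] } with hℓdef
  have hTi : ∀ η, Integrable (T η) halfSpaceMeasure := fun η => by
    obtain ⟨hη, S, hS⟩ := η.2
    exact integrable_halfSpaceMeasure (fun p hp => materialDeriv_eq_zero hS hp p.2)
      (integrable_materialDeriv hu hη S)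
  have hbound : ∀ η, |ℓ η| ≤ M * ∫ p, |T η p| ∂halfSpaceMeasure := fun η => by
    obtain ⟨hη, S, hS⟩ := η.2
    -- The final time of the `L¹` estimate must be nonnegative, whereas `S` may have any sign.
    have hS' : ∀ t, max S 0 ≤ t → η.1 t = 0 := fun t ht => hS t ((le_max_left _ _).trans ht)
    have h1 := integral_abs_le_integral_abs_materialDeriv hu hdiv hη (le_max_right S 0)
      (hS' _ le_rfl)
    have h2 : ∫ p, |materialDeriv u η.1 p.1 p.2| ∂halfSpaceMeasure =
        ∫ p, |materialDeriv u η.1 p.1 p.2| ∂((volume.restrict (Icc 0 (max S 0))).prod volume) :=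
      integral_halfSpaceMeasure fun p hp => by rw [materialDeriv_eq_zero hS' hp p.2, abs_zero]
    simp only [hℓdef, hTdef, LinearMap.coe_mk, AddHom.coe_mk, abs_neg]
    rw [h2]
    refine le_trans ?_ (mul_le_mul_of_nonneg_left h1 hM0)
    rw [← integral_const_mul]
    refine abs_integral_le_integral_abs.trans (integral_mono_of_nonneg
      (Filter.Eventually.of_forall fun x => abs_nonneg _)
      ((integrable_of_continuous (hη.isCn 0).continuous.abs).const_mul M) ?_)
    filter_upwards [hM] with x hx
    simp only [abs_mul]
    gcongr
  obtain ⟨f, hfm, hfM, hf⟩ := exists_bounded_representation_of_density hwm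
    (fun p => by simp [hw, Real.exp_pos]) hw1 T hTi ℓ hM0 hbound
  exact ⟨f, hfm, hfM, fun η hη => hf ⟨η, hη⟩⟩

end Torus2

/-! ### From space-time solutions to slices at every time. -/

namespace Torus2

variable {u : ℝ → Torus2 → Fin 2 → ℝ} {f₀ : Torus2 → ℝ} {f : ℝ → Torus2 → ℝ} {M : ℝ}

/-- A bounded function on `[0, ∞) × 𝕋²` solving the transport equation in the sense of space-time
distributions. -/
structure IsSpaceTimeSolution (u : ℝ → Torus2 → Fin 2 → ℝ) (f₀ : Torus2 → ℝ)
    (f : ℝ → Torus2 → ℝ) (M : ℝ) : Prop where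
  measurable : AEStronglyMeasurable (fun p : ℝ × Torus2 => f p.1 p.2) halfSpaceMeasure
  bounded : ∀ᵐ p ∂halfSpaceMeasure, |f p.1 p.2| ≤ M
  weak_eq : ∀ η ∈ testSubmodule,
    -∫ x, f₀ x * η 0 x = ∫ p, f p.1 p.2 * materialDeriv u η p.1 p.2 ∂halfSpaceMeasure

/-- The rate of change of `∫ f(t) η(t)`. -/
noncomputable def pairingRate (u : ℝ → Torus2 → Fin 2 → ℝ) (f η : ℝ → Torus2 → ℝ) (s : ℝ) : ℝ :=
  ∫ x, f s x * materialDeriv u η s x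

/-- The value of `∫ f(t) η(t)` predicted by the transport equation. -/
noncomputable def pairingPrimitive (u : ℝ → Torus2 → Fin 2 → ℝ) (f₀ : Torus2 → ℝ)
    (f η : ℝ → Torus2 → ℝ) (t : ℝ) : ℝ :=
  (∫ x, f₀ x * η 0 x) + ∫ s in (0 : ℝ)..t, pairingRate u f η s

namespace IsSpaceTimeSolution

theorem ae_slice (h : IsSpaceTimeSolution u f₀ f M) :
    ∀ᵐ s ∂(volume.restrict (Ici (0 : ℝ))), AEStronglyMeasurable (f s) volume ∧
      ∀ᵐ x, |f s x| ≤ M := by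
  filter_upwards [h.measurable.prodMk_left, Measure.ae_ae_of_ae_prod h.bounded] with s h1 h2
  exact ⟨h1, h2⟩

theorem restrict_Icc_le (T : ℝ) : (volume.restrict (Icc 0 T)).prod (volume : Measure Torus2) ≤
    halfSpaceMeasure := by
  rw [← halfSpaceMeasure_restrict]
  exact Measure.restrict_le_self

theorem integrable_mul_materialDeriv (h : IsSpaceTimeSolution u f₀ f M)
    (hu : IsLocallyIntegrableVelocity u) {η : ℝ → Torus2 → ℝ} (hη : IsSpaceTimeTest η) (T : ℝ) :
    Integrable (fun p : ℝ × Torus2 => f p.1 p.2 * materialDeriv u η p.1 p.2)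
      ((volume.restrict (Icc 0 T)).prod volume) :=
  Torus2.integrable_mul_materialDeriv hu hη (h.measurable.mono_measure (restrict_Icc_le T))
    (Measure.absolutelyContinuous_of_le (restrict_Icc_le T) |>.ae_le h.bounded)

theorem integrable_mul (h : IsSpaceTimeSolution u f₀ f M) {η : ℝ → Torus2 → ℝ}
    (hη : IsSpaceTimeTest η) (T : ℝ) :
    Integrable (fun p : ℝ × Torus2 => f p.1 p.2 * η p.1 p.2)
      ((volume.restrict (Icc 0 T)).prod volume) :=
  integrable_prod_mul_continuous (f := fun p => f p.1 p.2)
    (Integrable.of_bound (h.measurable.mono_measure (restrict_Icc_le T)) M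
      (Measure.absolutelyContinuous_of_le (restrict_Icc_le T) |>.ae_le h.bounded)) hη.continuous

theorem integrableOn_pairingRate (h : IsSpaceTimeSolution u f₀ f M)
    (hu : IsLocallyIntegrableVelocity u) {η : ℝ → Torus2 → ℝ} (hη : IsSpaceTimeTest η) (T : ℝ) :
    IntegrableOn (pairingRate u f η) (Icc 0 T) :=
  (h.integrable_mul_materialDeriv hu hη T).integral_prod_left

theorem intervalIntegrable_pairingRate (h : IsSpaceTimeSolution u f₀ f M)
    (hu : IsLocallyIntegrableVelocity u) {η : ℝ → Torus2 → ℝ} (hη : IsSpaceTimeTest η) {T : ℝ}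
    (hT : 0 ≤ T) : IntervalIntegrable (pairingRate u f η) volume 0 T := by
  rw [intervalIntegrable_iff_integrableOn_Icc_of_le hT]
  exact h.integrableOn_pairingRate hu hη T

theorem continuousOn_pairingPrimitive (h : IsSpaceTimeSolution u f₀ f M)
    (hu : IsLocallyIntegrableVelocity u) {η : ℝ → Torus2 → ℝ} (hη : IsSpaceTimeTest η) {T : ℝ}
    (hT : 0 ≤ T) : ContinuousOn (pairingPrimitive u f₀ f η) (Icc 0 T) := by
  have h1 := h.integrableOn_pairingRate hu hη T
  rw [← uIcc_of_le hT] at h1 ⊢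
  exact continuousOn_const.add (intervalIntegral.continuousOn_primitive_interval h1)

/-- The weak equation tested with `χ(s) η`, where `χ' = θ`, followed by integration by parts in
time; the boundary value `χ 0` brings in the initial datum. -/
theorem integral_mul_sub_pairingPrimitive (h : IsSpaceTimeSolution u f₀ f M)
    (hu : IsLocallyIntegrableVelocity u) {η : ℝ → Torus2 → ℝ} (hη : IsSpaceTimeTest η)
    {θ : ℝ → ℝ} (hθ : ContDiff ℝ (⊤ : ℕ∞) θ) {R : ℝ} (hR : 0 ≤ R) (hθR : ∀ s, R < s → θ s = 0) :
    ∫ s in Icc 0 R, θ s * ((∫ x, f s x * η s x) - pairingPrimitive u f₀ f η s) = 0 := by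
  -- The primitive is based at `R`, so it vanishes for all times after `R`, as membership in
  -- `testSubmodule` requires.
  set χ : ℝ → ℝ := fun s => ∫ r in R..s, θ r with hχ
  have hχd : ∀ s, HasDerivAt χ (θ s) s := fun s =>
    (hθ.continuous.integral_hasStrictDerivAt R s).hasDerivAt
  have hχs : ContDiff ℝ (⊤ : ℕ∞) χ := by
    refine contDiff_infty_iff_deriv.2 ⟨fun s => (hχd s).differentiableAt, ?_⟩
    rwa [funext fun s => (hχd s).deriv]
  have hχR : ∀ s, R ≤ s → χ s = 0 := fun s hs => by
    rw [hχ]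
    simp only
    rw [intervalIntegral.integral_of_le hs]
    exact setIntegral_eq_zero_of_forall_eq_zero fun r hr => hθR r hr.1
  have hmem : (fun t x => χ t * η t x) ∈ testSubmodule :=
    ⟨hη.mul_time hχs, R, fun t ht => by ext x; simp [hχR t ht]⟩
  have h1 := h.weak_eq _ hmem
  set c := ∫ x, f₀ x * η 0 x with hc
  set q := pairingRate u f η with hq
  set Q : ℝ → ℝ := fun s => ∫ r in (0 : ℝ)..s, q r with hQ
  set p : ℝ → ℝ := fun s => ∫ x, f s x * η s x with hp
  have hi1 := h.integrable_mul hη R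
  have hi2 := h.integrable_mul_materialDeriv hu hη R
  have hpi : IntegrableOn p (Icc 0 R) := hi1.integral_prod_left
  have hqi : IntegrableOn q (Icc 0 R) := h.integrableOn_pairingRate hu hη R
  have hqii : IntervalIntegrable q volume 0 R := h.intervalIntegrable_pairingRate hu hη hR
  have hQc : ContinuousOn Q (Icc 0 R) := by
    have := hqi
    rw [← uIcc_of_le hR] at this ⊢
    exact intervalIntegral.continuousOn_primitive_interval this
  have hθi : ∀ {g : ℝ → ℝ} {k : ℝ → ℝ}, Continuous k → IntegrableOn g (Icc 0 R) →
      IntegrableOn (fun s => k s * g s) (Icc 0 R) := fun {g k} hk hg =>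
    hg.continuousOn_mul hk.continuousOn isCompact_Icc
  have h2 : ∫ p, f p.1 p.2 * materialDeriv u (fun t x => χ t * η t x) p.1 p.2 ∂halfSpaceMeasure =
      ∫ s in Icc 0 R, (θ s * p s + χ s * q s) := by
    rw [integral_halfSpaceMeasure (T := R) fun p hp => by
      rw [materialDeriv_eq_zero (T := R) (fun t ht => by ext x; simp [hχR t ht]) hp, mul_zero],
      integral_prod _ (h.integrable_mul_materialDeriv hu (hη.mul_time hχs) R)]
    refine integral_congr_ae ?_
    filter_upwards [hi1.prod_right_ae, hi2.prod_right_ae] with s hs1 hs2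
    simp only [hp, hq, pairingRate]
    rw [← integral_const_mul, ← integral_const_mul,
      ← integral_add (hs1.const_mul _) (hs2.const_mul _)]
    refine integral_congr_ae (Filter.Eventually.of_forall fun x => ?_)
    simp only [materialDeriv_mul (hχd s) hη]
    ring
  have h3 : ∫ s in Icc 0 R, χ s * q s = -∫ s in Icc 0 R, θ s * Q s := by
    have hQac : AbsolutelyContinuousOnInterval Q 0 R :=
      hqii.absolutelyContinuousOnInterval_intervalIntegral (by simp)
    have hχac : AbsolutelyContinuousOnInterval χ 0 R :=
      (hχs.contDiffOn.of_le (by exact_mod_cast le_top)).absolutelyContinuousOnInterval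
    have hibp := hχac.integral_mul_deriv_eq_deriv_mul hQac
    have e1 : ∫ s in (0 : ℝ)..R, χ s * deriv Q s = ∫ s in (0 : ℝ)..R, χ s * q s := by
      refine intervalIntegral.integral_congr_ae ?_
      filter_upwards [hqii.ae_hasDerivAt_integral] with s hs hst
      rw [(hs (uIoc_subset_uIcc hst) 0 (by simp)).deriv]
    simp only [(hχd _).deriv] at hibp
    rw [e1, hχR R le_rfl] at hibp
    simp only [hQ, intervalIntegral.integral_same, zero_mul, mul_zero, sub_zero, zero_sub] at hibp
    rw [intervalIntegral.integral_of_le hR, intervalIntegral.integral_of_le hR] at hibp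
    rw [integral_Icc_eq_integral_Ioc, integral_Icc_eq_integral_Ioc]
    exact hibp
  have h4 : -∫ x, f₀ x * (χ 0 * η 0 x) = ∫ s in Icc 0 R, θ s * c := by
    have hχ0 : χ 0 = -∫ s in Icc 0 R, θ s := by
      simp only [hχ]
      rw [intervalIntegral.integral_symm, intervalIntegral.integral_of_le hR,
        integral_Icc_eq_integral_Ioc]
    simp only [mul_left_comm _ (χ 0)]
    rw [integral_const_mul, integral_mul_const, ← hc, hχ0]
    ring
  have hθQ : IntegrableOn (fun s => θ s * Q s) (Icc 0 R) :=
    (hθ.continuous.continuousOn.mul hQc).integrableOn_Icc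
  have hθc : IntegrableOn (fun s => θ s * c) (Icc 0 R) :=
    (hθ.continuous.mul continuous_const).continuousOn.integrableOn_Icc
  have hθp := hθi hθ.continuous hpi
  rw [h2, h4, integral_add hθp (hθi hχs.continuous hqi), h3] at h1
  have e : ∀ s, θ s * (p s - pairingPrimitive u f₀ f η s) = θ s * p s - (θ s * c + θ s * Q s) := by
    intro s
    simp only [pairingPrimitive, hQ]
    ring
  refine (integral_congr_ae (Filter.Eventually.of_forall e)).trans ?_
  have hθcQ : IntegrableOn (fun s => θ s * c + θ s * Q s) (Icc 0 R) := hθc.add hθQ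
  rw [integral_sub hθp hθcQ, integral_add hθc hθQ]
  linarith

theorem ae_integral_mul_eq (h : IsSpaceTimeSolution u f₀ f M)
    (hu : IsLocallyIntegrableVelocity u) {η : ℝ → Torus2 → ℝ} (hη : IsSpaceTimeTest η) :
    ∀ᵐ s ∂(volume.restrict (Ici (0 : ℝ))),
      ∫ x, f s x * η s x = pairingPrimitive u f₀ f η s := by
  set g : ℝ → ℝ := fun s => (∫ x, f s x * η s x) - pairingPrimitive u f₀ f η s with hg
  have hgi : ∀ R, 0 ≤ R → IntegrableOn g (Icc 0 R) := fun R hR =>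
    Integrable.sub (h.integrable_mul hη R).integral_prod_left
      (h.continuousOn_pairingPrimitive hu hη hR).integrableOn_Icc
  have hcpt : ∀ K : Set ℝ, IsCompact K → ∃ R, 0 ≤ R ∧ K ⊆ Iic R := fun K hK => by
    obtain ⟨R, hR⟩ := hK.bddAbove
    exact ⟨max R 0, le_max_right _ _, fun x hx => (hR hx).trans (le_max_left _ _)⟩
  have hloc : LocallyIntegrable ((Ici 0).indicator g) := by
    rw [locallyIntegrable_iff]
    intro K hK
    obtain ⟨R, hR, hKR⟩ := hcpt K hK
    refine IntegrableOn.mono_set ?_ hKR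
    rw [integrableOn_indicator_iff measurableSet_Ici, Ici_inter_Iic]
    exact hgi R hR
  have hz := ae_eq_zero_of_integral_contDiff_smul_eq_zero hloc fun θ hθ hθc => by
    obtain ⟨R, hR, hKR⟩ := hcpt _ hθc
    have hθR : ∀ s, R < s → θ s = 0 := fun s hs => by
      by_contra hne
      exact absurd (hKR (subset_tsupport _ hne)) (not_le.2 hs)
    have h0 := h.integral_mul_sub_pairingPrimitive hu hη hθ hR hθR
    rw [← integral_indicator measurableSet_Icc] at h0
    refine (integral_congr_ae (Filter.Eventually.of_forall fun s => ?_)).trans h0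
    simp only [smul_eq_mul, indicator]
    by_cases h1 : 0 ≤ s
    · by_cases h2 : s ≤ R
      · simp [h1, h2, hg]
      · simp [h1, h2, hθR s (not_le.1 h2)]
    · simp [h1]
  rw [ae_restrict_iff' measurableSet_Ici]
  filter_upwards [hz] with s hs hs0
  rw [indicator_of_mem hs0] at hs
  exact sub_eq_zero.1 hs

/-- Continuity upgrades an inequality from almost every time to the given one. The interval reaches
to `t + 1` so that it is nondegenerate even for `t = 0`. -/
theorem _root_.Torus2.le_zero_of_ae_le_zero {g : ℝ → ℝ} {t : ℝ} (ht : 0 ≤ t)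
    (hg : ContinuousOn g (Icc 0 (t + 1))) (h : ∀ᵐ s ∂(volume.restrict (Ici (0 : ℝ))), g s ≤ 0) :
    g t ≤ 0 := by
  have h1 : (fun s => max (g s) 0) =ᵐ[volume.restrict (Icc 0 (t + 1))] fun _ => (0 : ℝ) := by
    filter_upwards [ae_restrict_of_ae_restrict_of_subset Icc_subset_Ici_self h] with s hs
    exact max_eq_right hs
  have h2 := Measure.eqOn_Icc_of_ae_eq volume (by linarith : (0 : ℝ) < t + 1).ne
    h1 (hg.sup continuousOn_const) continuousOn_const
  exact max_eq_right_iff.1 (h2 ⟨ht, by linarith⟩)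

theorem _root_.Torus2.abs_integral_mul_le {k ζ : Torus2 → ℝ} (hk : ∀ᵐ x, |k x| ≤ M)
    (hζ : Continuous ζ) : |∫ x, k x * ζ x| ≤ M * ∫ x, |ζ x| := by
  rw [← integral_const_mul]
  refine abs_integral_le_integral_abs.trans (integral_mono_of_nonneg
    (Filter.Eventually.of_forall fun x => abs_nonneg _)
    ((integrable_of_continuous hζ.abs).const_mul M) ?_)
  filter_upwards [hk] with x hx
  simp only [abs_mul]
  gcongr

/-- For almost every time the primitive equals `∫ f(s) η(s)`, which is linear in `η`; both sides are
continuous in time. -/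
theorem pairingPrimitive_linear (h : IsSpaceTimeSolution u f₀ f M)
    (hu : IsLocallyIntegrableVelocity u) {η₁ η₂ η₃ : ℝ → Torus2 → ℝ} (h₁ : IsSpaceTimeTest η₁)
    (h₂ : IsSpaceTimeTest η₂) (h₃ : IsSpaceTimeTest η₃) {a b : ℝ}
    (hsum : ∀ s x, η₃ s x = a * η₁ s x + b * η₂ s x) {t : ℝ} (ht : 0 ≤ t) :
    pairingPrimitive u f₀ f η₃ t =
      a * pairingPrimitive u f₀ f η₁ t + b * pairingPrimitive u f₀ f η₂ t := by
  have hT : 0 ≤ t + 1 := by linarith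
  have hle := le_zero_of_ae_le_zero (g := fun s => |pairingPrimitive u f₀ f η₃ s -
    (a * pairingPrimitive u f₀ f η₁ s + b * pairingPrimitive u f₀ f η₂ s)|) ht
    (((h.continuousOn_pairingPrimitive hu h₃ hT).sub
      (((h.continuousOn_pairingPrimitive hu h₁ hT).const_mul a).add
      ((h.continuousOn_pairingPrimitive hu h₂ hT).const_mul b))).abs) (by
    filter_upwards [h.ae_integral_mul_eq hu h₁, h.ae_integral_mul_eq hu h₂,
      h.ae_integral_mul_eq hu h₃, h.ae_slice] with s e1 e2 e3 ⟨hsm, hsM⟩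
    have hsi : Integrable (f s) := Integrable.of_bound hsm M hsM
    rw [← e1, ← e2, ← e3, ← integral_const_mul, ← integral_const_mul, ← integral_add
      ((hsi.mul_continuous_torus (h₁.isCn s).continuous).const_mul a)
      ((hsi.mul_continuous_torus (h₂.isCn s).continuous).const_mul b), abs_nonpos_iff, sub_eq_zero]
    refine integral_congr_ae (Filter.Eventually.of_forall fun x => ?_)
    simp only [hsum]
    ring)
  exact sub_eq_zero.1 (abs_nonpos_iff.1 hle)

/-- The smooth functions on the torus. -/
def _root_.Torus2.smoothSubmodule : Submodule ℝ (Torus2 → ℝ) where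
  carrier := {ζ | IsCn ⊤ ζ}
  add_mem' := fun h h' => IsCn.add h h'
  zero_mem' := isCn_const 0
  smul_mem' := fun c _ h => IsCn.mul (isCn_const c) h

/-- The bound by `M ‖ζ‖₁` holds at almost every time, where the primitive is a pairing with `f s`,
and hence at `t` by continuity. The dual of `L¹` then provides the slice. -/
theorem exists_slice (h : IsSpaceTimeSolution u f₀ f M) (hM : 0 ≤ M)
    (hu : IsLocallyIntegrableVelocity u) {t : ℝ} (ht : 0 ≤ t) :
    ∃ k : Torus2 → ℝ, AEStronglyMeasurable k volume ∧ (∀ᵐ x, |k x| ≤ M) ∧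
      ∀ ζ, IsCn ⊤ ζ → ∫ x, k x * ζ x = pairingPrimitive u f₀ f (fun _ => ζ) t := by
  have hT : 0 ≤ t + 1 := by linarith
  set ℓ : smoothSubmodule →ₗ[ℝ] ℝ :=
    { toFun := fun ζ => pairingPrimitive u f₀ f (fun _ => ζ.1) t
      map_add' := fun ζ ζ' => by
        have := h.pairingPrimitive_linear hu (isSpaceTimeTest_of_isCn ζ.2)
          (isSpaceTimeTest_of_isCn ζ'.2) (isSpaceTimeTest_of_isCn (ζ + ζ').2) (a := 1) (b := 1)
          (fun s x => by simp) ht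
        simpa using this
      map_smul' := fun c ζ => by
        have := h.pairingPrimitive_linear hu (isSpaceTimeTest_of_isCn ζ.2)
          (isSpaceTimeTest_of_isCn ζ.2) (isSpaceTimeTest_of_isCn (c • ζ).2) (a := c) (b := 0)
          (fun s x => by simp) ht
        simpa using this } with hℓ
  obtain ⟨k, hk, hkM, e⟩ := exists_bounded_representation (μ := (volume : Measure Torus2))
    smoothSubmodule.subtype (fun ζ => integrable_of_continuous (IsCn.continuous ζ.2)) ℓ hM
    fun ζ => by
      have hζ := isSpaceTimeTest_of_isCn ζ.2
      have hle := le_zero_of_ae_le_zero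
        (g := fun s => |pairingPrimitive u f₀ f (fun _ => ζ.1) s| - M * ∫ x, |ζ.1 x|) ht
        ((h.continuousOn_pairingPrimitive hu hζ hT).abs.sub continuousOn_const) (by
          filter_upwards [h.ae_integral_mul_eq hu hζ, h.ae_slice] with s e1 ⟨_, hsM⟩
          rw [← e1, sub_nonpos]
          exact abs_integral_mul_le hsM (IsCn.continuous ζ.2))
      exact sub_nonpos.1 hle
  exact ⟨k, hk, hkM, fun ζ hζ => (e ⟨ζ, hζ⟩).symm⟩

theorem _root_.Torus2.ae_eq_of_integral_mFourier_eq {k k' : Torus2 → ℝ} (hk : MemLp k 2 volume)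
    (hk' : MemLp k' 2 volume)
    (hre : ∀ n, ∫ x, k x * (UnitAddTorus.mFourier n x).re =
      ∫ x, k' x * (UnitAddTorus.mFourier n x).re)
    (him : ∀ n, ∫ x, k x * (UnitAddTorus.mFourier n x).im =
      ∫ x, k' x * (UnitAddTorus.mFourier n x).im) : k =ᵐ[volume] k' := by
  have hd := hk.sub hk'
  have hi : Integrable k := hk.integrable (by norm_num)
  have hi' : Integrable k' := hk'.integrable (by norm_num)
  have hz : ∀ n, ‖fourierCoef (k - k') n‖ ^ 2 = 0 := by
    intro n
    rw [sq_norm_fourierCoef (hi.sub hi')]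
    simp only [Pi.sub_apply, sub_mul]
    rw [integral_sub (hi.mul_continuous_torus (isCn_mFourier_re _).continuous)
        (hi'.mul_continuous_torus (isCn_mFourier_re _).continuous),
      integral_sub (hi.mul_continuous_torus (isCn_mFourier_im _).continuous)
        (hi'.mul_continuous_torus (isCn_mFourier_im _).continuous), hre, him]
    simp
  have hs := hasSum_sq_fourierCoef hd
  simp only [hz] at hs
  have h0 := (integral_eq_zero_iff_of_nonneg (fun x => sq_nonneg _) hd.integrable_sq).1
    (hs.unique hasSum_zero)
  filter_upwards [h0] with x hx
  exact sub_eq_zero.1 (pow_eq_zero_iff (two_ne_zero)|>.1 hx)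

/-- The slices `k t` satisfy the equation at every time but come from independent choices in `t`;
`f` is jointly measurable but correct only at almost every time. The two are glued. -/
theorem exists_isTransportSolution (h : IsSpaceTimeSolution u f₀ f M) (hM : 0 ≤ M)
    (hu : IsLocallyIntegrableVelocity u) : ∃ g, IsTransportSolution u f₀ g := by
  classical
  have hex : ∀ t, ∃ k : Torus2 → ℝ, 0 ≤ t → AEStronglyMeasurable k volume ∧ (∀ᵐ x, |k x| ≤ M) ∧
      ∀ ζ, IsCn ⊤ ζ → ∫ x, k x * ζ x = pairingPrimitive u f₀ f (fun _ => ζ) t := fun t => by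
    by_cases ht : 0 ≤ t
    · obtain ⟨k, hk⟩ := h.exists_slice hM hu ht
      exact ⟨k, fun _ => hk⟩
    · exact ⟨0, fun h => absurd h ht⟩
  choose k hk using hex
  -- Only the countably many Fourier modes are tested, so that one null set of times serves for all
  -- of them.
  have hkf : ∀ᵐ s ∂(volume.restrict (Ici (0 : ℝ))), f s =ᵐ[volume] k s := by
    have hre := fun n => h.ae_integral_mul_eq hu (isSpaceTimeTest_of_isCn (isCn_mFourier_re n))
    have him := fun n => h.ae_integral_mul_eq hu (isSpaceTimeTest_of_isCn (isCn_mFourier_im n))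
    filter_upwards [ae_all_iff.2 hre, ae_all_iff.2 him, h.ae_slice,
      ae_restrict_mem measurableSet_Ici] with s h1 h2 ⟨h3, h4⟩ h5
    obtain ⟨h6, h7, h8⟩ := hk s h5
    refine ae_eq_of_integral_mFourier_eq (MemLp.of_bound h3 M h4) (MemLp.of_bound h6 M h7)
      (fun n => ?_) fun n => ?_
    · rw [h1, h8 _ (isCn_mFourier_re n)]
    · rw [h2, h8 _ (isCn_mFourier_im n)]
  -- Keeping `f t` wherever it agrees with `k t` makes `g` differ from `f` only on a null set of
  -- times, which preserves joint measurability.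
  set g : ℝ → Torus2 → ℝ := fun t => if f t =ᵐ[volume] k t then f t else k t with hg
  have hgk : ∀ t, g t =ᵐ[volume] k t := fun t => by
    simp only [hg]
    split_ifs with hc
    · exact hc
    · rfl
  have hgf : ∀ᵐ s ∂(volume.restrict (Ici (0 : ℝ))), g s = f s := by
    filter_upwards [hkf] with s hs
    simp only [hg, if_pos hs]
  refine ⟨g, ?_, fun t ht => (hk t ht).1.congr (hgk t).symm, fun T => ⟨M, fun t ht => ?_⟩,
    fun η hη t ht => ?_⟩
  · refine h.measurable.congr ?_
    have := Measure.quasiMeasurePreserving_fst (μ := volume.restrict (Ici (0 : ℝ)))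
      (ν := (volume : Measure Torus2)) |>.ae hgf
    filter_upwards [this] with p hp
    rw [hp]
  · filter_upwards [hgk t, (hk t ht.1).2.1] with x hx hx'
    rwa [hx]
  · have hT : 0 ≤ t + 1 := by linarith
    have hηt := isSpaceTimeTest_of_isCn (hη.isCn t)
    have e1 : ∫ x, g t x * η t x = pairingPrimitive u f₀ f (fun _ => η t) t := by
      rw [← (hk t ht).2.2 _ (hη.isCn t)]
      refine integral_congr_ae ?_
      filter_upwards [hgk t] with x hx
      rw [hx]
    have hint : Continuous fun s => ∫ x, |η s x - η t x| := by
      have hc : Continuous (Function.uncurry fun (s : ℝ) (x : Torus2) => |η s x - η t x|) :=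
        (hη.continuous.sub ((hη.isCn t).continuous.comp continuous_snd)).abs
      simpa using continuous_parametric_integral_of_continuous (μ := (volume : Measure Torus2))
        hc isCompact_univ
    -- The slice was built from time-independent test functions, so `η` is frozen at time `t`. At
    -- almost every `s` the error is at most `M ∫ |η s - η t|`, and this bound vanishes at `s = t`.
    have e2 : pairingPrimitive u f₀ f (fun _ => η t) t = pairingPrimitive u f₀ f η t := by
      have hle := le_zero_of_ae_le_zero (g := fun s => |pairingPrimitive u f₀ f η s -
        pairingPrimitive u f₀ f (fun _ => η t) s| - M * ∫ x, |η s x - η t x|) ht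
        (((h.continuousOn_pairingPrimitive hu hη hT).sub
          (h.continuousOn_pairingPrimitive hu hηt hT)).abs.sub
          (continuous_const.mul hint).continuousOn) (by
        filter_upwards [h.ae_integral_mul_eq hu hη, h.ae_integral_mul_eq hu hηt, h.ae_slice]
          with s h1 h2 ⟨h3, h4⟩
        have hsi : Integrable (f s) := Integrable.of_bound h3 M h4
        rw [← h1, ← h2, ← integral_sub (hsi.mul_continuous_torus (hη.isCn s).continuous)
          (hsi.mul_continuous_torus (hη.isCn t).continuous), sub_nonpos]
        simp only [← mul_sub]
        exact abs_integral_mul_le h4 ((hη.isCn s).continuous.sub (hη.isCn t).continuous))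
      simp only [sub_self, abs_zero, integral_zero, mul_zero, sub_zero] at hle
      exact (sub_eq_zero.1 (abs_nonpos_iff.1 hle)).symm
    rw [e1, e2, pairingPrimitive, add_sub_cancel_left]
    refine intervalIntegral.integral_congr_ae ?_
    have := (ae_restrict_iff' measurableSet_Ici).1 hgf
    filter_upwards [this] with s hs hst
    rw [uIoc_of_le ht] at hst
    rw [hs (le_of_lt hst.1)]
    rfl

end IsSpaceTimeSolution

theorem exists_isTransportSolution (hu : IsLocallyIntegrableVelocity u)
    (hdiv : IsDivergenceFreeVelocity u) {f₀ : Torus2 → ℝ} (hf₀ : Continuous f₀) :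
    ∃ g, IsTransportSolution u f₀ g := by
  obtain ⟨M, hM0, hM⟩ := hf₀.exists_forall_abs_le
  obtain ⟨f, hfm, hfM, hf⟩ := exists_spaceTime_solution hu hdiv (integrable_of_continuous hf₀) hM0
    (Filter.Eventually.of_forall hM)
  exact IsSpaceTimeSolution.exists_isTransportSolution (f := fun t x => f (t, x)) ⟨hfm, hfM, hf⟩
    hM0 hu

end Torus2

/-! ### Lagrangian representation of the vorticity. -/

theorem mainTheorem7 (K : ℕ) (hK : 2 ≤ K) (α : ℝ≥0) (hα0 : 0 < α) (hα1 : α < 1)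
    (F : (Fin K → ℝ) → ℝ) (hF : ContDiff ℝ (⊤ : ℕ∞) F)
    (φin : Fin K → Torus2 → ℝ) (hφin : ∀ k, Torus2.IsC1Holder α (φin k))
    (ω : ℝ → Torus2 → ℝ) (u : ℝ → Torus2 → Fin 2 → ℝ)
    (hω : Torus2.IsYudovichSolution (fun x => F (fun k => φin k x)) ω u) :
    (∃ φ : Fin K → ℝ → Torus2 → ℝ, ∀ k, Torus2.IsTransportSolution u (φin k) (φ k)) ∧
    ∀ φ : Fin K → ℝ → Torus2 → ℝ,
      (∀ k, Torus2.IsTransportSolution u (φin k) (φ k)) →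
      ∀ t, 0 ≤ t → ∀ᵐ x, ω t x = F (fun k => φ k t x) := by
  have hu : Torus2.IsLocallyIntegrableVelocity u := hω.integrable_velocity
  have hφc : ∀ k, Continuous (φin k) := fun k => (hφin k).1.continuous
  have hdiv : Torus2.IsDivergenceFreeVelocity u := fun s hs =>
    ⟨fun i => ((hω.biotSavart s hs).memLp i).integrable (by norm_num),
      fun η hη => (hω.biotSavart s hs).integral_divergence hη⟩
  refine ⟨?_, fun φ hφ t ht => ?_⟩
  · choose φ hφ using fun k => Torus2.exists_isTransportSolution hu hdiv (hφc k)
    exact ⟨φ, hφ⟩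
  obtain ⟨M, hM⟩ := hω.transport.bounded t
  have hC : ∀ s ∈ Icc 0 t, Torus2.IsSobolevVelocity (16 * M ^ 2) (u s) := fun s hs =>
    ⟨(hω.biotSavart s hs.1).memLp, fun η hη => (hω.biotSavart s hs.1).integral_divergence hη,
      (hω.biotSavart s hs.1).sqIncrement_le (hω.transport.measurable_slice s hs.1) (hM s hs)⟩
  -- The index `none` carries the vorticity and `some k` the markers, so renormalization applies to
  -- all of them jointly.
  set f₀ : Option (Fin K) → Torus2 → ℝ := fun j => j.elim (fun x => F fun k => φin k x) φin with hf₀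
  set f : Option (Fin K) → ℝ → Torus2 → ℝ := fun j => j.elim ω φ with hf
  have hf₀c : ∀ j, Continuous (f₀ j) := by
    rintro (_ | k)
    · exact hF.continuous.comp (continuous_pi hφc)
    · exact hφc k
  have hsol : ∀ j, Torus2.IsTransportSolution u (f₀ j) (f j) := by
    rintro (_ | k)
    · exact hω.transport
    · exact hφ k
  -- The squared defect: it vanishes identically on the initial data, and a zero integral at time
  -- `t` forces it to vanish almost everywhere.
  set Φ : (Option (Fin K) → ℝ) → ℝ := fun a => (a none - F fun k => a (some k)) ^ 2 with hΦ
  have hΦs : ContDiff ℝ (⊤ : ℕ∞) Φ :=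
    ((contDiff_apply ℝ ℝ none).sub (hF.comp (contDiff_pi.2 fun k =>
      contDiff_apply ℝ ℝ (some k)))).pow 2
  have key := Torus2.integral_comp_eq_of_isTransportSolution hu ht hC hsol
    (fun j => (hf₀c j).aestronglyMeasurable)
    (fun j => (hf₀c j).exists_forall_abs_le.imp fun m hm => Filter.Eventually.of_forall hm.2) hΦs
  have h0 : ∫ x, Φ (fun j => f j t x) = 0 := by
    rw [key]
    simp [hΦ, hf₀]
  have hmeas : AEStronglyMeasurable (fun x => Φ fun j => f j t x) volume :=
    hΦs.continuous.comp_aestronglyMeasurable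
      (Torus2.aestronglyMeasurable_pi_of_apply fun j => (hsol j).measurable_slice t ht)
  have hint : Integrable fun x => Φ fun j => f j t x := by
    choose m hm using fun j => (hsol j).bounded t
    obtain ⟨B, hB⟩ :=
      (isCompact_univ_pi fun j => isCompact_Icc (a := -m j) (b := m j)).exists_bound_of_continuousOn
      hΦs.continuous.continuousOn
    refine Integrable.of_bound hmeas B ?_
    filter_upwards [ae_all_iff.2 fun j => hm j t ⟨ht, le_rfl⟩] with x hx
    exact hB _ fun j _ => abs_le.1 (hx j)
  have hz := (integral_eq_zero_iff_of_nonneg (fun x => sq_nonneg _) hint).1 h0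
  filter_upwards [hz] with x hx
  exact sub_eq_zero.1 ((pow_eq_zero_iff two_ne_zero).1 hx)
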